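/- Let $M$ be a compact connected surface and $\Sigma\subset M$ a finite set, with a translation structure: an atlas on $M-\Sigma$ with values in $\mathbb{C}$ whose coordinate changes are locally of the form $x\mapsto x+v$, such that around each point of $\Sigma$ the surface is isomorphic to a finite ramified cover $z\mapsto z^d$ ($d\ge 1$) of $\mathbb{C}$ around $0$. Let $T:M\to M$ be a linear pseudo-Anosov map preserving orientations, with expansion factor $\lambda>1$: a homeomorphism with $T(\Sigma)=\Sigma$ which, in translation charts around $x$ and $Tx$ for every $x\in M-\Sigma$, is of the form $\left(\begin{smallmatrix}\lambda&0\\0&\lambda^{-1}\end{smallmatrix}\right)$ up to translations. Let $C^\infty_c(M-\Sigma)$ be the space of complex-valued $C^\infty$ functions on $M-\Sigma$ that vanish on a neighborhood of $\Sigma$, and let $L_v$ be the derivative in the vertical direction $\mathbf{i}$ of the charts. Fix a real number $\beta>0$, a real number $k_h\ge 0$ and an integer $k_v\ge 0$. Let $\mathcal{I}^h$ be the set of horizontal segments of length $\beta$ in $M-\Sigma$, and for $I\in\mathcal{I}^h$ let $C^{k_h}_c(I)$ be the space of $C^{k_h}$ functions on $I$ vanishing on a neighborhood of the endpoints, with the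 $C^{k_h}$ norm (when $k_h$ is not an integer: $C^{\lfloor k_h\rfloor}$ functions whose $\lfloor k_h\rfloor$-th derivative is Hölder continuous of exponent $k_h-\lfloor k_h\rfloor$). Let $\mathcal{B}^{-k_h,k_v}$ be the completion of $C^\infty_c(M-\Sigma)$ for the norm $$\|f\|_{-k_h,k_v}=\sup_{j\le k_v}\ \sup_{I\in\mathcal{I}^h}\ \sup_{\phi\in C^{k_h}_c(I),\ \|\phi\|_{C^{k_h}}\le 1}\left|\int_I\phi\cdot L_v^jf\,dx\right|.$$ Then the composition operator $f\mapsto f\circ T$ on $C^\infty_c(M-\Sigma)$ extends to a bounded linear operator $\mathcal{T}$ on $\mathcal{B}^{-k_h,k_v}$. The spectral radius of $\mathcal{T}$ is at most $1$, and its essential spectral radius is at most $\lambda^{-\min(k_h,k_v)}$. Here the essential spectral radius is the supremum of $|z|$ over all $z$ in the spectrum of $\mathcal{T}$ that are not isolated eigenvalues of finite algebraic multiplicity (and $0$ if there are none). -/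

import Mathlib

open Set Filter Topology
open scoped NNReal ENNReal ContDiff

noncomputable section

/-! ### Translation surfaces -/

/-- A translation structure on a space `M` (a compact connected Hausdorff space in all
applications) with finite singularity set `sing`: an atlas of charts `M → ℂ` covering `M - sing`
whose coordinate changes are locally translations, such that around each singularity the structure
is isomorphic to a finite ramified cover `z ↦ z ^ d` of the plane around `0`.
These conditions force `M` to be a topological surface. -/
structure TranslationSurface (M : Type*) [TopologicalSpace M] where
  /-- the singularity set -/
  sing : Set M
  finite_sing : sing.Finite
  /-- the translation charts -/
  atlas : Set (OpenPartialHomeomorph M ℂ)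
  source_subset : ∀ e ∈ atlas, e.source ⊆ singᶜ
  cover : ∀ x ∉ sing, ∃ e ∈ atlas, x ∈ e.source
  translation : ∀ e ∈ atlas, ∀ e' ∈ atlas, ∀ x ∈ e.source, x ∈ e'.source →
    ∀ᶠ y in 𝓝 x, e' y - e' x = e y - e x
  ramified : ∀ σ ∈ sing, ∃ d : ℕ, 0 < d ∧ ∃ h : OpenPartialHomeomorph M ℂ,
    σ ∈ h.source ∧ h σ = 0 ∧
    ∀ x ∈ h.source, x ≠ σ → ∀ e ∈ atlas, x ∈ e.source →
      ∀ᶠ y in 𝓝 x, e y - e x = h y ^ d - h x ^ d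

/-- A homeomorphism `T` of `M` is a linear pseudo-Anosov map preserving orientations, with
expansion factor `lam > 1`: it preserves the singularity set and it reads
`x + i y ↦ lam x + i lam⁻¹ y`, up to translations, in the translation charts. -/
structure IsLinearPseudoAnosov {M : Type*} [TopologicalSpace M] (S : TranslationSurface M)
    (T : M ≃ₜ M) (lam : ℝ) : Prop where
  one_lt : 1 < lam
  image_sing : T '' S.sing = S.sing
  linear : ∀ e ∈ S.atlas, ∀ e' ∈ S.atlas, ∀ x ∈ e.source, T x ∈ e'.source →
    ∀ᶠ y in 𝓝 x, e' (T y) - e' (T x) =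
      ((lam * (e y - e x).re : ℝ) : ℂ) + ((lam⁻¹ * (e y - e x).im : ℝ) : ℂ) * Complex.I

namespace TranslationSurface

variable {M : Type*} [TopologicalSpace M] (S : TranslationSurface M)

/-- `C^∞_c(M - Σ)`: complex functions which are smooth in the translation charts
and vanish on a neighborhood of the singularities (`M` being compact). -/
def smoothFun : Submodule ℂ (M → ℂ) where
  carrier := {f | (∀ e ∈ S.atlas, ContDiffOn ℝ ∞ (f ∘ e.symm) e.target) ∧
    ∀ σ ∈ S.sing, ∀ᶠ y in 𝓝 σ, f y = 0}
  add_mem' := fun {f g} hf hg =>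
    ⟨fun e he => (hf.1 e he).add (hg.1 e he), fun σ hσ => by
      filter_upwards [hf.2 σ hσ, hg.2 σ hσ] with y h1 h2
      simp [h1, h2]⟩
  zero_mem' := ⟨fun _ _ => contDiffOn_const, fun _ _ => Eventually.of_forall fun _ => rfl⟩
  smul_mem' := fun c f hf =>
    ⟨fun e he => contDiffOn_const.smul (hf.1 e he), fun σ hσ => by
      filter_upwards [hf.2 σ hσ] with y h1
      simp [h1]⟩

open Classical in
/-- The vertical derivative of a function: at a point of `M - Σ`, the derivative
in the direction `i` in a translation chart (the choice of the chart is irrelevant);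
by convention `0` on `Σ`. -/
def vertDeriv (f : M → ℂ) (x : M) : ℂ :=
  if hx : x ∉ S.sing then
    lineDeriv ℝ (f ∘ (S.cover x hx).choose.symm) ((S.cover x hx).choose x) Complex.I
  else 0

variable {S}

theorem symm_eventuallyEq {e e' : OpenPartialHomeomorph M ℂ} (he : e ∈ S.atlas)
    (he' : e' ∈ S.atlas) {x : M} (hx : x ∈ e.source) (hx' : x ∈ e'.source) :
    ∀ᶠ w in 𝓝 (e' x), e'.symm w = e.symm (w + (e x - e' x)) := by
  have hc : Tendsto e'.symm (𝓝 (e' x)) (𝓝 x) := by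
    have := (e'.continuousAt_symm (e'.map_source hx')).tendsto
    rwa [e'.left_inv hx'] at this
  filter_upwards [hc.eventually (S.translation e he e' he' x hx hx'),
    hc.eventually (e.open_source.mem_nhds hx),
    e'.open_target.mem_nhds (e'.map_source hx')] with w h1 h2 h3
  rw [e'.right_inv h3] at h1
  have : w + (e x - e' x) = e (e'.symm w) := by linear_combination h1
  rw [this, e.left_inv h2]

/-- The vertical derivative can be computed in any translation chart. -/
theorem vertDeriv_eq (f : M → ℂ) {e : OpenPartialHomeomorph M ℂ} (he : e ∈ S.atlas) {x : M}
    (hx : x ∈ e.source) :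
    S.vertDeriv f x = lineDeriv ℝ (f ∘ e.symm) (e x) Complex.I := by
  have hxs : x ∉ S.sing := S.source_subset e he hx
  rw [vertDeriv, dif_pos hxs]
  generalize_proofs h
  obtain ⟨he', hx'⟩ := h.choose_spec
  set e' := h.choose
  have key := symm_eventuallyEq he he' hx hx'
  unfold lineDeriv
  apply Filter.EventuallyEq.deriv_eq
  have ht : Tendsto (fun t : ℝ => e' x + t • Complex.I) (𝓝 0) (𝓝 (e' x)) := by
    have : Continuous (fun t : ℝ => e' x + t • Complex.I) := by fun_prop
    simpa using this.tendsto 0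
  filter_upwards [ht.eventually key] with t h
  simp only [Function.comp, h]
  congr 2
  ring

theorem vertDeriv_comp_symm (f : M → ℂ) {e : OpenPartialHomeomorph M ℂ} (he : e ∈ S.atlas)
    {w : ℂ} (hw : w ∈ e.target) :
    (S.vertDeriv f ∘ e.symm) w = lineDeriv ℝ (f ∘ e.symm) w Complex.I := by
  rw [Function.comp, vertDeriv_eq f he (e.map_target hw), e.right_inv hw]

theorem differentiableAt_of_mem {f : M → ℂ} (hf : f ∈ S.smoothFun)
    {e : OpenPartialHomeomorph M ℂ} (he : e ∈ S.atlas) {w : ℂ} (hw : w ∈ e.target) :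
    DifferentiableAt ℝ (f ∘ e.symm) w :=
  ((hf.1 e he).contDiffAt (e.open_target.mem_nhds hw)).differentiableAt (by simp)

theorem vertDeriv_mem {f : M → ℂ} (hf : f ∈ S.smoothFun) : S.vertDeriv f ∈ S.smoothFun := by
  refine ⟨fun e he => ?_, fun σ hσ => ?_⟩
  · have h1 : ContDiffOn ℝ ∞ (fun w => fderiv ℝ (f ∘ e.symm) w Complex.I) e.target :=
      ((hf.1 e he).fderiv_of_isOpen e.open_target (by simp)).clm_apply contDiffOn_const
    refine h1.congr fun w hw => ?_
    rw [vertDeriv_comp_symm f he hw, (differentiableAt_of_mem hf he hw).lineDeriv_eq_fderiv]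
  · have h := eventually_eventually_nhds.2 (hf.2 σ hσ)
    filter_upwards [h] with y hy
    by_cases hys : y ∈ S.sing
    · simp [vertDeriv, hys]
    · obtain ⟨e, he, hye⟩ := S.cover y hys
      rw [vertDeriv_eq f he hye]
      have hc : Tendsto e.symm (𝓝 (e y)) (𝓝 y) := by
        have := (e.continuousAt_symm (e.map_source hye)).tendsto
        rwa [e.left_inv hye] at this
      have h0 : (f ∘ e.symm) =ᶠ[𝓝 (e y)] fun _ => (0 : ℂ) := hc.eventually hy
      rw [(differentiableAt_of_mem hf he (e.map_source hye)).lineDeriv_eq_fderiv, h0.fderiv_eq]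
      simp

theorem vertDeriv_of_sing (f : M → ℂ) {x : M} (hx : x ∈ S.sing) : S.vertDeriv f x = 0 := by
  simp [vertDeriv, hx]

variable (S) in
/-- The derivation `L_v` acting on `C^∞_c(M - Σ)`. -/
def Lv : S.smoothFun →ₗ[ℂ] S.smoothFun where
  toFun f := ⟨S.vertDeriv f, vertDeriv_mem f.2⟩
  map_add' f g := by
    ext x
    change S.vertDeriv ((f : M → ℂ) + (g : M → ℂ)) x = S.vertDeriv f x + S.vertDeriv g x
    by_cases hx : x ∈ S.sing
    · simp [vertDeriv_of_sing, hx]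
    obtain ⟨e, he, hxe⟩ := S.cover x hx
    have hf := differentiableAt_of_mem f.2 he (e.map_source hxe)
    have hg := differentiableAt_of_mem g.2 he (e.map_source hxe)
    simp only [vertDeriv_eq _ he hxe]
    rw [hf.lineDeriv_eq_fderiv, hg.lineDeriv_eq_fderiv]
    have : ((f : M → ℂ) + (g : M → ℂ)) ∘ e.symm = (f : M → ℂ) ∘ e.symm + (g : M → ℂ) ∘ e.symm := rfl
    rw [this, (hf.add hg).lineDeriv_eq_fderiv, fderiv_add hf hg]
    simp
  map_smul' c f := by
    ext x
    change S.vertDeriv (c • (f : M → ℂ)) x = c • S.vertDeriv f x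
    by_cases hx : x ∈ S.sing
    · simp [vertDeriv_of_sing, hx]
    obtain ⟨e, he, hxe⟩ := S.cover x hx
    have hf := differentiableAt_of_mem f.2 he (e.map_source hxe)
    simp only [vertDeriv_eq _ he hxe]
    rw [hf.lineDeriv_eq_fderiv]
    have : (c • (f : M → ℂ)) ∘ e.symm = c • ((f : M → ℂ) ∘ e.symm) := rfl
    rw [this, (hf.const_smul c).lineDeriv_eq_fderiv, fderiv_const_smul hf]
    simp

theorem continuous_of_mem {f : M → ℂ} (hf : f ∈ S.smoothFun) : Continuous f := by
  rw [continuous_iff_continuousAt]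
  intro x
  by_cases hx : x ∈ S.sing
  · have h := hf.2 x hx
    exact (continuousAt_const (y := (0 : ℂ))).congr (h.mono fun y hy => hy.symm)
  · obtain ⟨e, he, hxe⟩ := S.cover x hx
    have h1 : ContinuousAt ((f ∘ e.symm) ∘ e) x :=
      ContinuousAt.comp (differentiableAt_of_mem hf he (e.map_source hxe)).continuousAt
        (e.continuousAt hxe)
    refine h1.congr ?_
    filter_upwards [e.open_source.mem_nhds hxe] with y hy
    simp [e.left_inv hy]

/-! ### The anisotropic norm -/

variable (S) in
/-- `γ` restricted to `[0, β]` is the (positively oriented, arc-length) parametrization of a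
horizontal segment of length `β` contained in `M - Σ`. -/
structure IsHorizontalSegment (β : ℝ) (γ : ℝ → M) : Prop where
  continuousOn : ContinuousOn γ (Icc 0 β)
  notMem_sing : ∀ t ∈ Icc 0 β, γ t ∉ S.sing
  horizontal : ∀ t ∈ Icc 0 β, ∀ e ∈ S.atlas, γ t ∈ e.source →
    ∀ᶠ s in 𝓝[Icc 0 β] t, e (γ s) - e (γ t) = ((s - t : ℝ) : ℂ)

end TranslationSurface

/-- The `C^k` norm of a function of class `C^⌊k⌋` on the line, for real `k ≥ 0`: the supremum of
the sup norms of the derivatives of order `≤ ⌊k⌋` and, when `k` is not an integer, of the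
`(k - ⌊k⌋)`-Hölder seminorm of the derivative of order `⌊k⌋`. -/
def ckNorm (k : ℝ≥0) (φ : ℝ → ℂ) : ℝ≥0∞ :=
  (⨆ i ≤ ⌊k⌋₊, ⨆ x, ‖iteratedDeriv i φ x‖ₑ) ⊔
    (⨆ _ : (⌊k⌋₊ : ℝ≥0) ≠ k, eHolderNorm (k - ⌊k⌋₊) (iteratedDeriv ⌊k⌋₊ φ))

/-- The unit ball of `C^k_c(I)` where `I` is a segment of length `β` parametrized by `[0, β]`:
functions of class `C^k` vanishing on a neighborhood of the endpoints of `I` (extended by zero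
to the line), with `C^k` norm at most `1`. -/
structure IsUnitTest (k : ℝ≥0) (β : ℝ) (φ : ℝ → ℂ) : Prop where
  contDiff : ContDiff ℝ ⌊k⌋₊ φ
  tsupport_subset : tsupport φ ⊆ Ioo 0 β
  norm_le : ckNorm k φ ≤ 1

namespace TranslationSurface

variable {M : Type*} [TopologicalSpace M] (S : TranslationSurface M)

/-- The integrals `|∫_I φ · (L_v)^j f dx|` over which one takes the supremum in the norm. -/
def testValues (β : ℝ) (kh : ℝ≥0) (kv : ℕ) (f : S.smoothFun) : Set ℝ :=
  {r | ∃ j ≤ kv, ∃ γ, S.IsHorizontalSegment β γ ∧ ∃ φ, IsUnitTest kh β φ ∧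
    r = ‖∫ t in (0 : ℝ)..β, φ t * ((S.Lv ^ j) f : M → ℂ) (γ t)‖}

/-- The norm `‖f‖_{-k_h, k_v}` on `C^∞_c(M - Σ)` (with segments of length `β`). The set is
bounded above, see `bddAbove_testValues`. -/
def anisoNorm (β : ℝ) (kh : ℝ≥0) (kv : ℕ) (f : S.smoothFun) : ℝ :=
  sSup (S.testValues β kh kv f)

variable {S}

theorem IsUnitTest_norm_le {k : ℝ≥0} {β : ℝ} {φ : ℝ → ℂ} (h : IsUnitTest k β φ) (t : ℝ) :
    ‖φ t‖ ≤ 1 := by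
  have h1 : ‖iteratedDeriv 0 φ t‖ₑ ≤ ckNorm k φ :=
    le_sup_of_le_left (le_iSup₂_of_le 0 (Nat.zero_le _)
      (le_iSup (fun x => ‖iteratedDeriv 0 φ x‖ₑ) t))
  have h2 := h1.trans h.norm_le
  rw [iteratedDeriv_zero, ← ofReal_norm, ENNReal.ofReal_le_one] at h2
  exact h2

theorem bddAbove_testValues [CompactSpace M] (β : ℝ) (kh : ℝ≥0) (kv : ℕ) (f : S.smoothFun) :
    BddAbove (S.testValues β kh kv f) := by
  have hb : ∀ j : ℕ, ∃ C : ℝ, ∀ x, ‖((S.Lv ^ j) f : M → ℂ) x‖ ≤ C := fun j => by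
    obtain ⟨C, hC⟩ := (isCompact_range
      (continuous_of_mem ((S.Lv ^ j) f).2).norm).bddAbove
    exact ⟨C, fun x => hC ⟨x, rfl⟩⟩
  choose C hC using hb
  refine ⟨∑ j ∈ Finset.range (kv + 1), |C j| * |β - 0|, ?_⟩
  rintro r ⟨j, hj, γ, -, φ, hφ, rfl⟩
  have h1 : ‖∫ t in (0 : ℝ)..β, φ t * ((S.Lv ^ j) f : M → ℂ) (γ t)‖ ≤ |C j| * |β - 0| := by
    refine intervalIntegral.norm_integral_le_of_norm_le_const fun t _ => ?_
    rw [norm_mul]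
    calc ‖φ t‖ * ‖((S.Lv ^ j) f : M → ℂ) (γ t)‖ ≤ 1 * |C j| :=
          mul_le_mul (IsUnitTest_norm_le hφ t) ((hC j _).trans (le_abs_self _))
            (norm_nonneg _) zero_le_one
      _ = |C j| := one_mul _
  exact h1.trans (Finset.single_le_sum (f := fun j => |C j| * |β - 0|)
    (fun i _ => by positivity) (Finset.mem_range.2 (Nat.lt_succ_of_le hj)))

theorem intervalIntegrable_test {β : ℝ} {kh : ℝ≥0} {γ : ℝ → M} {φ : ℝ → ℂ}
    (hγ : S.IsHorizontalSegment β γ) (hφ : IsUnitTest kh β φ) (g : S.smoothFun) :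
    IntervalIntegrable (fun t => φ t * (g : M → ℂ) (γ t)) MeasureTheory.volume 0 β := by
  rcases le_total 0 β with h | h
  · apply ContinuousOn.intervalIntegrable
    rw [uIcc_of_le h]
    exact hφ.contDiff.continuous.continuousOn.mul
      ((continuous_of_mem g.2).comp_continuousOn hγ.continuousOn)
  · have h0 : ∀ t, φ t = 0 := fun t => by
      by_contra ht
      have := hφ.tsupport_subset (subset_tsupport φ ht)
      exact absurd (this.1.trans this.2) (not_lt.2 h)
    simp [h0]

theorem anisoNorm_nonneg (β : ℝ) (kh : ℝ≥0) (kv : ℕ) (f : S.smoothFun) :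
    0 ≤ S.anisoNorm β kh kv f := by
  apply Real.sSup_nonneg
  rintro r ⟨j, _, γ, _, φ, _, rfl⟩
  exact norm_nonneg _

variable [CompactSpace M]

theorem anisoNorm_add_le (β : ℝ) (kh : ℝ≥0) (kv : ℕ) (f g : S.smoothFun) :
    S.anisoNorm β kh kv (f + g) ≤ S.anisoNorm β kh kv f + S.anisoNorm β kh kv g := by
  refine Real.sSup_le ?_ (add_nonneg (anisoNorm_nonneg _ _ _ _) (anisoNorm_nonneg _ _ _ _))
  rintro r ⟨j, hj, γ, hγ, φ, hφ, rfl⟩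
  have h1 : (∫ t in (0 : ℝ)..β, φ t * ((S.Lv ^ j) (f + g) : M → ℂ) (γ t)) =
      (∫ t in (0 : ℝ)..β, φ t * ((S.Lv ^ j) f : M → ℂ) (γ t)) +
        ∫ t in (0 : ℝ)..β, φ t * ((S.Lv ^ j) g : M → ℂ) (γ t) := by
    rw [← intervalIntegral.integral_add (intervalIntegrable_test hγ hφ _)
      (intervalIntegrable_test hγ hφ _)]
    simp [map_add, mul_add]
  rw [h1]
  exact (norm_add_le _ _).trans (add_le_add
    (le_csSup (bddAbove_testValues β kh kv f) ⟨j, hj, γ, hγ, φ, hφ, rfl⟩)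
    (le_csSup (bddAbove_testValues β kh kv g) ⟨j, hj, γ, hγ, φ, hφ, rfl⟩))

theorem anisoNorm_smul_le (β : ℝ) (kh : ℝ≥0) (kv : ℕ) (c : ℂ) (f : S.smoothFun) :
    S.anisoNorm β kh kv (c • f) ≤ ‖c‖ * S.anisoNorm β kh kv f := by
  refine Real.sSup_le ?_ (mul_nonneg (norm_nonneg _) (anisoNorm_nonneg _ _ _ _))
  rintro r ⟨j, hj, γ, hγ, φ, hφ, rfl⟩
  have h1 : (∫ t in (0 : ℝ)..β, φ t * ((S.Lv ^ j) (c • f) : M → ℂ) (γ t)) =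
      c * ∫ t in (0 : ℝ)..β, φ t * ((S.Lv ^ j) f : M → ℂ) (γ t) := by
    rw [← intervalIntegral.integral_const_mul]
    congr 1
    ext t
    simp only [map_smul, Submodule.coe_smul, Pi.smul_apply, smul_eq_mul]
    ring
  rw [h1, norm_mul]
  exact mul_le_mul_of_nonneg_left
    (le_csSup (bddAbove_testValues β kh kv f) ⟨j, hj, γ, hγ, φ, hφ, rfl⟩) (norm_nonneg _)

variable (S) in
/-- The norm `‖·‖_{-k_h, k_v}`, as a bundled seminorm. -/
def anisoSeminorm (β : ℝ) (kh : ℝ≥0) (kv : ℕ) : Seminorm ℂ S.smoothFun :=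
  Seminorm.ofSMulLE (S.anisoNorm β kh kv)
    (le_antisymm (by simpa using anisoNorm_smul_le β kh kv 0 (0 : S.smoothFun))
      (anisoNorm_nonneg β kh kv _))
    (anisoNorm_add_le β kh kv) (anisoNorm_smul_le β kh kv)

/-- The space `C^∞_c(M - Σ)`, endowed with the norm `‖·‖_{-k_h, k_v}`. -/
def NormedSmoothFun {M : Type*} [TopologicalSpace M] [CompactSpace M] (S : TranslationSurface M)
    (_β : ℝ) (_kh : ℝ≥0) (_kv : ℕ) : Type _ :=
  S.smoothFun

instance (β : ℝ) (kh : ℝ≥0) (kv : ℕ) : SeminormedAddCommGroup (S.NormedSmoothFun β kh kv) :=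
  (S.anisoSeminorm β kh kv).toAddGroupSeminorm.toSeminormedAddCommGroup

instance (β : ℝ) (kh : ℝ≥0) (kv : ℕ) : NormedSpace ℂ (S.NormedSmoothFun β kh kv) where
  toModule := inferInstanceAs (Module ℂ S.smoothFun)
  norm_smul_le := anisoNorm_smul_le β kh kv

variable (S) in
/-- The space `B^{-k_h, k_v}`: the completion of `C^∞_c(M - Σ)` for the norm
`‖·‖_{-k_h, k_v}` (defined with horizontal segments of length `β`). -/
abbrev AnisotropicSpace (β : ℝ) (kh : ℝ≥0) (kv : ℕ) : Type _ :=
  UniformSpace.Completion (S.NormedSmoothFun β kh kv)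

variable (S) in
/-- The canonical map `C^∞_c(M - Σ) → B^{-k_h, k_v}`. -/
def toAnisotropic (β : ℝ) (kh : ℝ≥0) (kv : ℕ) (f : S.smoothFun) : S.AnisotropicSpace β kh kv :=
  UniformSpace.Completion.coe' (α := S.NormedSmoothFun β kh kv) f

end TranslationSurface

/-! ### Composition with `T` -/

namespace IsLinearPseudoAnosov

variable {M : Type*} [TopologicalSpace M] {S : TranslationSurface M} {T : M ≃ₜ M} {lam : ℝ}

theorem map_mem_sing (hT : IsLinearPseudoAnosov S T lam) {x : M} : T x ∈ S.sing ↔ x ∈ S.sing := by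
  constructor
  · intro h
    rw [← hT.image_sing] at h
    obtain ⟨y, hy, hyx⟩ := h
    rwa [← T.injective hyx]
  · intro h
    rw [← hT.image_sing]
    exact ⟨x, h, rfl⟩

theorem comp_mem (hT : IsLinearPseudoAnosov S T lam) {f : M → ℂ} (hf : f ∈ S.smoothFun) :
    f ∘ T ∈ S.smoothFun := by
  refine ⟨fun e he w hw => ContDiffAt.contDiffWithinAt ?_, fun σ hσ => ?_⟩
  · set x := e.symm w with hx
    have hxe : x ∈ e.source := e.map_target hw
    have hTx : T x ∉ S.sing := fun h => S.source_subset e he hxe (hT.map_mem_sing.1 h)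
    obtain ⟨e', he', hxe'⟩ := S.cover _ hTx
    let A : ℂ → ℂ := fun z => e' (T x) + (((lam * (z - w).re : ℝ) : ℂ) +
      ((lam⁻¹ * (z - w).im : ℝ) : ℂ) * Complex.I)
    have hA : ContDiff ℝ ∞ A := by
      have h1 : ContDiff ℝ ∞ fun z : ℂ => ((lam * (z - w).re : ℝ) : ℂ) :=
        Complex.ofRealCLM.contDiff.comp (contDiff_const.mul
          (Complex.reCLM.contDiff.comp (contDiff_id.sub contDiff_const)))
      have h2 : ContDiff ℝ ∞ fun z : ℂ => ((lam⁻¹ * (z - w).im : ℝ) : ℂ) :=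
        Complex.ofRealCLM.contDiff.comp (contDiff_const.mul
          (Complex.imCLM.contDiff.comp (contDiff_id.sub contDiff_const)))
      exact contDiff_const.add (h1.add (h2.mul contDiff_const))
    have hAw : A w = e' (T x) := by simp [A]
    have hfe : ContDiffAt ℝ ∞ (f ∘ e'.symm) (A w) := by
      rw [hAw]
      exact (hf.1 e' he').contDiffAt (e'.open_target.mem_nhds (e'.map_source hxe'))
    refine (hfe.comp w hA.contDiffAt).congr_of_eventuallyEq ?_
    have hc : Tendsto e.symm (𝓝 w) (𝓝 x) := (e.continuousAt_symm hw).tendsto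
    have hc' : Tendsto (fun z => T (e.symm z)) (𝓝 w) (𝓝 (T x)) :=
      (T.continuous.tendsto x).comp hc
    filter_upwards [hc.eventually (hT.linear e he e' he' x hxe hxe'),
      hc'.eventually (e'.open_source.mem_nhds hxe'), e.open_target.mem_nhds hw] with z h1 h2 h3
    have hex : e x = w := e.right_inv hw
    rw [e.right_inv h3, hex] at h1
    have : A z = e' (T (e.symm z)) := by
      simp only [A]
      rw [← h1]
      ring
    simp [this, e'.left_inv h2]
  · have h := hf.2 (T σ) (hT.map_mem_sing.2 hσ)
    exact (T.continuous.tendsto σ).eventually h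

/-- The composition `f ↦ f ∘ T` on `C^∞_c(M - Σ)`. -/
def comp (hT : IsLinearPseudoAnosov S T lam) (f : S.smoothFun) : S.smoothFun :=
  ⟨(f : M → ℂ) ∘ T, hT.comp_mem f.2⟩

end IsLinearPseudoAnosov

/-! ### Essential spectral radius -/

/-- The essential spectrum of a bounded operator `A` on a complex Banach space: the complex numbers
which are neither in the resolvent set nor isolated points of the spectrum that are eigenvalues of
finite algebraic multiplicity. The latter two possibilities together mean that the space is a
topological direct sum of two `A`-invariant subspaces, one of them finite-dimensional and the other
one such that `A - z` is bijective on it. -/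
def essSpectrum {E : Type*} [NormedAddCommGroup E] [NormedSpace ℂ E] (A : E →L[ℂ] E) : Set ℂ :=
  {z | ¬ ∃ d : FredholmDecomposition ℂ E,
    MapsTo A d.X₀ d.X₀ ∧ MapsTo A d.X₁ d.X₁ ∧ BijOn (fun v => A v - z • v) d.X₁ d.X₁}

/-- The essential spectral radius: the supremum of the moduli of the elements of the essential
spectrum. Equivalently, the infimum of the `r` such that the spectrum outside of the disk of
radius `r` is made of isolated eigenvalues of finite multiplicity. -/
def essSpectralRadius {E : Type*} [NormedAddCommGroup E] [NormedSpace ℂ E] (A : E →L[ℂ] E) :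
    ℝ≥0∞ :=
  ⨆ z ∈ essSpectrum A, ‖z‖ₑ

end

/-! Two arguments meet: a Lasota–Yorke inequality for composition with `T`, and an abstract theorem
of Hennion type which converts contraction on subspaces of finite codimension into a bound on the
essential spectral radius.

Lasota–Yorke (`exists_lasotaYorke`). Transporting `∫_I φ · L_v^j (f ∘ T)` to the segment `T I`, of
length `λβ`, produces a factor `λ^(-j)` from the vertical derivatives, a Jacobian `λ^(-1)`, and the
test function `φ(λ^(-1) ·)`. A smooth partition of unity cuts `T I` into about `λβ/δ` pieces of
fixed length `δ`, a number which the Jacobian compensates. On each piece the stretched test function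
is replaced by its Taylor polynomial of degree `⌊k_h⌋`. The remainder has `C^{k_h}` size of order
`λ^(-k_h)`, and the polynomial involves only the finitely many fixed test functions `taylorWindow`.
For `j = k_v` this polynomial part carries the factor `λ^(-k_v)`; for `j < k_v` it is a weak term.
The constant is independent of the map, hence the same for all iterates. Bounding the weak term by
the norm gives power boundedness, and so spectral radius at most `1`.

Compactness (`exists_hasFiniteNet`). For `j < k_v`, integrals of `ψ L_v^j f` with `ψ` smooth depend
in a Lipschitz way on the segment: a horizontal displacement moves `ψ`, a vertical one costs one
more vertical derivative, which the norm still controls. Since `M` is compact, these functionals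
have finite nets; near a singularity, the finitely many branches of a `d`-th root play the role of
charts. On the common kernel of a finite net the weak term is small, and a power of the operator
contracts up to a constant. The nets need `δ` small whereas the norm uses segments of length `β`; a
fixed number of iterates stretching one length to the other bridges the gap
(`anisoNorm_comp_le_two_mul`).

Abstract theorem (`essSpectralRadius_le_of_finiteCodim`). If a power `B` of `A` has norm less than
`|w₀|` on a closed `V` of finite codimension, then `B - w₀` is bounded below on `V`. Near `w₀`, the
invertibility of `B - w` reduces to that of an analytic matrix `d w` whose size is the codimension
of `V` (`resolvent_structure`). Its determinant has isolated zeros of finite order as soon as `w₀`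
is a limit of resolvent points, and connectedness of `{|w| > q}` propagates this from infinity. So
`B - w₀` is a finite rank perturbation of an isomorphism and the resolvent grows polynomially at
`w₀`; the growth forces finite ascent, and the kernel and range of a power of `B - w₀` then split
the space (`exists_fredholmDecomposition`). -/

noncomputable section

/-! ### Index zero for finite rank perturbations of isomorphisms -/

section FiniteRangePerturbation

variable {K X : Type*} [Field K] [AddCommGroup X] [Module K X]

/-- A finite rank perturbation of the identity has index zero. -/
theorem finrank_quotient_range_of_finiteRange_sub_id (D : Module.End K X)
    (h : FiniteDimensional K (1 - D : Module.End K X).range) :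
    FiniteDimensional K D.ker ∧ FiniteDimensional K (X ⧸ D.range) ∧
      Module.finrank K (X ⧸ D.range) = Module.finrank K D.ker := by
  set F : Module.End K X := 1 - D with hF
  have hD : ∀ x, D x = x - F x := fun x => by simp [hF]
  set R := F.range with hR
  have hker : D.ker ≤ R := fun x hx => ⟨x, by
    have := hD x
    rw [LinearMap.mem_ker.1 hx] at this
    exact (sub_eq_zero.1 this.symm).symm⟩
  have hmaps : ∀ x ∈ R, D x ∈ R := fun x hx => by
    rw [hD]; exact R.sub_mem hx ⟨x, rfl⟩
  -- Since `x = D x + F x`, the kernel and the cokernel of `D` both live on the finite-dimensional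
  -- range `R` of `F`; rank–nullity for `DR` makes their dimensions agree.
  let DR : R →ₗ[K] R := D.restrict hmaps
  let Q : R →ₗ[K] X ⧸ D.range := D.range.mkQ.comp R.subtype
  have hQ : Function.Surjective Q := by
    intro y
    obtain ⟨x, rfl⟩ := D.range.mkQ_surjective y
    refine ⟨⟨F x, x, rfl⟩, ?_⟩
    refine (Submodule.Quotient.eq _).2 ⟨-x, ?_⟩
    rw [map_neg, hD]; simp
  have hQker : Q.ker = DR.range := by
    ext ⟨x, hx⟩
    simp only [LinearMap.mem_ker, LinearMap.mem_range]
    constructor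
    · intro h
      obtain ⟨y, hy⟩ := (Submodule.Quotient.mk_eq_zero _).1 h
      have hy' : D y = x := hy
      have hyR : y ∈ R := by
        have : y = x + F y := by rw [← hy', hD]; abel
        rw [this]; exact R.add_mem hx ⟨y, rfl⟩
      exact ⟨⟨y, hyR⟩, Subtype.ext hy'⟩
    · rintro ⟨y, hy⟩
      refine (Submodule.Quotient.mk_eq_zero _).2 ⟨y, ?_⟩
      exact congrArg Subtype.val hy
  have hkerfin : FiniteDimensional K D.ker :=
    Submodule.finiteDimensional_of_le hker
  have hqfin : FiniteDimensional K (X ⧸ D.range) := Module.Finite.of_surjective Q hQ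
  refine ⟨hkerfin, hqfin, ?_⟩
  have h1 := LinearMap.finrank_range_add_finrank_ker Q
  have h2 := LinearMap.finrank_range_add_finrank_ker DR
  rw [LinearMap.range_eq_top.2 hQ, finrank_top, hQker] at h1
  have h3 : Module.finrank K DR.ker = Module.finrank K D.ker := by
    have h4 : DR.ker = Submodule.comap R.subtype D.ker := by
      ext ⟨x, hx⟩
      simp [DR, LinearMap.mem_ker, Subtype.ext_iff]
    rw [h4]
    exact (Submodule.comapSubtypeEquivOfLe hker).finrank_eq
  omega

/-- A finite rank perturbation of an isomorphism, whose kernel and range are disjoint, splits the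
space as the sum of its kernel and of its range. -/
theorem isCompl_ker_range_of_finiteRange_sub (C : Module.End K X) (Ψ : X ≃ₗ[K] X)
    (h : FiniteDimensional K (C - Ψ.toLinearMap : Module.End K X).range)
    (hd : Disjoint C.ker C.range) : FiniteDimensional K C.ker ∧ IsCompl C.ker C.range := by
  -- Composing with `Ψ⁻¹` reduces to a perturbation of the identity: the kernel is unchanged and `Ψ`
  -- identifies the cokernels.
  set D : Module.End K X := Ψ.symm.toLinearMap ∘ₗ C with hDdef
  have hfin : FiniteDimensional K (1 - D : Module.End K X).range := by
    have : (1 - D : Module.End K X) = Ψ.symm.toLinearMap ∘ₗ (-(C - Ψ.toLinearMap)) := by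
      ext x; simp [hDdef]
    rw [this, LinearMap.range_comp, LinearMap.range_neg]
    infer_instance
  obtain ⟨h1, h2, h3⟩ := finrank_quotient_range_of_finiteRange_sub_id D hfin
  have hker : D.ker = C.ker := by simp [hDdef, LinearMap.ker_comp]
  rw [hker] at h1 h3
  have hrange : C.range = D.range.map Ψ.toLinearMap := by
    rw [hDdef, ← LinearMap.range_comp, ← LinearMap.comp_assoc]; simp
  let e : (X ⧸ D.range) ≃ₗ[K] (X ⧸ C.range) :=
    Submodule.Quotient.equiv _ _ Ψ hrange.symm
  have : FiniteDimensional K (X ⧸ C.range) := Module.Finite.equiv e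
  rw [e.finrank_eq] at h3
  refine ⟨h1, hd, ?_⟩
  let Q : C.ker →ₗ[K] X ⧸ C.range := C.range.mkQ.comp C.ker.subtype
  have hQ : Function.Injective Q := by
    rw [← LinearMap.ker_eq_bot, LinearMap.ker_comp, Submodule.ker_mkQ]
    exact Submodule.disjoint_iff_comap_eq_bot.1 hd
  -- Index zero turns the injection of the kernel into the cokernel into an isomorphism, which gives
  -- the spanning half of complementarity.
  have hQs : Function.Surjective Q :=
    (LinearMap.injective_iff_surjective_of_finrank_eq_finrank h3.symm).1 hQ
  rw [codisjoint_iff_le_sup]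
  intro x _
  obtain ⟨⟨k, hk⟩, hkx⟩ := hQs (C.range.mkQ x)
  have : k - x ∈ C.range := (Submodule.Quotient.eq _).1 hkx
  have : x = k + -(k - x) := by abel
  rw [this]
  exact Submodule.add_mem_sup hk (C.range.neg_mem ‹_›)

end FiniteRangePerturbation

/-! ### Finite ascent and the splitting of the space -/

section Decomposition

variable {X : Type*} [NormedAddCommGroup X] [NormedSpace ℂ X]

/-- If the resolvent of `C` blows up at most polynomially at `0`, then `C` has finite ascent. -/
theorem pow_apply_eq_zero_of_resolvent_growth (C : X →L[ℂ] X) (p : ℕ) (M : ℝ)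
    (h : ∀ᶠ w : ℂ in 𝓝[≠] 0, ∀ x, ‖w‖ ^ p * ‖x‖ ≤ M * ‖C x - w • x‖) (x : X)
    (hx : (C ^ (p + 1)) x = 0) : (C ^ p) x = 0 := by
  -- A truncated geometric sum: as `C^(p+1) x = 0`, it solves `(C - w) y = -w^(p+1) x`. The growth
  -- hypothesis then forces `y w` to tend to `0`, while its limit at `0` is `C^p x`.
  set y : ℂ → X := fun w => ∑ i ∈ Finset.range (p + 1), w ^ (p - i) • (C ^ i) x with hy
  have hCy : ∀ w, C (y w) - w • y w = -(w ^ (p + 1) • x) := by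
    intro w
    have key := Finset.sum_range_sub (fun i => w ^ (p + 1 - i) • (C ^ i) x) (p + 1)
    simp only [hx, Nat.sub_zero, pow_zero, Nat.sub_self, smul_zero, zero_sub] at key
    change _ = -(w ^ (p + 1) • x) at key
    rw [← key, hy, map_sum, Finset.smul_sum, ← Finset.sum_sub_distrib]
    refine Finset.sum_congr rfl fun i hi => ?_
    have hi' : i ≤ p := Nat.lt_succ_iff.1 (Finset.mem_range.1 hi)
    rw [map_smul, smul_smul, ← pow_succ']
    have e1 : p + 1 - (i + 1) = p - i := by omega
    have e2 : p + 1 - i = p - i + 1 := by omega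
    rw [e1, e2, pow_succ' C i]
    rfl
  have hbound : ∀ᶠ w : ℂ in 𝓝[≠] 0, ‖y w‖ ≤ M * ‖w‖ * ‖x‖ := by
    filter_upwards [h, self_mem_nhdsWithin] with w hw hw0
    have h1 := hw (y w)
    rw [hCy, norm_neg, norm_smul, norm_pow] at h1
    have hpos : 0 < ‖w‖ ^ p := pow_pos (norm_pos_iff.2 hw0) _
    refine le_of_mul_le_mul_left (h1.trans_eq ?_) hpos
    rw [pow_succ]; ring
  have hlim : Tendsto y (𝓝[≠] 0) (𝓝 ((C ^ p) x)) := by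
    have hc : Continuous y := by fun_prop
    have h0 : y 0 = (C ^ p) x := by
      simp only [hy]
      rw [Finset.sum_range_succ, Finset.sum_eq_zero, zero_add]
      · simp
      · intro i hi
        have : p - i ≠ 0 := by have := Finset.mem_range.1 hi; omega
        simp [this]
    rw [← h0]
    exact (hc.tendsto 0).mono_left nhdsWithin_le_nhds
  have hzero : Tendsto (fun w : ℂ => M * ‖w‖ * ‖x‖) (𝓝[≠] 0) (𝓝 0) := by
    have hc : Continuous fun w : ℂ => M * ‖w‖ * ‖x‖ := by fun_prop
    have := (hc.tendsto 0).mono_left (nhdsWithin_le_nhds (s := {0}ᶜ))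
    simpa using this
  have := le_of_tendsto_of_tendsto hlim.norm hzero hbound
  exact norm_le_zero_iff.1 this

/-- Telescoping through `C^n (C - Ψ) + (C^n - Ψ^n) Ψ`. Powers matter because the splitting comes
from a power of `C`. -/
theorem finiteRange_pow_sub_pow (C Ψ : Module.End ℂ X)
    (h : FiniteDimensional ℂ (C - Ψ : Module.End ℂ X).range) (n : ℕ) :
    FiniteDimensional ℂ (C ^ n - Ψ ^ n : Module.End ℂ X).range := by
  induction n with
  | zero =>
    rw [pow_zero, pow_zero, sub_self, LinearMap.range_zero]
    infer_instance
  | succ n ih =>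
    have e : (C ^ (n + 1) - Ψ ^ (n + 1) : Module.End ℂ X) =
        C ^ n * (C - Ψ) + (C ^ n - Ψ ^ n) * Ψ := by
      rw [mul_sub, sub_mul, pow_succ, pow_succ]; abel
    rw [e]
    have h1 : FiniteDimensional ℂ (C ^ n * (C - Ψ) : Module.End ℂ X).range := by
      rw [Module.End.mul_eq_comp, LinearMap.range_comp]; infer_instance
    have h2 : FiniteDimensional ℂ ((C ^ n - Ψ ^ n) * Ψ : Module.End ℂ X).range :=
      Submodule.finiteDimensional_of_le (LinearMap.range_comp_le_range _ _)
    exact Submodule.finiteDimensional_of_le (LinearMap.range_add_le _ _)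

variable [CompleteSpace X]

/-- If `C`, a polynomial multiple of `A - z`, is a finite rank perturbation of an isomorphism with
finite ascent, then the space splits into a finite dimensional part and a part on which `A - z`
is invertible. -/
theorem exists_fredholmDecomposition (A C G : X →L[ℂ] X) (z : ℂ)
    (hCG : C = (A - z • 1) * G) (hAG : Commute A G)
    (Ψ : X ≃L[ℂ] X) (hΨ : FiniteDimensional ℂ (C - Ψ.toContinuousLinearMap : X →L[ℂ] X).range)
    (p : ℕ) (hp : ∀ x, (C ^ (p + 1)) x = 0 → (C ^ p) x = 0) :
    ∃ d : FredholmDecomposition ℂ X,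
      MapsTo A d.X₀ d.X₀ ∧ MapsTo A d.X₁ d.X₁ ∧ BijOn (fun v => A v - z • v) d.X₁ d.X₁ := by
  have hAz : Commute (A - z • 1) G := hAG.sub_left ((Commute.one_left G).smul_left z)
  have hAC : Commute A C := by
    rw [hCG]
    exact ((Commute.refl A).sub_right ((Commute.one_right A).smul_right z)).mul_right hAG
  have hGC : Commute G C := by
    rw [hCG]; exact hAz.symm.mul_right (Commute.refl G)
  -- The exponent `p + 1` rather than `p` keeps `m` positive even when `p = 0`, so that the kernel
  -- of `C` lies in that of `C^m`.
  set m := p + 1 with hm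
  have hp' : ∀ n x, (C ^ (m + n)) x = 0 → (C ^ m) x = 0 := by
    intro n
    induction n with
    | zero => intro x hx; simpa using hx
    | succ n ih =>
      intro x hx
      apply ih
      have e1 : C ^ (m + (n + 1)) = C ^ (p + 1) * C ^ (n + 1) := by
        rw [← pow_add, hm]
      have e2 : C ^ (m + n) = C ^ p * C ^ (n + 1) := by
        rw [← pow_add, hm]; congr 1; omega
      rw [e1] at hx
      rw [e2]
      exact hp _ hx
  set Cm : X →L[ℂ] X := C ^ m with hCm
  have hCmlin : Cm.toLinearMap = C.toLinearMap ^ m := by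
    ext x; simp [hCm]
  have hdisj : Disjoint Cm.toLinearMap.ker Cm.toLinearMap.range := by
    rw [Submodule.disjoint_def]
    rintro x hx ⟨y, rfl⟩
    have : (C ^ (m + m)) y = 0 := by
      rw [pow_add]; exact hx
    exact hp' m y this
  have hpow : ∀ n : ℕ, ((Ψ.toLinearEquiv ^ n : X ≃ₗ[ℂ] X) : Module.End ℂ X) =
      (Ψ.toLinearEquiv : Module.End ℂ X) ^ n := by
    intro n
    ext x
    induction n with
    | zero => rfl
    | succ n ih =>
      rw [pow_succ', pow_succ']
      exact congrArg Ψ ih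
  have hfr : FiniteDimensional ℂ
      (Cm.toLinearMap - ((Ψ.toLinearEquiv ^ m : X ≃ₗ[ℂ] X) : Module.End ℂ X) :
        Module.End ℂ X).range := by
    rw [hCmlin, hpow]
    exact finiteRange_pow_sub_pow _ _ hΨ m
  obtain ⟨hfin, hcompl⟩ := isCompl_ker_range_of_finiteRange_sub Cm.toLinearMap
    (Ψ.toLinearEquiv ^ m) hfr hdisj
  have hclosed : IsClosed (Cm.toLinearMap.range : Set X) := by
    let Ψm : X →L[ℂ] X := Ψ.symm.toContinuousLinearMap ^ m
    have hinv1 : Ψ.symm.toContinuousLinearMap * Ψ.toContinuousLinearMap = 1 := by ext x; simp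
    have hinv2 : Ψ.toContinuousLinearMap * Ψ.symm.toContinuousLinearMap = 1 := by ext x; simp
    have hcomm : Commute Ψ.symm.toContinuousLinearMap Ψ.toContinuousLinearMap := by
      rw [Commute, SemiconjBy, hinv1, hinv2]
    have hΨm1 : Ψm * Ψ.toContinuousLinearMap ^ m = 1 := by
      rw [← hcomm.mul_pow, hinv1, one_pow]
    have hΨm2 : Ψ.toContinuousLinearMap ^ m * Ψm = 1 := by
      rw [← hcomm.symm.mul_pow, hinv2, one_pow]
    have hE : (Cm.toLinearMap - ((Ψ.toLinearEquiv ^ m : X ≃ₗ[ℂ] X) : Module.End ℂ X)) =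
        (Cm - Ψ.toContinuousLinearMap ^ m).toLinearMap := by
      rw [hpow]
      ext x
      simp
    rw [hE] at hfr
    -- `Ψ^(-m)` inverts `C^m` modulo finite rank, so `C^m` is Fredholm and its range is closed; this
    -- makes the algebraic splitting topological.
    refine (ContinuousLinearMap.IsFredholm.of_isQuasiInverse (u := Cm) (v := Ψm)
      ⟨?_, ?_⟩).isClosed_range
    · refine (LinearMap.FiniteRangeSetoid.equiv_iff_hasFiniteRange).2 ?_
      rw [LinearMap.hasFiniteRange_iff_range]
      have : (Ψm.toLinearMap ∘ₗ Cm.toLinearMap - LinearMap.id : X →ₗ[ℂ] X) =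
          Ψm.toLinearMap ∘ₗ (Cm - Ψ.toContinuousLinearMap ^ m).toLinearMap := by
        have e : Ψm * Cm - 1 = Ψm * (Cm - Ψ.toContinuousLinearMap ^ m) := by rw [mul_sub, hΨm1]
        exact congrArg ContinuousLinearMap.toLinearMap e
      rw [this, LinearMap.range_comp]
      exact Module.Finite.iff_fg.1 inferInstance
    · refine (LinearMap.FiniteRangeSetoid.equiv_iff_hasFiniteRange).2 ?_
      rw [LinearMap.hasFiniteRange_iff_range]
      have : (Cm.toLinearMap ∘ₗ Ψm.toLinearMap - LinearMap.id : X →ₗ[ℂ] X) =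
          (Cm - Ψ.toContinuousLinearMap ^ m).toLinearMap ∘ₗ Ψm.toLinearMap := by
        have e : Cm * Ψm - 1 = (Cm - Ψ.toContinuousLinearMap ^ m) * Ψm := by rw [sub_mul, hΨm2]
        exact congrArg ContinuousLinearMap.toLinearMap e
      rw [this]
      exact Module.Finite.iff_fg.1
        (Submodule.finiteDimensional_of_le (LinearMap.range_comp_le_range _ _))
  have hACm : Commute A Cm := hAC.pow_right m
  have hGCm : Commute G Cm := hGC.pow_right m
  have happ : ∀ {L L' : X →L[ℂ] X}, Commute L L' → ∀ x, L (L' x) = L' (L x) :=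
    fun h x => congrArg (fun L : X →L[ℂ] X => L x) h.eq
  have htop : Submodule.IsTopCompl Cm.toLinearMap.range Cm.toLinearMap.ker :=
    Submodule.IsCompl.isTopCompl_of_isClosed hcompl.symm hclosed (Submodule.closed_of_finiteDimensional _)
  refine ⟨⟨Cm.toLinearMap.ker, Cm.toLinearMap.range, htop, hfin⟩, ?_, ?_, ?_, ?_, ?_⟩
  · intro x hx
    change Cm (A x) = 0
    rw [← happ hACm, show Cm x = 0 from hx, map_zero]
  · rintro x ⟨y, rfl⟩
    exact ⟨A y, (happ hACm y).symm⟩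
  · rintro x ⟨y, rfl⟩
    refine ⟨A y - z • y, ?_⟩
    simp [happ hACm y]
  · rintro x hx y hy hxy
    have h0 : (A - z • 1 : X →L[ℂ] X) (x - y) = 0 := by
      have : A x - z • x = A y - z • y := hxy
      change A (x - y) - z • (x - y) = 0
      rw [map_sub, smul_sub, sub_sub_sub_comm, this, sub_self]
    have h1 : C (x - y) = 0 := by
      rw [hCG, hAz.eq, mul_apply_eq_comp, h0, map_zero]
    have h2 : Cm (x - y) = 0 := by
      rw [hCm, hm, pow_succ, mul_apply_eq_comp, h1, map_zero]
    have h3 : x - y ∈ Cm.toLinearMap.range := Submodule.sub_mem _ hx hy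
    exact sub_eq_zero.1 (Submodule.disjoint_def.1 hcompl.disjoint _ h2 h3)
  · rintro x ⟨y, rfl⟩
    obtain ⟨k, hk, r, ⟨t, rfl⟩, rfl⟩ := Submodule.mem_sup.1
      (show y ∈ Cm.toLinearMap.ker ⊔ Cm.toLinearMap.range by rw [hcompl.sup_eq_top]; trivial)
    -- `C^m` kills the kernel component `k`, so the target is `C^m (C^m t)`; the identity `(A - z) G
    -- C^p = C^(p+1) = C^m` exhibits a preimage.
    refine ⟨G ((C ^ p) (Cm t)), ⟨G ((C ^ p) t), ?_⟩, ?_⟩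
    · change Cm (G ((C ^ p) t)) = _
      rw [← happ hGCm]
      congr 1
      exact happ ((Commute.refl C).pow_pow m p) t
    · change (A - z • 1 : X →L[ℂ] X) (G ((C ^ p) (Cm t))) = Cm (k + Cm t)
      rw [map_add, show Cm k = 0 from hk, zero_add, ← mul_apply_eq_comp, ← hCG,
        ← mul_apply_eq_comp, ← pow_succ']

end Decomposition

/-! ### Stability of the codimension of the image of a subspace -/

section SemiFredholm

variable {X Y : Type*} [NormedAddCommGroup X] [NormedSpace ℂ X]
  [NormedAddCommGroup Y] [NormedSpace ℂ Y]

/-- A family of vectors whose classes modulo the range of an injective operator are linearly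
independent completes this operator to an injective operator. -/
theorem injective_coprod_of_linearIndependent {ι : Type*} [Fintype ι] (L : Y →L[ℂ] X)
    (hL : Function.Injective L) (s : ι → X)
    (hs : LinearIndependent ℂ fun i => L.toLinearMap.range.mkQ (s i)) :
    Function.Injective (L.coprod (Fintype.linearCombination ℂ s).toContinuousLinearMap) := by
  rw [injective_iff_map_eq_zero]
  rintro ⟨v, c⟩ h
  have h : L v + ∑ i, c i • s i = 0 := by
    simpa [Fintype.linearCombination_apply] using h
  have h1 : ∑ i, c i • L.toLinearMap.range.mkQ (s i) = 0 := by
    have h2 := congrArg L.toLinearMap.range.mkQ h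
    have h3 : L.toLinearMap.range.mkQ (L v) = 0 :=
      (Submodule.Quotient.mk_eq_zero _).2 ⟨v, rfl⟩
    rw [map_add, h3, zero_add, map_zero, map_sum] at h2
    simpa using h2
  have hc : c = 0 := funext (Fintype.linearIndependent_iff.1 hs c h1)
  subst hc
  have : L v = 0 := by simpa using h
  rw [(injective_iff_map_eq_zero L).1 hL v this]
  rfl

theorem range_coprod_linearCombination {ι : Type*} [Fintype ι] (L : Y →L[ℂ] X) (s : ι → X) :
    (L.coprod (Fintype.linearCombination ℂ s).toContinuousLinearMap).toLinearMap.range =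
      L.toLinearMap.range ⊔ Submodule.span ℂ (range s) := by
  rw [← Fintype.range_linearCombination ℂ s, ← LinearMap.range_coprod]
  rfl

theorem isClosed_range_coprod {ι : Type*} [Fintype ι] (L : Y →L[ℂ] X)
    (hL : IsClosed (L.toLinearMap.range : Set X)) (s : ι → X) :
    IsClosed (range (L.coprod (Fintype.linearCombination ℂ s).toContinuousLinearMap)) := by
  have := Submodule.isClosed_sup_finiteDimensional L.toLinearMap.range
    (Submodule.span ℂ (range s)) hL (ht := FiniteDimensional.span_of_finite ℂ (finite_range s))
  rw [← range_coprod_linearCombination] at this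
  exact this

/-- Lifting a basis of the cokernel of an injective operator completes it to a bijection. -/
theorem bijective_coprod_of_basis {ι : Type*} [Fintype ι] (L : Y →L[ℂ] X)
    (hL : Function.Injective L) (b : Module.Basis ι ℂ (X ⧸ L.toLinearMap.range)) :
    ∃ ℓ : (ι → ℂ) →L[ℂ] X, Function.Bijective (L.coprod ℓ) := by
  choose s hs using fun i => L.toLinearMap.range.mkQ_surjective (b i)
  refine ⟨(Fintype.linearCombination ℂ s).toContinuousLinearMap,
    injective_coprod_of_linearIndependent L hL s ?_, ?_⟩
  · simp only [hs]; exact b.linearIndependent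
  · have : (L.coprod (Fintype.linearCombination ℂ s).toContinuousLinearMap).toLinearMap.range
        = ⊤ := by
      rw [range_coprod_linearCombination, ← Submodule.ker_mkQ L.toLinearMap.range, sup_comm,
        ← Submodule.comap_map_eq, Submodule.map_span, ← range_comp]
      have : (L.toLinearMap.range.mkQ ∘ s) = b := funext hs
      rw [this, b.span_eq, Submodule.comap_top]
    exact LinearMap.range_eq_top.1 this

/-- Makes the family visibly affine in `w`; its continuity, and later the analyticity of the reduced
problem, follow from this form. -/
theorem coprod_restrict_eq (V : Submodule ℂ X) {B : X →L[ℂ] X} {E : Type*} [NormedAddCommGroup E] [NormedSpace ℂ E]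
    (ℓ : E →L[ℂ] X) (w : ℂ) : ((B - w • 1) ∘L V.subtypeL).coprod ℓ =
      (B ∘L V.subtypeL).coprod ℓ - w • (V.subtypeL ∘L ContinuousLinearMap.fst ℂ V E) := by
  ext <;> simp

theorem continuous_coprod_restrict (V : Submodule ℂ X) {B : X →L[ℂ] X} {E : Type*} [NormedAddCommGroup E] [NormedSpace ℂ E]
    (ℓ : E →L[ℂ] X) : Continuous fun w : ℂ => ((B - w • 1) ∘L V.subtypeL).coprod ℓ := by
  have : (fun w : ℂ => ((B - w • 1) ∘L V.subtypeL).coprod ℓ) = fun w : ℂ =>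
      (B ∘L V.subtypeL).coprod ℓ - w • (V.subtypeL ∘L ContinuousLinearMap.fst ℂ V E) :=
    funext (coprod_restrict_eq V ℓ)
  rw [this]
  exact continuous_const.sub (continuous_id.smul continuous_const)

variable (V : Submodule ℂ X) [FiniteDimensional ℂ (X ⧸ V)] {B : X →L[ℂ] X} 

/-- Composing with `D⁻¹` turns the image of `V` back into `V`, so the columns of `D⁻¹ ℓ` are
independent modulo `V`. -/
theorem card_le_finrank_quotient {ι : Type*} [Fintype ι] {D : X →L[ℂ] X} (hD : IsUnit D)
    (ℓ : (ι → ℂ) →L[ℂ] X) (h : Function.Injective ((D ∘L V.subtypeL).coprod ℓ)) :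
    Fintype.card ι ≤ Module.finrank ℂ (X ⧸ V) := by
  obtain ⟨u, rfl⟩ := hD
  have hu : ∀ x, (u : X →L[ℂ] X) ((↑u⁻¹ : X →L[ℂ] X) x) = x := fun x =>
    congrArg (fun L : X →L[ℂ] X => L x) u.mul_inv
  let φ : (ι → ℂ) →ₗ[ℂ] X ⧸ V :=
    V.mkQ ∘ₗ (↑u⁻¹ : X →L[ℂ] X).toLinearMap ∘ₗ ℓ.toLinearMap
  have hφ : Function.Injective φ := by
    rw [injective_iff_map_eq_zero]
    intro c hc
    have hv : (↑u⁻¹ : X →L[ℂ] X) (ℓ c) ∈ V := (Submodule.Quotient.mk_eq_zero _).1 hc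
    have h0 : ((u : X →L[ℂ] X) ∘L V.subtypeL).coprod ℓ (⟨_, hv⟩, -c) = 0 := by
      simp [hu]
    have := (injective_iff_map_eq_zero _).1 h _ h0
    simpa using congrArg Prod.snd this
  simpa using LinearMap.finrank_le_finrank_of_injective hφ

theorem card_eq_finrank_quotient {ι : Type*} [Fintype ι] {D : X →L[ℂ] X} (hD : IsUnit D)
    (ℓ : (ι → ℂ) →L[ℂ] X) (h : Function.Bijective ((D ∘L V.subtypeL).coprod ℓ)) :
    Fintype.card ι = Module.finrank ℂ (X ⧸ V) := by
  refine le_antisymm (card_le_finrank_quotient V hD ℓ h.1) ?_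
  obtain ⟨u, rfl⟩ := hD
  have hu : ∀ x, (↑u⁻¹ : X →L[ℂ] X) ((u : X →L[ℂ] X) x) = x := fun x =>
    congrArg (fun L : X →L[ℂ] X => L x) u.inv_mul
  let φ : (ι → ℂ) →ₗ[ℂ] X ⧸ V :=
    V.mkQ ∘ₗ (↑u⁻¹ : X →L[ℂ] X).toLinearMap ∘ₗ ℓ.toLinearMap
  have hφ : Function.Surjective φ := by
    intro y
    obtain ⟨x, rfl⟩ := V.mkQ_surjective y
    obtain ⟨⟨v, c⟩, hvc⟩ := h.2 ((u : X →L[ℂ] X) x)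
    refine ⟨c, ?_⟩
    have h1 := congrArg (↑u⁻¹ : X →L[ℂ] X) hvc
    rw [hu] at h1
    have h2 : x = (v : X) + (↑u⁻¹ : X →L[ℂ] X) (ℓ c) := by
      rw [← h1]; simp [hu]
    refine (Submodule.Quotient.eq _).2 ?_
    rw [h2]
    simp
  simpa using LinearMap.finrank_le_finrank_of_surjective hφ

/-- Injective operators with closed range are stable under perturbation. -/
theorem eventually_injective_of_isClosed_range [CompleteSpace X] {E : Type*} [NormedAddCommGroup E] [NormedSpace ℂ E]
    [CompleteSpace E] {Θ : ℂ → E →L[ℂ] X} {w₀ : ℂ} (hΘ : ContinuousAt Θ w₀)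
    (hinj : Function.Injective (Θ w₀)) (hcl : IsClosed (range (Θ w₀))) :
    ∀ᶠ w in 𝓝 w₀, Function.Injective (Θ w) := by
  obtain ⟨K, hK⟩ := (Θ w₀).antilipschitz_of_injective_of_isClosed_range hinj hcl
  have hpos : (0 : ℝ) < ((K : ℝ) + 1)⁻¹ := by positivity
  filter_upwards [Metric.tendsto_nhds.1 hΘ _ hpos] with w hw
  rw [injective_iff_map_eq_zero]
  intro x hx
  have h1 : ‖x‖ ≤ ((K : ℝ) + 1) * ‖Θ w₀ x‖ := by
    have := hK.le_mul_dist x 0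
    simp only [map_zero, dist_zero_right] at this
    linarith [norm_nonneg (Θ w₀ x)]
  have h2 : ‖Θ w₀ x‖ ≤ dist (Θ w) (Θ w₀) * ‖x‖ := by
    have h3 := (Θ w - Θ w₀).le_opNorm x
    rw [sub_apply, hx, zero_sub, norm_neg] at h3
    rwa [dist_eq_norm]
  by_contra hne
  have hxpos : 0 < ‖x‖ := norm_pos_iff.2 hne
  have h4 : ((K : ℝ) + 1) * ‖Θ w₀ x‖ < ‖x‖ := by
    calc ((K : ℝ) + 1) * ‖Θ w₀ x‖ ≤ ((K : ℝ) + 1) * (dist (Θ w) (Θ w₀) * ‖x‖) := by gcongr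
      _ < ((K : ℝ) + 1) * (((K : ℝ) + 1)⁻¹ * ‖x‖) := by gcongr
      _ = ‖x‖ := by field_simp
  linarith

theorem eventually_bijective_of_bijective [CompleteSpace X] {E : Type*} [NormedAddCommGroup E] [NormedSpace ℂ E]
    [CompleteSpace E] {Θ : ℂ → E →L[ℂ] X} {w₀ : ℂ} (hΘ : ContinuousAt Θ w₀)
    (hbij : Function.Bijective (Θ w₀)) : ∀ᶠ w in 𝓝 w₀, Function.Bijective (Θ w) := by
  let e := ContinuousLinearEquiv.ofBijective (Θ w₀) (LinearMap.ker_eq_bot.2 hbij.1)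
    (LinearMap.range_eq_top.2 hbij.2)
  have he : (e : E →L[ℂ] X) = Θ w₀ := ContinuousLinearEquiv.coe_ofBijective _ _ _
  have h := hΘ.eventually (he ▸ e.nhds)
  filter_upwards [h] with w hw
  obtain ⟨e', he'⟩ := hw
  rw [← he']
  exact e'.bijective

/-- Stability of the codimension: if `B - w₀`, restricted to a closed subspace `V` of finite
codimension, is bounded below, and if `w₀` is a limit of points of the resolvent set, then the
image of `V` has a complement with the same dimension as the complements of `V`. -/
theorem exists_bijective_coprod_restrict [CompleteSpace X] (hV : IsClosed (V : Set X)) {w₀ : ℂ} {c : ℝ} (hc : 0 < c)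
    (hbelow : ∀ v ∈ V, c * ‖v‖ ≤ ‖B v - w₀ • v‖)
    (hfreq : ∃ᶠ w in 𝓝 w₀, IsUnit (B - w • 1)) :
    ∃ ℓ : (Fin (Module.finrank ℂ (X ⧸ V)) → ℂ) →L[ℂ] X,
      Function.Bijective (((B - w₀ • 1) ∘L V.subtypeL).coprod ℓ) := by
  have := hV.completeSpace_coe
  set L : V →L[ℂ] X := (B - w₀ • 1) ∘L V.subtypeL with hLdef
  have hanti : AntilipschitzWith (Real.toNNReal c⁻¹) L := by
    refine AddMonoidHomClass.antilipschitz_of_bound L fun v => ?_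
    rw [Real.coe_toNNReal _ (by positivity)]
    have := hbelow v v.2
    rw [inv_mul_eq_div, le_div_iff₀ hc, mul_comm]
    exact this
  have hLinj := hanti.injective
  have hLcl : IsClosed (L.toLinearMap.range : Set X) := hanti.isClosed_range L.uniformContinuous
  -- Any finite independent family modulo the image keeps the completed operator injective for `w`
  -- near `w₀`. At such a `w` with `B - w` invertible, its cardinality is at most the codimension of
  -- `V`.
  have hrank : Module.rank ℂ (X ⧸ L.toLinearMap.range) ≤ Module.finrank ℂ (X ⧸ V) := by
    refine rank_le fun s hs => ?_
    choose t ht using fun i : s => L.toLinearMap.range.mkQ_surjective i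
    have hinj := injective_coprod_of_linearIndependent L hLinj t (by simpa only [ht] using hs)
    have hev := eventually_injective_of_isClosed_range
      (Θ := fun w : ℂ => ((B - w • 1) ∘L V.subtypeL).coprod
        (Fintype.linearCombination ℂ t).toContinuousLinearMap)
      (continuous_coprod_restrict V _).continuousAt hinj (isClosed_range_coprod L hLcl t)
    obtain ⟨w, hw, hw'⟩ := (hfreq.and_eventually hev).exists
    simpa using card_le_finrank_quotient V hw _ hw'
  have hfin : FiniteDimensional ℂ (X ⧸ L.toLinearMap.range) :=
    Module.rank_lt_aleph0_iff.1 (hrank.trans_lt (Cardinal.natCast_lt_aleph0))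
  obtain ⟨ℓ, hℓ⟩ := bijective_coprod_of_basis L hLinj
    (Module.finBasis ℂ (X ⧸ L.toLinearMap.range))
  -- Bijectivity also persists near `w₀`; comparing at a resolvent point shows that the number of
  -- added columns is exactly the codimension of `V`.
  obtain ⟨w, hw, hw'⟩ :=
    (hfreq.and_eventually (eventually_bijective_of_bijective
      (Θ := fun w : ℂ => ((B - w • 1) ∘L V.subtypeL).coprod ℓ)
      (continuous_coprod_restrict V ℓ).continuousAt hℓ)).exists
  have hcard := card_eq_finrank_quotient V hw _ hw'
  rw [Fintype.card_fin] at hcard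
  rw [← hcard]
  exact ⟨ℓ, hℓ⟩

end SemiFredholm

/-! ### Reduction of the resolvent to an analytic matrix -/

section Resolvent

/-- If a matrix depends analytically on a parameter and is invertible for parameters accumulating
at `w₀`, then it is invertible in a punctured neighborhood of `w₀`, and its inverse blows up at
most polynomially. -/
theorem matrix_inverse_growth {ι : Type*} [Fintype ι] [DecidableEq ι] {d : ℂ → Matrix ι ι ℂ}
    {w₀ : ℂ} (hd : ∀ i j, AnalyticAt ℂ (fun w => d w i j) w₀)
    (hfreq : ∃ᶠ w in 𝓝 w₀, (d w).det ≠ 0) :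
    ∃ (p : ℕ) (M : ℝ), ∀ᶠ w in 𝓝[≠] w₀, IsUnit (d w).det ∧
      ∀ c : ι → ℂ, ‖w - w₀‖ ^ p * ‖c‖ ≤ M * ‖(d w).mulVec c‖ := by
  have hdet : AnalyticAt ℂ (fun w => (d w).det) w₀ := by
    simp only [Matrix.det_apply']
    refine Finset.analyticAt_fun_sum _ fun σ _ => analyticAt_const.mul ?_
    exact Finset.analyticAt_fun_prod _ fun i _ => hd _ _
  -- The determinant is not identically zero near `w₀`, so it is `(w - w₀)^p g(w)` with `g w₀ ≠ 0`;
  -- this order `p` is the growth exponent.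
  obtain ⟨p, g, hg, hg0, hgeq⟩ := hdet.exists_eventuallyEq_pow_smul_nonzero_iff.2
    (fun h => hfreq (h.mono fun w hw => by simpa using hw))
  have hcont : ContinuousAt d w₀ := by
    refine tendsto_pi_nhds.2 fun i => tendsto_pi_nhds.2 fun j => (hd i j).continuousAt
  have hadj : ContinuousAt (fun w => ∑ i, ∑ j, ‖(d w).adjugate i j‖) w₀ := by
    have h1 : Continuous fun A : Matrix ι ι ℂ => ∑ i, ∑ j, ‖A.adjugate i j‖ := by
      refine continuous_finsetSum _ fun i _ => continuous_finsetSum _ fun j _ => ?_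
      exact ((continuous_id.matrix_adjugate).matrix_elem i j).norm
    exact h1.continuousAt.comp hcont
  set S := (∑ i, ∑ j, ‖(d w₀).adjugate i j‖) + 1 with hS
  have hSev : ∀ᶠ w in 𝓝 w₀, ∑ i, ∑ j, ‖(d w).adjugate i j‖ ≤ S :=
    (hadj.eventually (gt_mem_nhds (lt_add_one _))).mono fun w hw => hw.le
  have hgpos : 0 < ‖g w₀‖ := norm_pos_iff.2 hg0
  have hgev : ∀ᶠ w in 𝓝 w₀, ‖g w₀‖ / 2 ≤ ‖g w‖ :=
    (hg.continuousAt.norm.eventually (lt_mem_nhds (half_lt_self hgpos))).mono fun w hw => hw.le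
  refine ⟨p, (‖g w₀‖ / 2)⁻¹ * S, ?_⟩
  have hall := (hSev.and (hgev.and hgeq)).filter_mono (nhdsWithin_le_nhds (s := {w₀}ᶜ))
  filter_upwards [hall, self_mem_nhdsWithin] with w hw hne
  obtain ⟨h1, h2, h3⟩ := hw
  have hgw : g w ≠ 0 := fun h => by rw [h, norm_zero] at h2; linarith
  have hdet0 : (d w).det ≠ 0 := by
    rw [h3]; exact smul_ne_zero (pow_ne_zero _ (sub_ne_zero.2 hne)) hgw
  refine ⟨isUnit_iff_ne_zero.2 hdet0, fun c => ?_⟩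
  -- Cramer's rule: the adjugate is bounded near `w₀`, so the inverse blows up no faster than `1 /
  -- det`.
  have hmv : (d w).det • c = (d w).adjugate.mulVec ((d w).mulVec c) := by
    rw [Matrix.mulVec_mulVec, Matrix.adjugate_mul, Matrix.smul_mulVec, Matrix.one_mulVec]
  have hrow : ∀ (A : Matrix ι ι ℂ) (i : ι), ∑ j, ‖A i j‖ ≤ ∑ i, ∑ j, ‖A i j‖ := fun A i =>
    Finset.single_le_sum (f := fun i => ∑ j, ‖A i j‖)
      (fun i _ => Finset.sum_nonneg fun j _ => norm_nonneg _) (Finset.mem_univ i)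
  have hb : ∀ (A : Matrix ι ι ℂ) (y : ι → ℂ), ‖A.mulVec y‖ ≤ (∑ i, ∑ j, ‖A i j‖) * ‖y‖ := by
    intro A y
    refine (pi_norm_le_iff_of_nonneg (by positivity)).2 fun i => ?_
    calc ‖A.mulVec y i‖ ≤ ∑ j, ‖A i j * y j‖ := norm_sum_le _ _
      _ ≤ ∑ j, ‖A i j‖ * ‖y‖ := by
          refine Finset.sum_le_sum fun j _ => ?_
          rw [norm_mul]
          gcongr
          exact norm_le_pi_norm y j
      _ = (∑ j, ‖A i j‖) * ‖y‖ := (Finset.sum_mul _ _ _).symm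
      _ ≤ (∑ i, ∑ j, ‖A i j‖) * ‖y‖ :=
          mul_le_mul_of_nonneg_right (hrow A i) (norm_nonneg y)
  have h4 : ‖w - w₀‖ ^ p * ‖g w‖ * ‖c‖ ≤ S * ‖(d w).mulVec c‖ := by
    have h5 := congrArg norm hmv
    rw [norm_smul, h3, norm_smul, norm_pow] at h5
    rw [h5]
    exact (hb _ _).trans (by gcongr)
  rw [mul_assoc, inv_mul_eq_div, le_div_iff₀ (by positivity)]
  calc ‖w - w₀‖ ^ p * ‖c‖ * (‖g w₀‖ / 2) ≤ ‖w - w₀‖ ^ p * ‖c‖ * ‖g w‖ := by gcongr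
    _ = ‖w - w₀‖ ^ p * ‖g w‖ * ‖c‖ := by ring
    _ ≤ _ := h4

variable {X : Type*} [NormedAddCommGroup X] [NormedSpace ℂ X] [CompleteSpace X]

/-- Analyticity of inversion is only needed at the identity, since `U w₀ = 1` and the families are
affine in `w`. -/
theorem analyticAt_inverse_of_affine {E : Type*} [NormedAddCommGroup E] [NormedSpace ℂ E]
    [CompleteSpace E] {U W : ℂ → E →L[ℂ] E} {P Q R S : E →L[ℂ] E} {w₀ : ℂ}
    (hU : U = fun w => P - w • Q) (hW : W = fun w => R - w • S) (hU0 : U w₀ = 1) :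
    (∀ᶠ w in 𝓝 w₀, IsUnit (U w)) ∧ AnalyticAt ℂ (fun w => Ring.inverse (U w)) w₀ ∧
      AnalyticAt ℂ (fun w => Ring.inverse (U w) * W w) w₀ := by
  have hUan : AnalyticAt ℂ U w₀ := by
    rw [hU]; exact analyticAt_const.sub (analyticAt_id.smul analyticAt_const)
  have hWan : AnalyticAt ℂ W w₀ := by
    rw [hW]; exact analyticAt_const.sub (analyticAt_id.smul analyticAt_const)
  have hinv : AnalyticAt ℂ (fun w => Ring.inverse (U w)) w₀ := by
    have h1 : AnalyticAt ℂ Ring.inverse (U w₀) := by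
      rw [hU0]; exact analyticAt_inverse (𝕜 := ℂ) (1 : (E →L[ℂ] E)ˣ)
    exact h1.comp hUan
  refine ⟨hUan.continuousAt.eventually ?_, hinv, hinv.mul hWan⟩
  rw [hU0]
  exact Units.nhds (1 : (E →L[ℂ] E)ˣ)

/-- Structure of the resolvent of `B` at a limit point of the resolvent set where `B - w₀` is
bounded below on a subspace of finite codimension. -/
theorem resolvent_structure {B : X →L[ℂ] X} (V : Submodule ℂ X) [FiniteDimensional ℂ (X ⧸ V)]
    (hV : IsClosed (V : Set X)) {w₀ : ℂ} {c : ℝ} (hc : 0 < c)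
    (hbelow : ∀ v ∈ V, c * ‖v‖ ≤ ‖B v - w₀ • v‖)
    (hfreq : ∃ᶠ w in 𝓝 w₀, IsUnit (B - w • 1)) :
    (∃ Ψ : X ≃L[ℂ] X, FiniteDimensional ℂ
      (B - w₀ • 1 - Ψ.toContinuousLinearMap : X →L[ℂ] X).range) ∧
    ∃ (p : ℕ) (M : ℝ), ∀ᶠ w in 𝓝[≠] w₀, IsUnit (B - w • 1) ∧
      ∀ x, ‖w - w₀‖ ^ p * ‖x‖ ≤ M * ‖B x - w • x‖ := by
  have := hV.completeSpace_coe
  set N := Module.finrank ℂ (X ⧸ V) with hN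
  obtain ⟨ℓ, hℓ⟩ := exists_bijective_coprod_restrict V hV hc hbelow hfreq
  -- Two models of `X` on `V × ℂ^N`: `E` extends the inclusion of `V`, and `Θ₀` extends `B - w₀` on
  -- `V`. Then `Θ₀ E⁻¹` agrees with `B - w₀` on `V`, so it is an isomorphism differing from it by
  -- finite rank.
  obtain ⟨s, hs⟩ : ∃ s : (Fin N → ℂ) →L[ℂ] X, Function.Bijective (V.subtypeL.coprod s) := by
    have hr : V.subtypeL.toLinearMap.range = V := V.range_subtype
    exact bijective_coprod_of_basis V.subtypeL V.injective_subtype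
      ((Module.finBasis ℂ (X ⧸ V)).map (Submodule.quotEquivOfEq _ _ hr.symm))
  set Θ : ℂ → (V × (Fin N → ℂ)) →L[ℂ] X := fun w => ((B - w • 1) ∘L V.subtypeL).coprod ℓ with hΘ
  let Θ₀ : (V × (Fin N → ℂ)) ≃L[ℂ] X := ContinuousLinearEquiv.ofBijective (Θ w₀) (LinearMap.ker_eq_bot.2 hℓ.1)
    (LinearMap.range_eq_top.2 hℓ.2)
  have hΘ₀ : (Θ₀ : (V × (Fin N → ℂ)) →L[ℂ] X) = Θ w₀ := ContinuousLinearEquiv.coe_ofBijective _ _ _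
  let E : (V × (Fin N → ℂ)) ≃L[ℂ] X := ContinuousLinearEquiv.ofBijective (V.subtypeL.coprod s)
    (LinearMap.ker_eq_bot.2 hs.1) (LinearMap.range_eq_top.2 hs.2)
  have hE : ∀ y : (V × (Fin N → ℂ)), E y = (y.1 : X) + s y.2 := fun y => rfl
  have hΘ₀' : ∀ y : (V × (Fin N → ℂ)), Θ₀ y = (B - w₀ • 1 : X →L[ℂ] X) y.1 + ℓ y.2 := fun y => rfl
  constructor
  · refine ⟨E.symm.trans Θ₀, ?_⟩
    have hle : (B - w₀ • 1 - (E.symm.trans Θ₀).toContinuousLinearMap : X →L[ℂ] X).range ≤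
        ((B - w₀ • 1) ∘L s - ℓ : (Fin N → ℂ) →L[ℂ] X).range := by
      rintro _ ⟨x, rfl⟩
      obtain ⟨y, rfl⟩ := E.surjective x
      refine ⟨y.2, ?_⟩
      have h1 : E.symm.trans Θ₀ (E y) = (B - w₀ • 1 : X →L[ℂ] X) y.1 + ℓ y.2 := by
        rw [ContinuousLinearEquiv.trans_apply, E.symm_apply_apply, hΘ₀']
      change (B - w₀ • 1 : X →L[ℂ] X) (s y.2) - ℓ y.2 =
        (B - w₀ • 1 : X →L[ℂ] X) (E y) - E.symm.trans Θ₀ (E y)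
      rw [h1, hE, map_add]
      abel
    exact Submodule.finiteDimensional_of_le hle
  set U : ℂ → (V × (Fin N → ℂ)) →L[ℂ] (V × (Fin N → ℂ)) := fun w => (Θ₀.symm : X →L[ℂ] (V × (Fin N → ℂ))) ∘L Θ w with hU
  have hUaff : U = fun w => (Θ₀.symm : X →L[ℂ] (V × (Fin N → ℂ))) ∘L ((B ∘L V.subtypeL).coprod ℓ) -
      w • ((Θ₀.symm : X →L[ℂ] (V × (Fin N → ℂ))) ∘L (V.subtypeL ∘L ContinuousLinearMap.fst ℂ V _)) := by
    funext w
    simp only [hU, hΘ]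
    rw [coprod_restrict_eq, ContinuousLinearMap.comp_sub, ContinuousLinearMap.comp_smul]
  have hU0 : U w₀ = 1 := by
    simp only [hU]
    rw [← hΘ₀]
    exact ContinuousLinearMap.ext fun y => Θ₀.symm_apply_apply y
  set W : ℂ → (V × (Fin N → ℂ)) →L[ℂ] (V × (Fin N → ℂ)) := fun w => (Θ₀.symm : X →L[ℂ] (V × (Fin N → ℂ))) ∘L (B - w • 1) ∘L (E : (V × (Fin N → ℂ)) →L[ℂ] X)
    with hW
  have hWaff : W = fun w => (Θ₀.symm : X →L[ℂ] (V × (Fin N → ℂ))) ∘L B ∘L (E : (V × (Fin N → ℂ)) →L[ℂ] X) -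
      w • ((Θ₀.symm : X →L[ℂ] (V × (Fin N → ℂ))) ∘L (E : (V × (Fin N → ℂ)) →L[ℂ] X)) :=
    funext fun w => ContinuousLinearMap.ext fun y => by simp [hW]
  obtain ⟨hUunit, hinv, hHan⟩ := analyticAt_inverse_of_affine hUaff hWaff hU0
  -- For `U w` invertible, `B - w = Θ₀ U(w) H(w) E⁻¹`, so `B - w` is invertible exactly when `H w`
  -- is. As `H w` fixes `V × 0`, it is block triangular with identity block on `V` and only one
  -- other diagonal block, the matrix `d w` below.
  set H : ℂ → (V × (Fin N → ℂ)) →L[ℂ] (V × (Fin N → ℂ)) := fun w => Ring.inverse (U w) * W w with hH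
  have hUH : ∀ w, IsUnit (U w) → ∀ y, U w (H w y) = W w y := fun w hw y => by
    have := congrArg (fun L : (V × (Fin N → ℂ)) →L[ℂ] (V × (Fin N → ℂ)) => L y) (Ring.mul_inverse_cancel_left (U w) (W w) hw)
    exact this
  have hUinj : ∀ w, IsUnit (U w) → Function.Injective (U w) := fun w hw =>
    (ContinuousLinearMap.isUnit_iff_bijective.1 hw).1
  have hHV : ∀ w, IsUnit (U w) → ∀ v : V, H w (v, 0) = (v, 0) := fun w hw v => by
    apply hUinj w hw
    rw [hUH w hw]
    simp [hU, hW, hΘ, hE]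
  let e : Fin N → Fin N → ℂ := fun j => Pi.single j 1
  set d : ℂ → Matrix (Fin N) (Fin N) ℂ := fun w => Matrix.of fun i j => (H w (0, e j)).2 i with hd
  have hmul : ∀ w c, (d w).mulVec c = (H w (0, c)).2 := by
    intro w c
    let φ : (Fin N → ℂ) →ₗ[ℂ] (Fin N → ℂ) :=
      LinearMap.snd ℂ V _ ∘ₗ (H w).toLinearMap ∘ₗ LinearMap.inr ℂ V _
    have : d w = LinearMap.toMatrix' φ := by
      ext i j
      simp [hd, φ, e, LinearMap.toMatrix'_apply]
    rw [this, LinearMap.toMatrix'_mulVec]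
    rfl
  have hsplit : ∀ w, IsUnit (U w) → ∀ y : (V × (Fin N → ℂ)), H w y = (y.1 + (H w (0, y.2)).1, (d w).mulVec y.2) := by
    intro w hw y
    have : y = (y.1, 0) + (0, y.2) := by simp
    conv_lhs => rw [this, map_add, hHV w hw]
    rw [hmul]
    ext <;> simp
  have hdan : ∀ i j, AnalyticAt ℂ (fun w => d w i j) w₀ := by
    intro i j
    let ev : ((V × (Fin N → ℂ)) →L[ℂ] (V × (Fin N → ℂ))) →L[ℂ] ℂ := (ContinuousLinearMap.proj i ∘L ContinuousLinearMap.snd ℂ V _) ∘L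
      ContinuousLinearMap.apply ℂ (V × (Fin N → ℂ)) ((0, e j) : (V × (Fin N → ℂ)))
    exact (ev.analyticAt _).comp hHan
  have hBinj : ∀ w, IsUnit (U w) → IsUnit (B - w • 1) → (d w).det ≠ 0 := by
    intro w hw hB h0
    obtain ⟨c, hc0, hc⟩ := Matrix.exists_mulVec_eq_zero_iff.2 h0
    have hWinj : Function.Injective (W w) :=
      Θ₀.symm.injective.comp ((ContinuousLinearMap.isUnit_iff_bijective.1 hB).1.comp E.injective)
    have hHinj : Function.Injective (H w) := fun a b hab => hWinj (by
      rw [← hUH w hw, ← hUH w hw, hab])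
    have h1 := hsplit w hw (0, c)
    rw [hc] at h1
    have h2 : H w (0, c) = H w ((H w (0, c)).1, 0) := by
      rw [hHV w hw]
      simpa using h1
    exact hc0 (congrArg Prod.snd (hHinj h2))
  obtain ⟨p, M, hpM⟩ := matrix_inverse_growth hdan
    ((hfreq.and_eventually hUunit).mono fun w hw => hBinj w hw.2 hw.1)
  set MH := ‖H w₀‖ + 1
  have hHb : ∀ᶠ w in 𝓝 w₀, ‖H w‖ ≤ MH :=
    (hHan.continuousAt.norm.eventually (gt_mem_nhds (lt_add_one _))).mono fun w hw => hw.le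
  set MU := ‖Ring.inverse (U w₀)‖ + 1
  have hUb : ∀ᶠ w in 𝓝 w₀, ‖Ring.inverse (U w)‖ ≤ MU :=
    (hinv.continuousAt.norm.eventually (gt_mem_nhds (lt_add_one _))).mono fun w hw => hw.le
  have hw1 : ∀ᶠ w in 𝓝 w₀, ‖w - w₀‖ ≤ 1 := by
    filter_upwards [Metric.closedBall_mem_nhds w₀ one_pos] with w hw
    rwa [← dist_eq_norm]
  refine ⟨p, ‖(E : (V × (Fin N → ℂ)) →L[ℂ] X)‖ * ((1 + (1 + MH) * |M|) * (MU * ‖(Θ₀.symm : X →L[ℂ] (V × (Fin N → ℂ)))‖)), ?_⟩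
  have hall := (hUunit.and (hHb.and (hUb.and hw1))).filter_mono
    (nhdsWithin_le_nhds (s := {w₀}ᶜ))
  filter_upwards [hall, hpM] with w ⟨hw, hHw, hUw, hw1⟩ ⟨hdet, hpw⟩
  have hMH : 0 ≤ MH := by positivity
  have hpw1 : ‖w - w₀‖ ^ p ≤ 1 := pow_le_one₀ (norm_nonneg _) hw1
  have hHlow : ∀ y : (V × (Fin N → ℂ)), ‖w - w₀‖ ^ p * ‖y‖ ≤ (1 + (1 + MH) * |M|) * ‖H w y‖ := by
    intro y
    have h1 : ‖w - w₀‖ ^ p * ‖y.2‖ ≤ |M| * ‖H w y‖ := by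
      refine (hpw y.2).trans ?_
      refine mul_le_mul (le_abs_self M) ?_ (norm_nonneg _) (abs_nonneg _)
      rw [hsplit w hw y]
      exact le_max_right _ _
    have h2 : ‖y.1‖ ≤ ‖H w y‖ + MH * ‖y.2‖ := by
      have h3 : y.1 = (H w y).1 - (H w (0, y.2)).1 := by rw [hsplit w hw y]; simp
      rw [h3]
      refine (norm_sub_le _ _).trans (add_le_add (norm_fst_le _) ?_)
      refine (norm_fst_le _).trans (((H w).le_opNorm _).trans ?_)
      have : ‖((0, y.2) : (V × (Fin N → ℂ)))‖ = ‖y.2‖ := by simp [Prod.norm_def]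
      rw [this]
      gcongr
    have h4 : ‖y‖ ≤ ‖y.1‖ + ‖y.2‖ := max_le_add_of_nonneg (norm_nonneg _) (norm_nonneg _)
    calc ‖w - w₀‖ ^ p * ‖y‖ ≤ ‖w - w₀‖ ^ p * (‖H w y‖ + MH * ‖y.2‖ + ‖y.2‖) := by
          gcongr; linarith
      _ = ‖w - w₀‖ ^ p * ‖H w y‖ + (1 + MH) * (‖w - w₀‖ ^ p * ‖y.2‖) := by ring
      _ ≤ 1 * ‖H w y‖ + (1 + MH) * (|M| * ‖H w y‖) := by gcongr
      _ = _ := by ring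
  have hBW : ∀ y, ‖W w y‖ ≤ ‖(Θ₀.symm : X →L[ℂ] (V × (Fin N → ℂ)))‖ * ‖B (E y) - w • E y‖ := fun y =>
    (Θ₀.symm : X →L[ℂ] (V × (Fin N → ℂ))).le_opNorm _
  have hlow : ∀ x, ‖w - w₀‖ ^ p * ‖x‖ ≤
      ‖(E : (V × (Fin N → ℂ)) →L[ℂ] X)‖ * ((1 + (1 + MH) * |M|) * (MU * ‖(Θ₀.symm : X →L[ℂ] (V × (Fin N → ℂ)))‖)) *
        ‖B x - w • x‖ := by
    intro x
    obtain ⟨y, rfl⟩ := E.surjective x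
    calc ‖w - w₀‖ ^ p * ‖E y‖ ≤ ‖w - w₀‖ ^ p * (‖(E : (V × (Fin N → ℂ)) →L[ℂ] X)‖ * ‖y‖) := by
          gcongr; exact (E : (V × (Fin N → ℂ)) →L[ℂ] X).le_opNorm y
      _ = ‖(E : (V × (Fin N → ℂ)) →L[ℂ] X)‖ * (‖w - w₀‖ ^ p * ‖y‖) := by ring
      _ ≤ ‖(E : (V × (Fin N → ℂ)) →L[ℂ] X)‖ * ((1 + (1 + MH) * |M|) * ‖H w y‖) := by exact mul_le_mul_of_nonneg_left (hHlow y) (by positivity)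
      _ ≤ ‖(E : (V × (Fin N → ℂ)) →L[ℂ] X)‖ * ((1 + (1 + MH) * |M|) * (MU *
            (‖(Θ₀.symm : X →L[ℂ] (V × (Fin N → ℂ)))‖ * ‖B (E y) - w • E y‖))) := by
          gcongr
          calc ‖H w y‖ ≤ ‖Ring.inverse (U w)‖ * ‖W w y‖ := (Ring.inverse (U w)).le_opNorm _
            _ ≤ MU * (‖(Θ₀.symm : X →L[ℂ] (V × (Fin N → ℂ)))‖ * ‖B (E y) - w • E y‖) := by
              gcongr; exact hBW y
      _ = _ := by ring
  refine ⟨?_, hlow⟩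
  rw [ContinuousLinearMap.isUnit_iff_bijective]
  have hHsurj : Function.Surjective (H w) := by
    rintro ⟨a, b⟩
    refine ⟨(a - (H w (0, (d w)⁻¹.mulVec b)).1, (d w)⁻¹.mulVec b), ?_⟩
    rw [hsplit w hw]
    simp [Matrix.mulVec_mulVec, Matrix.mul_nonsing_inv _ hdet]
  have hHinj : Function.Injective (H w) := by
    rw [injective_iff_map_eq_zero]
    intro y hy
    have h1 := hsplit w hw y
    rw [hy] at h1
    have h2 : (d w).mulVec y.2 = 0 := (congrArg Prod.snd h1).symm
    have h3 : y.2 = 0 := by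
      have := congrArg (d w)⁻¹.mulVec h2
      simpa [Matrix.mulVec_mulVec, Matrix.nonsing_inv_mul _ hdet] using this
    have h4 : y = (y.1, 0) := by rw [← h3]
    rw [h4, hHV w hw] at hy
    rw [h4]; exact hy
  have hWbij : Function.Bijective (W w) := by
    have : ⇑(W w) = U w ∘ H w := funext fun y => (hUH w hw y).symm
    rw [this]
    exact (ContinuousLinearMap.isUnit_iff_bijective.1 hw).comp ⟨hHinj, hHsurj⟩
  have hBcomp : ⇑(B - w • 1 : X →L[ℂ] X) = Θ₀ ∘ W w ∘ E.symm := by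
    funext x
    simp [hW]
  rw [hBcomp]
  exact Θ₀.bijective.comp (hWbij.comp E.symm.bijective)

end Resolvent

/-! ### Essential spectral radius from contraction in finite codimension -/

section EssentialSpectralRadius

/-- Polar coordinates present the set as a continuous image of a connected product. -/
theorem isPreconnected_setOf_lt_norm (q : ℝ) : IsPreconnected {w : ℂ | q < ‖w‖} := by
  have himg : {w : ℂ | q < ‖w‖} =
      (fun p : ℝ × ℝ => (p.1 : ℂ) * Complex.exp (p.2 * Complex.I)) '' (Ioi q ×ˢ univ) := by
    ext w
    simp only [mem_ofPred_eq, mem_image, mem_prod, mem_Ioi, mem_univ, and_true, Prod.exists]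
    constructor
    · intro h
      exact ⟨‖w‖, w.arg, h, Complex.norm_mul_exp_arg_mul_I w⟩
    · rintro ⟨a, b, ha, rfl⟩
      rw [norm_mul, Complex.norm_exp_ofReal_mul_I, mul_one, Complex.norm_real, Real.norm_eq_abs]
      exact ha.trans_le (le_abs_self a)
  rw [himg]
  refine (isPreconnected_Ioi.prod isPreconnected_univ).image _ ?_
  exact Continuous.continuousOn (by fun_prop)

variable {X : Type*} [NormedAddCommGroup X] [NormedSpace ℂ X] [CompleteSpace X]

/-- If `B` is bounded by `q` on a subspace of finite codimension, every `w₀` with `q < ‖w₀‖` has a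
punctured neighborhood contained in the resolvent set of `B`. -/
theorem eventually_isUnit_sub_smul {B : X →L[ℂ] X} (V : Submodule ℂ X)
    [FiniteDimensional ℂ (X ⧸ V)] (hV : IsClosed (V : Set X)) {q : ℝ} (hq : 0 ≤ q)
    (hB : ∀ v ∈ V, ‖B v‖ ≤ q * ‖v‖) {w₀ : ℂ} (hw₀ : q < ‖w₀‖) :
    ∀ᶠ w in 𝓝[≠] w₀, IsUnit (B - w • 1) := by
  -- Open-closed argument inside `{|w| > q}`: `u` is open, contains points of large modulus, and is
  -- relatively closed by `resolvent_structure`.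
  set u : Set ℂ := {w | ∀ᶠ w' in 𝓝[≠] w, IsUnit (B - w' • 1)} with hu
  have hopen : IsOpen u := by
    rw [isOpen_iff_mem_nhds]
    intro w hw
    have h1 := eventually_eventually_nhdsWithin.2 (show ∀ᶠ w' in 𝓝[≠] w, _ from hw)
    rw [eventually_nhdsWithin_iff] at h1
    filter_upwards [h1] with w' hw'
    by_cases h : w' = w
    · rw [h]; exact hw
    · have h2 := hw' h
      rw [isOpen_compl_singleton.nhdsWithin_eq (show w' ∈ ({w} : Set ℂ)ᶜ from h)] at h2
      exact h2.filter_mono nhdsWithin_le_nhds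
  have hlarge : ∀ w : ℂ, ‖B‖ * ‖(1 : X →L[ℂ] X)‖ < ‖w‖ → IsUnit (B - w • 1) := fun w hw => by
    have := spectrum.mem_resolventSet_of_norm_lt_mul hw
    rw [spectrum.mem_resolventSet_iff, Algebra.algebraMap_eq_smul_one] at this
    rw [← neg_sub]
    exact this.neg
  have hne : ({w : ℂ | q < ‖w‖} ∩ u).Nonempty := by
    set R : ℝ := ‖B‖ * ‖(1 : X →L[ℂ] X)‖ + q + 1
    have hR : 0 ≤ R := by positivity
    have hRn : ‖(R : ℂ)‖ = R := by rw [Complex.norm_real, Real.norm_of_nonneg hR]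
    refine ⟨R, ?_, ?_⟩
    · change q < ‖(R : ℂ)‖
      rw [hRn]
      have : 0 ≤ ‖B‖ * ‖(1 : X →L[ℂ] X)‖ := by positivity
      simp only [R]; linarith
    · have h1 : ∀ᶠ w : ℂ in 𝓝 (R : ℂ), ‖B‖ * ‖(1 : X →L[ℂ] X)‖ < ‖w‖ := by
        refine continuous_norm.continuousAt.eventually (lt_mem_nhds ?_)
        change _ < ‖(R : ℂ)‖
        rw [hRn]; simp only [R]; linarith
      exact (h1.mono hlarge).filter_mono nhdsWithin_le_nhds
  have hclos : closure u ∩ {w : ℂ | q < ‖w‖} ⊆ u := by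
    rintro w ⟨hw, hqw⟩
    have hfreq : ∃ᶠ w' in 𝓝 w, IsUnit (B - w' • 1) := by
      intro hcon
      obtain ⟨w', hw'u, hw'⟩ :=
        ((mem_closure_iff_frequently.1 hw).and_eventually (eventually_eventually_nhds.2 hcon)).exists
      obtain ⟨x, hx1, hx2⟩ := ((show ∀ᶠ x in 𝓝[≠] w', _ from hw'u).and
        (hw'.filter_mono nhdsWithin_le_nhds)).exists
      exact hx2 hx1
    obtain ⟨-, p, M, h⟩ := resolvent_structure V hV (sub_pos.2 hqw) (fun v hv => by
      have h1 := hB v hv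
      have h2 := norm_sub_norm_le (w • v) (B v)
      rw [norm_smul, norm_sub_rev] at h2
      linarith) hfreq
    exact h.mono fun w hw => hw.1
  exact (isPreconnected_setOf_lt_norm q).subset_of_closure_inter_subset hopen hne hclos hw₀

/-- **Hennion's theorem**, in the following form: if the iterates `A ^ (n + m)` are bounded by
`C * r ^ n` on subspaces of finite codimension, then the essential spectral radius of `A` is
at most `r`. -/
theorem essSpectralRadius_le_of_finiteCodim (A : X →L[ℂ] X) {r C : ℝ} (hr : 0 ≤ r) (m : ℕ)
    (h : ∀ n : ℕ, ∃ V : Submodule ℂ X, IsClosed (V : Set X) ∧ FiniteDimensional ℂ (X ⧸ V) ∧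
      ∀ v ∈ V, ‖(A ^ (n + m)) v‖ ≤ C * r ^ n * ‖v‖) :
    essSpectralRadius A ≤ ENNReal.ofReal r := by
  refine iSup₂_le fun z hz => ?_
  by_contra hlt
  have hrz : r < ‖z‖ := by
    rw [← ofReal_norm, not_le] at hlt
    exact (ENNReal.ofReal_lt_ofReal_iff_of_nonneg hr).1 hlt
  apply hz
  have hz0 : 0 < ‖z‖ := hr.trans_lt hrz
  -- As `r < |z|`, a large power wins over the constant: on the corresponding `V`, the operator
  -- `A^(n+m)` has norm below `|z^(n+m)|`.
  obtain ⟨n, hn⟩ : ∃ n : ℕ, |C| * r ^ n < ‖z‖ ^ (n + m) := by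
    have h1 : Tendsto (fun n : ℕ => |C| * (r / ‖z‖) ^ n) atTop (𝓝 (|C| * 0)) :=
      (tendsto_pow_atTop_nhds_zero_of_lt_one (by positivity)
        ((div_lt_one hz0).2 hrz)).const_mul _
    rw [mul_zero] at h1
    obtain ⟨n, hn⟩ := (h1.eventually (gt_mem_nhds (pow_pos hz0 m))).exists
    refine ⟨n, ?_⟩
    rw [div_pow, mul_div_assoc', div_lt_iff₀ (pow_pos hz0 n)] at hn
    rwa [pow_add, mul_comm (‖z‖ ^ n)]
  obtain ⟨V, hV, hfin, hVb⟩ := h n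
  set k := n + m
  set B := A ^ k with hBdef
  set w₀ := z ^ k with hw₀
  set q := |C| * r ^ n
  have hq : 0 ≤ q := by positivity
  have hqw : q < ‖w₀‖ := by rw [hw₀, norm_pow]; exact hn
  have hBV : ∀ v ∈ V, ‖B v‖ ≤ q * ‖v‖ := fun v hv => by
    refine (hVb v hv).trans ?_
    exact mul_le_mul_of_nonneg_right (mul_le_mul_of_nonneg_right (le_abs_self C) (by positivity))
      (norm_nonneg v)
  have hev := eventually_isUnit_sub_smul V hV hq hBV hqw
  have hfreq : ∃ᶠ w in 𝓝 w₀, IsUnit (B - w • 1) :=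
    hev.frequently.filter_mono nhdsWithin_le_nhds
  obtain ⟨⟨Ψ, hΨ⟩, p, M, hpM⟩ := resolvent_structure V hV (sub_pos.2 hqw) (fun v hv => by
      have h1 := hBV v hv
      have h2 := norm_sub_norm_le (w₀ • v) (B v)
      rw [norm_smul, norm_sub_rev] at h2
      linarith) hfreq
  -- The factorization `A^k - z^k = (A - z) G`, with `G` commuting with `A`, carries the information
  -- on the power `B` back to `A` at `z`.
  set G : X →L[ℂ] X := ∑ i ∈ Finset.range k, A ^ i * (z • 1) ^ (k - 1 - i)
  have hz1 : Commute A (z • 1 : X →L[ℂ] X) := (Commute.one_right A).smul_right z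
  have hCG : B - w₀ • 1 = (A - z • 1) * G := by
    rw [hz1.mul_geom_sum₂, smul_pow, one_pow]
  have hAG : Commute A G := Commute.sum_right _ _ _ fun i _ =>
    ((Commute.refl A).pow_right i).mul_right (hz1.pow_right _)
  refine exists_fredholmDecomposition A (B - w₀ • 1) G z hCG hAG Ψ hΨ p fun x hx =>
    pow_apply_eq_zero_of_resolvent_growth _ p M ?_ x hx
  have htr : Tendsto (fun w : ℂ => w + w₀) (𝓝[≠] 0) (𝓝[≠] w₀) := by
    refine tendsto_nhdsWithin_iff.2 ⟨?_, ?_⟩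
    · have : Continuous fun w : ℂ => w + w₀ := by fun_prop
      simpa using (this.tendsto 0).mono_left (nhdsWithin_le_nhds (s := {0}ᶜ))
    · filter_upwards [self_mem_nhdsWithin] with w hw
      simpa using hw
  filter_upwards [htr.eventually hpM] with w hw x
  have := hw.2 x
  rw [add_sub_cancel_right] at this
  convert this using 3
  simp [add_smul]
  abel

end EssentialSpectralRadius

/-! ### Hölder estimates for test functions and Taylor remainders -/

section CkBounds

/-- `g` is of class `C^k`; on `s` its derivatives of order at most `k` are bounded by `A` and the
derivative of order `k` is `α`-Hölder with constant `A`. -/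
structure CkBoundOn (k : ℕ) (α : ℝ) (s : Set ℝ) (A : ℝ) (g : ℝ → ℂ) : Prop where
  contDiff : ContDiff ℝ k g
  bound : ∀ i ≤ k, ∀ x ∈ s, ‖iteratedDeriv i g x‖ ≤ A
  holder : ∀ x ∈ s, ∀ y ∈ s, ‖iteratedDeriv k g x - iteratedDeriv k g y‖ ≤ A * |x - y| ^ α

theorem ckExponent_nonneg (k : ℝ≥0) : (0 : ℝ) ≤ k - ⌊k⌋₊ :=
  sub_nonneg.2 (Nat.floor_le k.2)

theorem ckExponent_le_one (k : ℝ≥0) : (k : ℝ) - ⌊k⌋₊ ≤ 1 := by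
  have : (k : ℝ) < (⌊k⌋₊ : ℝ) + 1 := Nat.lt_floor_add_one k
  linarith

theorem ckExponent_coe (k : ℝ≥0) : ((k - ⌊k⌋₊ : ℝ≥0) : ℝ) = k - ⌊k⌋₊ := by
  rw [NNReal.coe_sub (Nat.floor_le k.2)]; simp

/-- The constant `2` covers integer `kh`: the Hölder exponent is then `0` and the Hölder clause only
bounds the oscillation of the top derivative. -/
theorem IsUnitTest.ckBoundOn {kh : ℝ≥0} {β : ℝ} {φ : ℝ → ℂ} (h : IsUnitTest kh β φ) :
    CkBoundOn ⌊kh⌋₊ (kh - ⌊kh⌋₊) univ 2 φ ∧ ∀ i ≤ ⌊kh⌋₊, ∀ x, ‖iteratedDeriv i φ x‖ ≤ 1 := by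
  have hb : ∀ i ≤ ⌊kh⌋₊, ∀ x, ‖iteratedDeriv i φ x‖ ≤ 1 := by
    intro i hi x
    have h1 : ‖iteratedDeriv i φ x‖ₑ ≤ ckNorm kh φ :=
      le_sup_of_le_left (le_iSup₂_of_le i hi (le_iSup (fun x => ‖iteratedDeriv i φ x‖ₑ) x))
    have h2 := h1.trans h.norm_le
    rwa [← ofReal_norm, ENNReal.ofReal_le_one] at h2
  refine ⟨⟨h.contDiff, fun i hi x _ => (hb i hi x).trans one_le_two, fun x _ y _ => ?_⟩, hb⟩
  by_cases hk : (⌊kh⌋₊ : ℝ≥0) = kh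
  · have h0 : (kh : ℝ) - ⌊kh⌋₊ = 0 := by
      rw [sub_eq_zero]; exact_mod_cast congrArg NNReal.toReal hk.symm
    rw [h0, Real.rpow_zero]
    have := norm_sub_le (iteratedDeriv ⌊kh⌋₊ φ x) (iteratedDeriv ⌊kh⌋₊ φ y)
    linarith [hb _ le_rfl x, hb _ le_rfl y]
  · have h1 : eHolderNorm (kh - ⌊kh⌋₊) (iteratedDeriv ⌊kh⌋₊ φ) ≤ 1 :=
      (le_sup_of_le_right (le_iSup (fun _ : (⌊kh⌋₊ : ℝ≥0) ≠ kh =>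
        eHolderNorm (kh - ⌊kh⌋₊) (iteratedDeriv ⌊kh⌋₊ φ)) hk)).trans h.norm_le
    have h2 : MemHolder (kh - ⌊kh⌋₊) (iteratedDeriv ⌊kh⌋₊ φ) :=
      eHolderNorm_lt_top.1 (h1.trans_lt ENNReal.one_lt_top)
    have h3 : HolderWith 1 (kh - ⌊kh⌋₊) (iteratedDeriv ⌊kh⌋₊ φ) := by
      refine h2.holderWith.mono ?_
      have := coe_nnHolderNorm_le_eHolderNorm.trans h1
      exact_mod_cast this
    have h4 := h3.dist_le x y
    rw [ckExponent_coe, dist_eq_norm, Real.dist_eq, NNReal.coe_one, one_mul] at h4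
    have : 0 ≤ |x - y| ^ ((kh : ℝ) - ⌊kh⌋₊) := by positivity
    linarith

theorem CkBoundOn.isUnitTest {kh : ℝ≥0} {β : ℝ} {φ : ℝ → ℂ}
    (h : CkBoundOn ⌊kh⌋₊ (kh - ⌊kh⌋₊) univ 1 φ) (hs : tsupport φ ⊆ Ioo 0 β) :
    IsUnitTest kh β φ := by
  refine ⟨h.contDiff, hs, sup_le (iSup₂_le fun i hi => iSup_le fun x => ?_) (iSup_le fun hk => ?_)⟩
  · rw [← ofReal_norm, ENNReal.ofReal_le_one]
    exact h.bound i hi x trivial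
  · have : HolderWith 1 (kh - ⌊kh⌋₊) (iteratedDeriv ⌊kh⌋₊ φ) := by
      intro x y
      have h1 := h.holder x trivial y trivial
      rw [one_mul, ← ckExponent_coe] at h1
      rw [edist_eq_enorm_sub, ← ofReal_norm, ENNReal.coe_one, one_mul, edist_dist,
        ENNReal.ofReal_rpow_of_nonneg dist_nonneg (NNReal.coe_nonneg _), Real.dist_eq]
      exact ENNReal.ofReal_le_ofReal h1
    simpa using this.eHolderNorm_le

theorem CkBoundOn.const_mul {k : ℕ} {α A : ℝ} {s : Set ℝ} {g : ℝ → ℂ} (h : CkBoundOn k α s A g)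
    (c : ℂ) : CkBoundOn k α s (‖c‖ * A) (fun x => c * g x) := by
  have hd : ∀ i ≤ k, ∀ x, iteratedDeriv i (fun x => c * g x) x = c * iteratedDeriv i g x :=
    fun i hi x => iteratedDeriv_const_mul c
      (h.contDiff.contDiffAt.of_le (by exact_mod_cast hi))
  refine ⟨contDiff_const.mul h.contDiff, fun i hi x hx => ?_, fun x hx y hy => ?_⟩
  · rw [hd i hi, norm_mul]
    exact mul_le_mul_of_nonneg_left (h.bound i hi x hx) (norm_nonneg _)
  · rw [hd k le_rfl, hd k le_rfl, ← mul_sub, norm_mul, mul_assoc]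
    exact mul_le_mul_of_nonneg_left (h.holder x hx y hy) (norm_nonneg _)

/-- A bound for the integrals against all unit tests gives a bound for the integrals against all
test functions. -/
theorem CkBoundOn.norm_integral_le {kh : ℝ≥0} {β A B : ℝ} {φ G : ℝ → ℂ}
    (h : CkBoundOn ⌊kh⌋₊ (kh - ⌊kh⌋₊) univ A φ) (hs : tsupport φ ⊆ Ioo 0 β) (hA : 0 ≤ A)
    (hB : ∀ φ', IsUnitTest kh β φ' → ‖∫ t in (0 : ℝ)..β, φ' t * G t‖ ≤ B) :
    ‖∫ t in (0 : ℝ)..β, φ t * G t‖ ≤ A * B := by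
  rcases hA.eq_or_lt with rfl | hpos
  · have h0 : ∀ t, φ t = 0 := fun t => by
      simpa using h.bound 0 (Nat.zero_le _) t trivial
    simp [h0]
  · have h1 := h.const_mul ((A⁻¹ : ℝ) : ℂ)
    rw [Complex.norm_real, Real.norm_of_nonneg (by positivity), inv_mul_cancel₀ hpos.ne'] at h1
    have h2 := hB _ (h1.isUnitTest ((tsupport_mul_subset_right).trans hs))
    have h3 : (∫ t in (0 : ℝ)..β, ((A⁻¹ : ℝ) : ℂ) * φ t * G t) =
        ((A⁻¹ : ℝ) : ℂ) * ∫ t in (0 : ℝ)..β, φ t * G t := by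
      rw [← intervalIntegral.integral_const_mul]
      simp only [mul_assoc]
    rw [h3, norm_mul, Complex.norm_real, Real.norm_of_nonneg (by positivity),
      inv_mul_le_iff₀ hpos] at h2
    exact h2

theorem iteratedDeriv_eq_zero_of_notMem_tsupport {g : ℝ → ℂ} {x : ℝ} (hx : x ∉ tsupport g)
    (i : ℕ) : iteratedDeriv i g x = 0 := by
  have h1 : g =ᶠ[𝓝 x] fun _ => 0 := notMem_tsupport_iff_eventuallyEq.1 hx
  rw [h1.iteratedDeriv_eq i]
  simp

/-- For functions supported in an interval, estimates on this interval are global. -/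
theorem CkBoundOn.univ_of_tsupport {k : ℕ} {α A δ : ℝ} {g : ℝ → ℂ}
    (h : CkBoundOn k α (Icc 0 δ) A g) (hs : tsupport g ⊆ Ioo 0 δ) (hA : 0 ≤ A) (hδ : 0 ≤ δ)
    (hα : 0 ≤ α) : CkBoundOn k α univ A g := by
  have hz : ∀ x ∉ Ioo 0 δ, ∀ i, iteratedDeriv i g x = 0 := fun x hx i =>
    iteratedDeriv_eq_zero_of_notMem_tsupport (fun h => hx (hs h)) i
  refine ⟨h.contDiff, fun i hi x _ => ?_, fun x _ y _ => ?_⟩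
  · by_cases hx : x ∈ Ioo 0 δ
    · exact h.bound i hi x (Ioo_subset_Icc_self hx)
    · rw [hz x hx, norm_zero]; exact hA
  -- Clamping to `[0, δ]` is 1-Lipschitz and does not change the value of the top derivative, which
  -- vanishes outside `(0, δ)`.
  · set P : ℝ → ℝ := fun x => projIcc 0 δ hδ x with hP
    have hPg : ∀ x, iteratedDeriv k g x = iteratedDeriv k g (P x) := by
      intro x
      by_cases hx : x ∈ Icc 0 δ
      · simp only [hP, projIcc_of_mem hδ hx]
      · rw [hz x fun h => hx (Ioo_subset_Icc_self h)]
        rcases lt_or_ge x 0 with h0 | h0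
        · simp only [hP, projIcc_of_le_left hδ h0.le]
          rw [hz 0 (by simp)]
        · have h1 : δ ≤ x := by
            by_contra h2
            exact hx ⟨h0, (not_le.1 h2).le⟩
          simp only [hP, projIcc_of_right_le hδ h1]
          rw [hz δ (by simp)]
    rw [hPg x, hPg y]
    refine (h.holder _ (projIcc 0 δ hδ x).2 _ (projIcc 0 δ hδ y).2).trans ?_
    have : |P x - P y| ≤ |x - y| := by
      have := (LipschitzWith.projIcc hδ).dist_le_mul x y
      simpa [Subtype.dist_eq, Real.dist_eq] using this
    gcongr

/-- On bounded intervals this turns Lipschitz estimates into Hölder ones, at the price of a factor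
`D^(1-α) ≤ D`. -/
theorem le_mul_rpow_of_le {x D α : ℝ} (hx : 0 ≤ x) (hxD : x ≤ D) (hD : 1 ≤ D) (hα : 0 ≤ α)
    (hα1 : α ≤ 1) : x ≤ D * x ^ α := by
  rcases hx.eq_or_lt with rfl | hpos
  · positivity
  · have h1 : x = x ^ (1 - α) * x ^ α := by
      rw [← Real.rpow_add hpos]; simp
    have h2 : x ^ (1 - α) ≤ D := by
      calc x ^ (1 - α) ≤ D ^ (1 - α) := by gcongr
        _ ≤ D ^ (1 : ℝ) := Real.rpow_le_rpow_of_exponent_le hD (by linarith)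
        _ = D := Real.rpow_one D
    calc x = x ^ (1 - α) * x ^ α := h1
      _ ≤ D * x ^ α := by gcongr

theorem norm_iteratedDeriv_sub_le {g : ℝ → ℂ} {n i : ℕ} (hg : ContDiff ℝ n g) (hi : i < n) {M : ℝ}
    {s : Set ℝ} (hs : Convex ℝ s) (hM : ∀ x ∈ s, ‖iteratedDeriv (i + 1) g x‖ ≤ M) {x y : ℝ}
    (hx : x ∈ s) (hy : y ∈ s) : ‖iteratedDeriv i g x - iteratedDeriv i g y‖ ≤ M * |x - y| := by
  refine hs.norm_image_sub_le_of_norm_deriv_le (𝕜 := ℝ) (fun z _ => ?_) (fun z hz => ?_) hy hx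
  · exact (hg.differentiable_iteratedDeriv i (by exact_mod_cast hi)).differentiableAt
  · rw [← iteratedDeriv_succ]; exact hM z hz

/-- A function with bounded derivatives up to order `k + 1` satisfies `C^(k+α)` bounds. -/
theorem CkBoundOn.of_bound_succ {g : ℝ → ℂ} {k : ℕ} (hg : ContDiff ℝ ((k + 1 : ℕ) : ℕ∞) g) {M α : ℝ}
    (hM : ∀ i ≤ k + 1, ∀ x, ‖iteratedDeriv i g x‖ ≤ M) (hα : 0 ≤ α) (hα1 : α ≤ 1) :
    CkBoundOn k α univ (2 * M) g := by
  have hM0 : 0 ≤ M := (norm_nonneg _).trans (hM 0 (Nat.zero_le _) 0)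
  refine ⟨hg.of_le (by exact_mod_cast Nat.le_succ k), fun i hi x _ => ?_, fun x _ y _ => ?_⟩
  · have := hM i (by omega) x
    linarith
  -- The mean value inequality handles close points; for distant ones `|x - y|^α ≥ 1` and twice the
  -- sup bound suffices.
  · rcases le_total |x - y| 1 with h | h
    · have h1 := norm_iteratedDeriv_sub_le (i := k) hg (Nat.lt_succ_self k) convex_univ
        (fun x _ => hM (k + 1) le_rfl x) (mem_univ x) (mem_univ y)
      have h2 := le_mul_rpow_of_le (abs_nonneg (x - y)) h le_rfl hα hα1
      have h3 : 0 ≤ |x - y| ^ α := by positivity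
      nlinarith
    · have h1 := norm_sub_le (iteratedDeriv k g x) (iteratedDeriv k g y)
      have h2 := hM k (by omega) x
      have h3 := hM k (by omega) y
      have h4 : 1 ≤ |x - y| ^ α := Real.one_le_rpow h hα
      nlinarith

theorem exists_bound_iteratedDeriv {ρ : ℝ → ℂ} (hρ : ContDiff ℝ ∞ ρ) (hs : HasCompactSupport ρ)
    (n : ℕ) : ∃ M : ℝ, 0 ≤ M ∧ ∀ i ≤ n, ∀ x, ‖iteratedDeriv i ρ x‖ ≤ M := by
  have h1 : ∀ i : ℕ, ∃ M : ℝ, ∀ x, ‖iteratedDeriv i ρ x‖ ≤ M := by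
    intro i
    have hc : Continuous (iteratedDeriv i ρ) := hρ.continuous_iteratedDeriv i (by exact_mod_cast le_top)
    refine hc.bounded_above_of_compact_support ?_
    refine HasCompactSupport.intro hs fun x hx => iteratedDeriv_eq_zero_of_notMem_tsupport hx i
  choose M hM using h1
  refine ⟨∑ i ∈ Finset.range (n + 1), |M i|, by positivity, fun i hi x => ?_⟩
  exact (hM i x).trans ((le_abs_self _).trans (Finset.single_le_sum (f := fun i => |M i|)
    (fun i _ => abs_nonneg _) (Finset.mem_range.2 (Nat.lt_succ_of_le hi))))

/-- Multiplication by a fixed smooth function preserves `C^(k+α)` bounds. -/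
theorem CkBoundOn.mul_smooth {ρ : ℝ → ℂ} (hρ : ContDiff ℝ ∞ ρ) {k : ℕ} {M : ℝ} (hM0 : 0 ≤ M)
    (hM : ∀ i ≤ k + 1, ∀ x, ‖iteratedDeriv i ρ x‖ ≤ M) {α A δ D : ℝ} {g : ℝ → ℂ}
    (h : CkBoundOn k α (Icc 0 δ) A g) (hA : 0 ≤ A) (hD : 1 ≤ D) (hδD : δ ≤ D) (hα : 0 ≤ α)
    (hα1 : α ≤ 1) : CkBoundOn k α (Icc 0 δ) (2 ^ (k + 1) * M * D * A) (fun x => ρ x * g x) := by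
  have hexp : ∀ i ≤ k, ∀ x, iteratedDeriv i (fun x => ρ x * g x) x = ∑ j ∈ Finset.range (i + 1),
      i.choose j * iteratedDeriv j ρ x * iteratedDeriv (i - j) g x := fun i hi x =>
    iteratedDeriv_mul (hρ.contDiffAt.of_le (by exact_mod_cast le_top))
      (h.contDiff.contDiffAt.of_le (by exact_mod_cast hi))
  have hchoose : ∀ i ≤ k, ∀ c : ℝ, 0 ≤ c →
      ∑ j ∈ Finset.range (i + 1), (i.choose j : ℝ) * c ≤ 2 ^ k * c := by
    intro i hi c hc
    rw [← Finset.sum_mul]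
    have h1 : (∑ j ∈ Finset.range (i + 1), (i.choose j : ℝ)) = 2 ^ i := by
      exact_mod_cast Nat.sum_range_choose i
    rw [h1]
    gcongr
    exact one_le_two
  refine ⟨(hρ.of_le (by exact_mod_cast le_top)).mul h.contDiff, fun i hi x hx => ?_,
    fun x hx y hy => ?_⟩
  · rw [hexp i hi]
    refine (norm_sum_le _ _).trans ?_
    calc ∑ j ∈ Finset.range (i + 1), ‖(i.choose j : ℂ) * iteratedDeriv j ρ x *
            iteratedDeriv (i - j) g x‖
        ≤ ∑ j ∈ Finset.range (i + 1), (i.choose j : ℝ) * (M * A) := by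
          refine Finset.sum_le_sum fun j hj => ?_
          have hj' := Finset.mem_range.1 hj
          rw [norm_mul, norm_mul, Complex.norm_natCast, mul_assoc]
          gcongr
          · exact hM j (by omega) x
          · exact h.bound _ (by omega) x hx
      _ ≤ 2 ^ k * (M * A) := hchoose i hi _ (by positivity)
      _ = (2 ^ k * M * A) * 1 := by ring
      _ ≤ (2 ^ k * M * A) * (2 * D) := by gcongr; linarith
      _ = _ := by ring
  · have hxy : |x - y| ≤ δ := by
      rw [abs_le]; constructor <;> linarith [hx.1, hx.2, hy.1, hy.2]
    have hle := le_mul_rpow_of_le (abs_nonneg (x - y)) (hxy.trans hδD) hD hα hα1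
    have hr0 : 0 ≤ |x - y| ^ α := by positivity
    rw [hexp k le_rfl, hexp k le_rfl, ← Finset.sum_sub_distrib]
    refine (norm_sum_le _ _).trans ?_
    calc ∑ j ∈ Finset.range (k + 1), ‖(k.choose j : ℂ) * iteratedDeriv j ρ x *
            iteratedDeriv (k - j) g x - (k.choose j : ℂ) * iteratedDeriv j ρ y *
            iteratedDeriv (k - j) g y‖
        ≤ ∑ j ∈ Finset.range (k + 1), (k.choose j : ℝ) * (2 * M * D * A * |x - y| ^ α) := by
          refine Finset.sum_le_sum fun j hj => ?_
          have hj' := Finset.mem_range.1 hj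
          have e : (k.choose j : ℂ) * iteratedDeriv j ρ x *
            iteratedDeriv (k - j) g x - (k.choose j : ℂ) * iteratedDeriv j ρ y *
            iteratedDeriv (k - j) g y = (k.choose j : ℂ) * (iteratedDeriv j ρ x *
              (iteratedDeriv (k - j) g x - iteratedDeriv (k - j) g y) +
              (iteratedDeriv j ρ x - iteratedDeriv j ρ y) * iteratedDeriv (k - j) g y) := by ring
          rw [e, norm_mul, Complex.norm_natCast]
          gcongr
          refine (norm_add_le _ _).trans ?_
          rw [norm_mul, norm_mul]
          -- For `j = 0` the top derivative is only known to be Hölder; lower derivatives are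
          -- Lipschitz, hence Hölder with loss `D`.
          have h1 : ‖iteratedDeriv (k - j) g x - iteratedDeriv (k - j) g y‖ ≤
              A * (D * |x - y| ^ α) := by
            rcases Nat.eq_zero_or_pos j with rfl | hj0
            · refine (h.holder x hx y hy).trans ?_
              gcongr
              exact le_mul_of_one_le_left hr0 hD
            · refine (norm_iteratedDeriv_sub_le h.contDiff (i := k - j) (by omega)
                (convex_Icc 0 δ) (fun z hz => h.bound _ (by omega) z hz) hx hy).trans ?_
              gcongr
          have h2 : ‖iteratedDeriv j ρ x - iteratedDeriv j ρ y‖ ≤ M * (D * |x - y| ^ α) := by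
            refine (norm_iteratedDeriv_sub_le (n := j + 1) (i := j)
              (hρ.of_le (by exact_mod_cast le_top)) (Nat.lt_succ_self j)
              convex_univ (fun z _ => hM _ (by omega) z) (mem_univ x) (mem_univ y)).trans ?_
            gcongr
          have h3 := h.bound (k - j) (by omega) y hy
          calc _ ≤ M * (A * (D * |x - y| ^ α)) + M * (D * |x - y| ^ α) * A := by
                gcongr
                exact hM j (by omega) x
            _ = _ := by ring
      _ ≤ 2 ^ k * (2 * M * D * A * |x - y| ^ α) := hchoose k le_rfl _ (by positivity)
      _ = _ := by ring

/-- The remainder in the Taylor expansion of order `k` of `g` at `a`. -/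
def taylorRemainder (k : ℕ) (a : ℝ) (g : ℝ → ℂ) (t : ℝ) : ℂ :=
  g t - ∑ i ∈ Finset.range (k + 1),
    iteratedDeriv i g a * (((t - a) ^ i / i.factorial : ℝ) : ℂ)

theorem contDiff_taylorMonomial (a : ℝ) (i : ℕ) {n : WithTop ℕ∞} :
    ContDiff ℝ n fun t : ℝ => (((t - a) ^ i / i.factorial : ℝ) : ℂ) :=
  Complex.ofRealCLM.contDiff.comp (((contDiff_id.sub contDiff_const).pow i).div_const _)

theorem contDiff_taylorRemainder {k : ℕ} {n : ℕ∞} (a : ℝ) {g : ℝ → ℂ} (hg : ContDiff ℝ n g) :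
    ContDiff ℝ n (taylorRemainder k a g) :=
  hg.sub (ContDiff.sum fun i _ => contDiff_const.mul (contDiff_taylorMonomial a i))

/-- Drives the induction on the order in `ckBoundOn_taylorRemainder`: the monomials `(t - a)^i / i!`
differentiate into one another. -/
theorem deriv_taylorRemainder_succ (k : ℕ) (a : ℝ) {g : ℝ → ℂ} (hg : Differentiable ℝ g) :
    deriv (taylorRemainder (k + 1) a g) = taylorRemainder k a (deriv g) := by
  funext t
  apply HasDerivAt.deriv
  unfold taylorRemainder
  refine (hg t).hasDerivAt.sub ?_
  have hmon : ∀ i : ℕ, HasDerivAt (fun t : ℝ => (((t - a) ^ (i + 1) / (i + 1).factorial : ℝ) : ℂ))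
      ((((t - a) ^ i / i.factorial : ℝ) : ℂ)) t := by
    intro i
    have h1 : HasDerivAt (fun t : ℝ => (t - a) ^ (i + 1) / (i + 1).factorial)
        ((t - a) ^ i / i.factorial) t := by
      have h2 := ((((hasDerivAt_id t).sub_const a).pow (i + 1)).div_const
        ((i + 1).factorial : ℝ))
      refine h2.congr_deriv ?_
      rw [Nat.factorial_succ]
      have : (i.factorial : ℝ) ≠ 0 := by positivity
      push_cast
      simp only [id]
      field_simp
    exact h1.ofReal_comp
  have e : (fun t : ℝ => ∑ i ∈ Finset.range (k + 1 + 1),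
      iteratedDeriv i g a * (((t - a) ^ i / i.factorial : ℝ) : ℂ)) = fun t : ℝ =>
      (∑ i ∈ Finset.range (k + 1), iteratedDeriv (i + 1) g a *
        (((t - a) ^ (i + 1) / (i + 1).factorial : ℝ) : ℂ)) + g a := by
    funext t
    rw [Finset.sum_range_succ']
    simp
  rw [e]
  refine HasDerivAt.add_const _ (HasDerivAt.fun_sum fun i _ => ?_)
  rw [← iteratedDeriv_succ']
  exact (hmon i).const_mul _

/-- Estimate of the Taylor remainder in terms of the Hölder constant of the top derivative. -/
theorem ckBoundOn_taylorRemainder {α A δ D a : ℝ} (hA : 0 ≤ A) (hD : 1 ≤ D) (hδD : δ ≤ D)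
    (hα : 0 ≤ α) (hα1 : α ≤ 1) (ha : a ∈ Icc 0 δ) (k : ℕ) (g : ℝ → ℂ) (hg : ContDiff ℝ k g)
    (h : ∀ x ∈ Icc 0 δ, ∀ y ∈ Icc 0 δ,
      ‖iteratedDeriv k g x - iteratedDeriv k g y‖ ≤ A * |x - y| ^ α) :
    CkBoundOn k α (Icc 0 δ) (A * D ^ (k + 1)) (taylorRemainder k a g) := by
  have hdist : ∀ x ∈ Icc 0 δ, |x - a| ≤ D := fun x hx => by
    refine le_trans ?_ hδD
    rw [abs_le]; constructor <;> linarith [hx.1, hx.2, ha.1, ha.2]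
  have hD0 : 0 ≤ D := zero_le_one.trans hD
  induction k generalizing g with
  | zero =>
    have e : taylorRemainder 0 a g = fun t => g t - g a := by
      funext t; simp [taylorRemainder]
    have hh : ∀ x ∈ Icc 0 δ, ∀ y ∈ Icc 0 δ, ‖g x - g y‖ ≤ A * |x - y| ^ α := by simpa using h
    have hAD : A ≤ A * D ^ (0 + 1) := by
      rw [zero_add, pow_one]; exact le_mul_of_one_le_right hA hD
    rw [e]
    refine ⟨hg.sub contDiff_const, fun i hi x hx => ?_, fun x hx y hy => ?_⟩
    · rw [Nat.le_zero.1 hi, iteratedDeriv_zero]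
      refine (hh x hx a ha).trans ?_
      rw [zero_add, pow_one]
      gcongr
      calc |x - a| ^ α ≤ D ^ α := by gcongr; exact hdist x hx
        _ ≤ D ^ (1 : ℝ) := Real.rpow_le_rpow_of_exponent_le hD hα1
        _ = D := Real.rpow_one D
    · simp only [iteratedDeriv_zero, sub_sub_sub_cancel_right]
      exact (hh x hx y hy).trans (by gcongr)
  | succ k ih =>
    have hgd : Differentiable ℝ g := hg.differentiable (by simp)
    have hg' : ContDiff ℝ k (deriv g) := by
      have : ContDiff ℝ ((k : WithTop ℕ∞) + 1) g := by exact_mod_cast hg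
      exact (contDiff_succ_iff_deriv.1 this).2.2
    have hstep := ih (deriv g) hg' (by simpa only [iteratedDeriv_succ'] using h)
    rw [← deriv_taylorRemainder_succ k a hgd] at hstep
    have hcd : ContDiff ℝ ((k + 1 : ℕ) : ℕ∞) (taylorRemainder (k + 1) a g) :=
      contDiff_taylorRemainder a (by exact_mod_cast hg)
    have hle : A * D ^ (k + 1) ≤ A * D ^ (k + 1 + 1) := by
      gcongr
      omega
    refine ⟨by exact_mod_cast hcd, fun i hi x hx => ?_, fun x hx y hy => ?_⟩
    · rcases i with _ | i
      -- The induction hypothesis concerns the derivative only. Order `0` comes from the mean value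
      -- inequality starting at `a`, where the remainder vanishes, and costs one factor `D`.
      · have h0 : taylorRemainder (k + 1) a g a = 0 := by
          simp [taylorRemainder, Finset.sum_range_succ']
        have h1 := norm_iteratedDeriv_sub_le (i := 0) hcd (Nat.succ_pos k) (convex_Icc 0 δ)
          (fun z hz => by
            rw [iteratedDeriv_succ']; exact hstep.bound 0 (Nat.zero_le _) z hz) hx ha
        rw [iteratedDeriv_zero, h0, sub_zero] at h1
        rw [iteratedDeriv_zero]
        refine h1.trans ?_
        rw [pow_succ D (k + 1), ← mul_assoc]
        gcongr
        exact hdist x hx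
      · rw [iteratedDeriv_succ']
        exact (hstep.bound i (by omega) x hx).trans hle
    · rw [iteratedDeriv_succ']
      exact (hstep.holder x hx y hy).trans (by gcongr)

end CkBounds

/-! ### A smooth partition of unity by translates of a window -/

section Windows

/-- A smooth step from `0` to `1` inside `[0, δ / 2]`. -/
def smoothStep (δ s : ℝ) : ℝ := Real.smoothTransition (4 * s / δ - 1 / 2)

/-- A smooth function supported in `(0, δ)` whose translates by the multiples of `δ / 2` form a
partition of unity. -/
def window (δ s : ℝ) : ℂ := ((smoothStep δ s - smoothStep δ (s - δ / 2) : ℝ) : ℂ)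

theorem contDiff_smoothStep (δ : ℝ) : ContDiff ℝ ∞ (smoothStep δ) :=
  Real.smoothTransition.contDiff.comp
    (((contDiff_const.mul contDiff_id).div_const _).sub contDiff_const)

theorem contDiff_window (δ : ℝ) : ContDiff ℝ ∞ (window δ) :=
  Complex.ofRealCLM.contDiff.comp ((contDiff_smoothStep δ).sub
    ((contDiff_smoothStep δ).comp (contDiff_id.sub contDiff_const)))

theorem smoothStep_eq_zero {δ s : ℝ} (hδ : 0 < δ) (hs : s ≤ δ / 8) : smoothStep δ s = 0 := by
  refine Real.smoothTransition.zero_of_nonpos ?_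
  rw [sub_nonpos, div_le_iff₀ hδ]; linarith

theorem smoothStep_eq_one {δ s : ℝ} (hδ : 0 < δ) (hs : 3 * δ / 8 ≤ s) : smoothStep δ s = 1 := by
  refine Real.smoothTransition.one_of_one_le ?_
  rw [le_sub_iff_add_le, le_div_iff₀ hδ]; linarith

/-- The step rises on `[δ/8, 3δ/8]` and its translate on `[5δ/8, 7δ/8]`; outside the hull of these
intervals they cancel. -/
theorem tsupport_window_subset {δ : ℝ} (hδ : 0 < δ) :
    tsupport (window δ) ⊆ Icc (δ / 8) (7 * δ / 8) := by
  refine closure_minimal (fun s hs => ?_) isClosed_Icc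
  by_contra h
  apply hs
  rcases lt_or_ge s (δ / 8) with h1 | h1
  · simp [window, smoothStep_eq_zero hδ h1.le,
      smoothStep_eq_zero hδ (show s - δ / 2 ≤ δ / 8 by linarith)]
  · have h2 : 7 * δ / 8 < s := by
      by_contra h3
      exact h ⟨h1, not_lt.1 h3⟩
    simp [window, smoothStep_eq_one hδ (show 3 * δ / 8 ≤ s by linarith),
      smoothStep_eq_one hδ (show 3 * δ / 8 ≤ s - δ / 2 by linarith)]

theorem tsupport_window_subset_Ioo {δ : ℝ} (hδ : 0 < δ) : tsupport (window δ) ⊆ Ioo 0 δ :=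
  (tsupport_window_subset hδ).trans fun s hs => ⟨by linarith [hs.1], by linarith [hs.2]⟩

theorem hasCompactSupport_window {δ : ℝ} (hδ : 0 < δ) : HasCompactSupport (window δ) :=
  isCompact_Icc.of_isClosed_subset (isClosed_tsupport _) (tsupport_window_subset hδ)

/-- A telescoping sum of steps. The shift `j - 1` starts the windows at `-δ/2`, so that the first
step is already `1` on the whole range, while the last is still `0`. -/
theorem sum_window_eq_one {δ s : ℝ} (hδ : 0 < δ) {n : ℕ} (h0 : 0 ≤ s) (hn : s ≤ n * (δ / 2)) :
    ∑ j ∈ Finset.range (n + 1), window δ (s - ((j : ℝ) - 1) * (δ / 2)) = 1 := by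
  have h1 : ∀ j : ℕ, window δ (s - ((j : ℝ) - 1) * (δ / 2)) =
      (smoothStep δ (s - ((j : ℝ) - 1) * (δ / 2)) : ℂ) -
        (smoothStep δ (s - (((j + 1 : ℕ) : ℝ) - 1) * (δ / 2)) : ℂ) := by
    intro j
    have e : s - ((j : ℝ) - 1) * (δ / 2) - δ / 2 = s - (((j + 1 : ℕ) : ℝ) - 1) * (δ / 2) := by
      push_cast; ring
    rw [window, e, Complex.ofReal_sub]
  simp only [h1]
  rw [Finset.sum_range_sub', smoothStep_eq_one hδ (by push_cast; linarith),
    smoothStep_eq_zero hδ (by push_cast; linarith)]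
  simp

end Windows

/-! ### Cutting long horizontal segments -/

namespace TranslationSurface

variable {M : Type*} [TopologicalSpace M] {S : TranslationSurface M}

theorem IsHorizontalSegment.shift {L δ a : ℝ} {γ : ℝ → M} (h : S.IsHorizontalSegment L γ)
    (ha : 0 ≤ a) (haL : a + δ ≤ L) : S.IsHorizontalSegment δ fun t => γ (a + t) := by
  have hmaps : MapsTo (fun t => a + t) (Icc 0 δ) (Icc 0 L) := fun t ht =>
    ⟨by linarith [ht.1], by linarith [ht.2]⟩
  refine ⟨h.continuousOn.comp (by fun_prop) hmaps, fun t ht => h.notMem_sing _ (hmaps ht),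
    fun t ht e he hte => ?_⟩
  have hc : Tendsto (fun t => a + t) (𝓝[Icc 0 δ] t) (𝓝[Icc 0 L] (a + t)) :=
    (show Continuous fun t : ℝ => a + t by fun_prop).continuousWithinAt.tendsto_nhdsWithin hmaps
  filter_upwards [hc.eventually (h.horizontal _ (hmaps ht) e he hte)] with s hs
  rw [hs]
  push_cast
  ring

/-- The integral of a test function along a window inside a long horizontal segment. -/
theorem norm_integral_window_le {kh : ℝ≥0} {L δ A B B' D Mw : ℝ} (hδ : 0 < δ) (hδL : δ ≤ L)
    {γ : ℝ → M} (hγ : S.IsHorizontalSegment L γ) {φ : ℝ → ℂ} (hA : 0 ≤ A) (hD : 1 ≤ D)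
    (hδD : δ ≤ D) (hMw0 : 0 ≤ Mw)
    (hMw : ∀ i ≤ ⌊kh⌋₊ + 1, ∀ x, ‖iteratedDeriv i (window δ) x‖ ≤ Mw)
    (hφ : ContDiff ℝ ⌊kh⌋₊ φ) (hφs : tsupport φ ⊆ Ioo 0 L)
    (hφ1 : ∀ i ≤ ⌊kh⌋₊, ∀ x, ‖iteratedDeriv i φ x‖ ≤ 1)
    (hφh : ∀ x y, ‖iteratedDeriv ⌊kh⌋₊ φ x - iteratedDeriv ⌊kh⌋₊ φ y‖ ≤
      A * |x - y| ^ ((kh : ℝ) - ⌊kh⌋₊)) {g : M → ℂ} (hg : Continuous g)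
    (hB : ∀ γ', S.IsHorizontalSegment δ γ' → ∀ φ', IsUnitTest kh δ φ' →
      ‖∫ t in (0 : ℝ)..δ, φ' t * g (γ' t)‖ ≤ B)
    (hB' : ∀ γ', S.IsHorizontalSegment δ γ' → ∀ i ≤ ⌊kh⌋₊,
      ‖∫ t in (0 : ℝ)..δ, window δ t * ((t ^ i / i.factorial : ℝ) : ℂ) * g (γ' t)‖ ≤ B')
    (c : ℝ) :
    ‖∫ t in (0 : ℝ)..L, window δ (t - c) * φ t * g (γ t)‖ ≤
      2 ^ (⌊kh⌋₊ + 1) * Mw * D * (A * D ^ (⌊kh⌋₊ + 1)) * B + (⌊kh⌋₊ + 1) * B' := by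
  set k := ⌊kh⌋₊ with hk
  have hα := ckExponent_nonneg kh
  have hα1 := ckExponent_le_one kh
  set α : ℝ := (kh : ℝ) - ⌊kh⌋₊ with hαdef
  have hD0 : 0 ≤ D := zero_le_one.trans hD
  set K := 2 ^ (k + 1) * Mw * D * (A * D ^ (k + 1)) with hK
  have hK0 : 0 ≤ K := by positivity
  -- The window at `c` may stick out of `[0, L]`. Clamping its origin gives a genuine segment of
  -- length `δ` which still contains the support of the product with `φ`.
  set a := max 0 (min c (L - δ)) with ha
  have ha0 : 0 ≤ a := le_max_left _ _
  have haL : a + δ ≤ L := by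
    have : a ≤ L - δ := max_le (by linarith) (min_le_right _ _)
    linarith
  have hγa := hγ.shift ha0 haL
  have hB'0 : 0 ≤ B' := (norm_nonneg _).trans (hB' _ hγa 0 (Nat.zero_le _))
  set F : ℝ → ℂ := fun t => window δ (t - c) * φ t * g (γ t) with hF
  have hFsupp : Function.support F ⊆ Ioo (max 0 c) (min L (c + δ)) := by
    intro t ht
    have h1 : window δ (t - c) ≠ 0 := fun h => ht (by simp [hF, h])
    have h2 : φ t ≠ 0 := fun h => ht (by simp [hF, h])
    have h3 := tsupport_window_subset_Ioo hδ (subset_tsupport _ h1)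
    have h4 := hφs (subset_tsupport _ h2)
    exact ⟨max_lt h4.1 (by linarith [h3.1]), lt_min h4.2 (by linarith [h3.2])⟩
  have hcases : (c < 0 ∧ a = 0) ∨ (0 ≤ c ∧ c ≤ L - δ ∧ a = c) ∨ (L - δ < c ∧ a = L - δ) := by
    rcases lt_or_ge c 0 with h | h
    · left
      exact ⟨h, max_eq_left ((min_le_left _ _).trans h.le)⟩
    · right
      rcases le_or_gt c (L - δ) with h' | h'
      · left; exact ⟨h, h', by rw [ha, min_eq_left h', max_eq_right h]⟩
      · right; exact ⟨h', by rw [ha, min_eq_right h'.le, max_eq_right (by linarith)]⟩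
  have hmove : (∫ t in (0 : ℝ)..L, F t) =
      ∫ t in (0 : ℝ)..δ, window δ (a + t - c) * φ (a + t) * g (γ (a + t)) := by
    have h1 : (∫ t in (0 : ℝ)..L, F t) = ∫ t, F t := by
      refine intervalIntegral.integral_eq_integral_of_support_subset fun t ht => ?_
      have := hFsupp ht
      exact ⟨(le_max_left _ _).trans_lt this.1, (this.2.trans_le (min_le_left _ _)).le⟩
    have h2 : (∫ t in a..a + δ, F t) = ∫ t, F t := by
      refine intervalIntegral.integral_eq_integral_of_support_subset fun t ht => ?_
      have h3 := hFsupp ht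
      have e1 := (le_max_left (0 : ℝ) c).trans_lt h3.1
      have e2 := (le_max_right (0 : ℝ) c).trans_lt h3.1
      have e3 := h3.2.trans_le (min_le_left _ _)
      have e4 := h3.2.trans_le (min_le_right _ _)
      rcases hcases with ⟨h, h'⟩ | ⟨h, h', h''⟩ | ⟨h, h'⟩ <;> constructor <;> linarith
    rw [h1, ← h2]
    have h4 := intervalIntegral.integral_comp_add_left (a := 0) (b := δ) F a
    rw [add_zero] at h4
    rw [← h4]
  rw [hmove]
  set φa : ℝ → ℂ := fun t => φ (a + t) with hφa
  set w : ℝ → ℂ := fun t => window δ (a + t - c) with hw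
  have hφad : ∀ i, iteratedDeriv i φa = fun t => iteratedDeriv i φ (a + t) := fun i =>
    iteratedDeriv_comp_const_add i φ a
  have hwsmooth : ContDiff ℝ ∞ w := (contDiff_window δ).comp (by fun_prop)
  have hwb : ∀ i ≤ k + 1, ∀ x, ‖iteratedDeriv i w x‖ ≤ Mw := by
    intro i hi x
    have e : w = fun t => window δ (t + (a - c)) := by
      funext t; simp only [hw]; congr 1; ring
    rw [e, iteratedDeriv_comp_add_const]
    exact hMw i hi _
  have hφac : ContDiff ℝ k φa := hφ.comp (by fun_prop)
  have htay : ∀ b ∈ Icc 0 δ, CkBoundOn k α (Icc 0 δ) K (fun t => w t * taylorRemainder k b φa t) := by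
    intro b hb
    have h1 := ckBoundOn_taylorRemainder hA hD hδD hα hα1 hb k φa hφac (fun x _ y _ => by
      simp only [hφad]
      have := hφh (a + x) (a + y)
      rwa [add_sub_add_left_eq_sub] at this)
    exact h1.mul_smooth hwsmooth hMw0 hwb (by positivity) hD hδD hα hα1
  have htsw : ∀ t ∈ tsupport w, a + t - c ∈ Ioo 0 δ := fun t ht =>
    tsupport_window_subset_Ioo hδ (tsupport_comp_subset_preimage (window δ)
      (show Continuous fun t : ℝ => a + t - c by fun_prop) ht)
  have htsφ : ∀ t ∈ tsupport φa, a + t ∈ Ioo 0 L := fun t ht =>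
    hφs (tsupport_comp_subset_preimage φ (show Continuous fun t : ℝ => a + t by fun_prop) ht)
  -- At an end of the long segment all derivatives of `φ` vanish. Expanding there gives a zero
  -- Taylor polynomial, so the remainder estimate applies to `φ` itself and no polynomial term
  -- appears.
  have hbdry : ∀ b ∈ Icc 0 δ, (∀ i, iteratedDeriv i φ (a + b) = 0) →
      (∀ t, a + t - c ∈ Ioo 0 δ → a + t ∈ Ioo 0 L → t ∈ Ioo 0 δ) →
      ‖∫ t in (0 : ℝ)..δ, w t * φa t * g (γ (a + t))‖ ≤ K * B + (k + 1) * B' := by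
    intro b hb hz hsub
    have h1 : taylorRemainder k b φa = φa := by
      funext t
      simp [taylorRemainder, hφad, hz]
    have h2 := htay b hb
    rw [h1] at h2
    have hts : tsupport (fun t => w t * φa t) ⊆ Ioo 0 δ := fun t ht =>
      hsub t (htsw t (tsupport_mul_subset_left ht)) (htsφ t (tsupport_mul_subset_right ht))
    have h3 := (h2.univ_of_tsupport hts hK0 hδ.le hα).norm_integral_le hts hK0
      (fun φ' hφ' => hB _ hγa φ' hφ')
    have : 0 ≤ ((k : ℝ) + 1) * B' := by positivity
    linarith
  rcases hcases with ⟨h, h'⟩ | ⟨h, h', h''⟩ | ⟨h, h'⟩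
  · refine hbdry 0 ⟨le_rfl, hδ.le⟩ (fun i => ?_) (fun t h1 h2 => ?_)
    · refine iteratedDeriv_eq_zero_of_notMem_tsupport (fun h3 => ?_) i
      have := (hφs h3).1
      linarith
    · rw [h'] at h1 h2
      exact ⟨by linarith [h2.1], by linarith [h1.2]⟩
  -- Interior window: the Taylor polynomial at its left end is split off. Its coefficients are
  -- bounded by `1`, and the window times a monomial is a fixed test function, estimated by `B'`.
  · have hwe : w = window δ := by
      funext t; simp only [hw, h'']; congr 1; ring
    have hts : tsupport (fun t => w t * taylorRemainder k 0 φa t) ⊆ Ioo 0 δ := by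
      rw [hwe]
      exact tsupport_mul_subset_left.trans (tsupport_window_subset_Ioo hδ)
    have h3 := ((htay 0 ⟨le_rfl, hδ.le⟩).univ_of_tsupport hts hK0 hδ.le hα).norm_integral_le hts hK0
      (fun φ' hφ' => hB _ hγa φ' hφ')
    have hgc : ContinuousOn (fun t => g (γ (a + t))) (Icc 0 δ) :=
      hg.comp_continuousOn hγa.continuousOn
    have hint : ∀ f : ℝ → ℂ, Continuous f →
        IntervalIntegrable (fun t => f t * g (γ (a + t))) MeasureTheory.volume 0 δ := by
      intro f hf
      apply ContinuousOn.intervalIntegrable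
      rw [uIcc_of_le hδ.le]
      exact hf.continuousOn.mul hgc
    set q : ℕ → ℝ → ℂ := fun i t => window δ t * ((t ^ i / i.factorial : ℝ) : ℂ) with hq
    have hqc : ∀ i, Continuous (q i) := fun i =>
      (contDiff_window δ).continuous.mul (by simpa using (contDiff_taylorMonomial 0 i (n := 0)).continuous)
    have hsplit : (∫ t in (0 : ℝ)..δ, w t * φa t * g (γ (a + t))) =
        (∫ t in (0 : ℝ)..δ, w t * taylorRemainder k 0 φa t * g (γ (a + t))) +
        ∑ i ∈ Finset.range (k + 1), iteratedDeriv i φa 0 *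
          ∫ t in (0 : ℝ)..δ, q i t * g (γ (a + t)) := by
      simp_rw [← intervalIntegral.integral_const_mul]
      rw [← intervalIntegral.integral_finsetSum, ← intervalIntegral.integral_add]
      · congr 1
        funext t
        simp only [taylorRemainder, hwe, hq, sub_zero]
        rw [mul_sub, sub_mul, Finset.mul_sum, Finset.sum_mul]
        have : ∀ i, window δ t * (iteratedDeriv i φa 0 * ((t ^ i / i.factorial : ℝ) : ℂ)) *
          g (γ (a + t)) = iteratedDeriv i φa 0 * (window δ t * ((t ^ i / i.factorial : ℝ) : ℂ) *
          g (γ (a + t))) := fun i => by ring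
        simp only [this]
        ring
      · refine hint _ (hwsmooth.continuous.mul ?_)
        have : ContDiff ℝ ((k : ℕ∞) : WithTop ℕ∞) (taylorRemainder k 0 φa) :=
          contDiff_taylorRemainder 0 (by exact_mod_cast hφac)
        exact this.continuous
      · simpa only [Finset.sum_fn] using
          IntervalIntegrable.sum (Finset.range (k + 1)) fun i _ =>
            (hint _ (hqc i)).const_mul (iteratedDeriv i φa 0)
      · exact fun i _ => (hint _ (hqc i)).const_mul _
    change ‖∫ t in (0 : ℝ)..δ, w t * φa t * g (γ (a + t))‖ ≤ _
    rw [hsplit]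
    refine (norm_add_le _ _).trans (add_le_add h3 ((norm_sum_le _ _).trans ?_))
    calc ∑ i ∈ Finset.range (k + 1), ‖iteratedDeriv i φa 0 *
          ∫ t in (0 : ℝ)..δ, q i t * g (γ (a + t))‖ ≤ ∑ i ∈ Finset.range (k + 1), B' := by
          refine Finset.sum_le_sum fun i hi => ?_
          have hi' := Nat.lt_succ_iff.1 (Finset.mem_range.1 hi)
          rw [norm_mul, hφad]
          calc _ ≤ 1 * B' := mul_le_mul (hφ1 i hi' _) (hB' _ hγa i hi') (norm_nonneg _) zero_le_one
            _ = B' := one_mul _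
      _ = ((k : ℝ) + 1) * B' := by simp
  · refine hbdry δ ⟨hδ.le, le_rfl⟩ (fun i => ?_) (fun t h1 h2 => ?_)
    · refine iteratedDeriv_eq_zero_of_notMem_tsupport (fun h3 => ?_) i
      have := (hφs h3).2
      linarith
    · rw [h'] at h1 h2
      exact ⟨by linarith [h1.1], by linarith [h2.2]⟩

/-- Cutting a long horizontal segment into segments of length `δ`. -/
theorem norm_integral_le_of_split {kh : ℝ≥0} {L δ A B B' D Mw : ℝ} (hδ : 0 < δ) (hδL : δ ≤ L)
    {γ : ℝ → M} (hγ : S.IsHorizontalSegment L γ) {φ : ℝ → ℂ} (hA : 0 ≤ A) (hD : 1 ≤ D)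
    (hδD : δ ≤ D) (hMw0 : 0 ≤ Mw)
    (hMw : ∀ i ≤ ⌊kh⌋₊ + 1, ∀ x, ‖iteratedDeriv i (window δ) x‖ ≤ Mw)
    (hφ : ContDiff ℝ ⌊kh⌋₊ φ) (hφs : tsupport φ ⊆ Ioo 0 L)
    (hφ1 : ∀ i ≤ ⌊kh⌋₊, ∀ x, ‖iteratedDeriv i φ x‖ ≤ 1)
    (hφh : ∀ x y, ‖iteratedDeriv ⌊kh⌋₊ φ x - iteratedDeriv ⌊kh⌋₊ φ y‖ ≤
      A * |x - y| ^ ((kh : ℝ) - ⌊kh⌋₊)) {g : M → ℂ} (hg : Continuous g)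
    (hB : ∀ γ', S.IsHorizontalSegment δ γ' → ∀ φ', IsUnitTest kh δ φ' →
      ‖∫ t in (0 : ℝ)..δ, φ' t * g (γ' t)‖ ≤ B)
    (hB' : ∀ γ', S.IsHorizontalSegment δ γ' → ∀ i ≤ ⌊kh⌋₊,
      ‖∫ t in (0 : ℝ)..δ, window δ t * ((t ^ i / i.factorial : ℝ) : ℂ) * g (γ' t)‖ ≤ B') :
    ‖∫ t in (0 : ℝ)..L, φ t * g (γ t)‖ ≤ 4 * L / δ *
      (2 ^ (⌊kh⌋₊ + 1) * Mw * D * (A * D ^ (⌊kh⌋₊ + 1)) * B + (⌊kh⌋₊ + 1) * B') := by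
  set Z := 2 ^ (⌊kh⌋₊ + 1) * Mw * D * (A * D ^ (⌊kh⌋₊ + 1)) * B + (⌊kh⌋₊ + 1) * B'
  have hwin := fun c => norm_integral_window_le hδ hδL hγ hA hD hδD hMw0 hMw hφ hφs hφ1 hφh hg hB hB' c
  have hZ : 0 ≤ Z := (norm_nonneg _).trans (hwin 0)
  have hL : 0 ≤ L := hδ.le.trans hδL
  -- There are `n + 1` windows, and `n + 1 ≤ 2L/δ + 2 ≤ 4L/δ` because `δ ≤ L`.
  set n := ⌈2 * L / δ⌉₊ with hn
  have hnL : L ≤ n * (δ / 2) := by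
    have := Nat.le_ceil (2 * L / δ)
    rw [div_le_iff₀ hδ] at this
    linarith
  have hgc : ContinuousOn (fun t => g (γ t)) (Icc 0 L) := hg.comp_continuousOn hγ.continuousOn
  have hsum : (∫ t in (0 : ℝ)..L, φ t * g (γ t)) = ∑ j ∈ Finset.range (n + 1),
      ∫ t in (0 : ℝ)..L, window δ (t - ((j : ℝ) - 1) * (δ / 2)) * φ t * g (γ t) := by
    rw [← intervalIntegral.integral_finsetSum]
    · refine intervalIntegral.integral_congr fun t ht => ?_
      rw [uIcc_of_le hL] at ht
      rw [← Finset.sum_mul, ← Finset.sum_mul, sum_window_eq_one hδ ht.1 (ht.2.trans hnL), one_mul]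
    · intro j _
      apply ContinuousOn.intervalIntegrable
      rw [uIcc_of_le hL]
      refine ContinuousOn.mul (Continuous.continuousOn ?_) hgc
      exact ((contDiff_window δ).continuous.comp (by fun_prop)).mul hφ.continuous
  rw [hsum]
  calc _ ≤ ∑ j ∈ Finset.range (n + 1), Z := (norm_sum_le _ _).trans
        (Finset.sum_le_sum fun j _ => hwin _)
    _ = (n + 1) * Z := by simp
    _ ≤ 4 * L / δ * Z := by
      gcongr
      have h1 := Nat.ceil_lt_add_one (show 0 ≤ 2 * L / δ by positivity)
      have h2 : 1 ≤ L / δ := (one_le_div hδ).2 hδL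
      have h3 : 4 * L / δ = 2 * L / δ + 2 * (L / δ) := by ring
      rw [h3]
      linarith

end TranslationSurface

/-! ### Action of a pseudo-Anosov map on segments, derivatives and tests -/

namespace IsLinearPseudoAnosov

open TranslationSurface

variable {M : Type*} [TopologicalSpace M] {S : TranslationSurface M} {T T' : M ≃ₜ M}
  {lam lam' : ℝ}

theorem pos (hT : IsLinearPseudoAnosov S T lam) : 0 < lam := zero_lt_one.trans hT.one_lt

theorem isHorizontalSegment_image (hT : IsLinearPseudoAnosov S T lam) {β : ℝ} {γ : ℝ → M}
    (hγ : S.IsHorizontalSegment β γ) :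
    S.IsHorizontalSegment (lam * β) fun s => T (γ (lam⁻¹ * s)) := by
  have hmaps : MapsTo (fun s => lam⁻¹ * s) (Icc 0 (lam * β)) (Icc 0 β) := fun s hs => by
    have h := hT.pos
    refine ⟨mul_nonneg (inv_nonneg.2 h.le) hs.1, ?_⟩
    rw [inv_mul_le_iff₀ h]
    exact hs.2
  refine ⟨T.continuous.comp_continuousOn (hγ.continuousOn.comp (by fun_prop) hmaps),
    fun t ht h => hγ.notMem_sing _ (hmaps ht) (hT.map_mem_sing.1 h), fun t ht e' he' hte => ?_⟩
  obtain ⟨e, he, hxe⟩ := S.cover _ (hγ.notMem_sing _ (hmaps ht))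
  have hc : Tendsto (fun s => lam⁻¹ * s) (𝓝[Icc 0 (lam * β)] t) (𝓝[Icc 0 β] (lam⁻¹ * t)) :=
    (show Continuous fun s : ℝ => lam⁻¹ * s by fun_prop).continuousWithinAt.tendsto_nhdsWithin hmaps
  have hγc := (hγ.continuousOn _ (hmaps ht)).tendsto.comp hc
  filter_upwards [hc.eventually (hγ.horizontal _ (hmaps ht) e he hxe),
    hγc.eventually (hT.linear e he e' he' _ hxe hte)] with s h1 h2
  simp only [Function.comp] at h2
  rw [h2, h1]
  have hl := hT.pos.ne'
  simp only [Complex.ofReal_re, Complex.ofReal_im]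
  rw [← mul_sub, mul_inv_cancel_left₀ hl]
  simp

/-- The chain rule in charts, where `T` contracts the direction `i` by `λ⁻¹`. Iterated, this is the
source of the gain `λ^(-k_v)`. -/
theorem vertDeriv_comp (hT : IsLinearPseudoAnosov S T lam) (f : M → ℂ) (x : M) :
    S.vertDeriv (f ∘ T) x = ((lam⁻¹ : ℝ) : ℂ) * S.vertDeriv f (T x) := by
  by_cases hx : x ∈ S.sing
  · rw [vertDeriv_of_sing _ hx, vertDeriv_of_sing _ (hT.map_mem_sing.2 hx), mul_zero]
  obtain ⟨e, he, hxe⟩ := S.cover x hx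
  obtain ⟨e', he', hxe'⟩ := S.cover (T x) (fun h => hx (hT.map_mem_sing.1 h))
  rw [vertDeriv_eq _ he hxe, vertDeriv_eq _ he' hxe']
  have hc : Tendsto e.symm (𝓝 (e x)) (𝓝 x) := by
    have := (e.continuousAt_symm (e.map_source hxe)).tendsto
    rwa [e.left_inv hxe] at this
  have ht : Tendsto (fun t : ℝ => e x + t • Complex.I) (𝓝 0) (𝓝 (e x)) := by
    have : Continuous (fun t : ℝ => e x + t • Complex.I) := by fun_prop
    simpa using this.tendsto 0
  have key : (fun t : ℝ => ((f ∘ T) ∘ e.symm) (e x + t • Complex.I)) =ᶠ[𝓝 0]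
      fun t : ℝ => (fun u : ℝ => (f ∘ e'.symm) (e' (T x) + u • Complex.I)) (lam⁻¹ * t) := by
    filter_upwards [ht.eventually (hc.eventually (hT.linear e he e' he' x hxe hxe')),
      ht.eventually (hc.eventually ((T.continuous.tendsto x).eventually
        (e'.open_source.mem_nhds hxe'))),
      ht.eventually (e.open_target.mem_nhds (e.map_source hxe))] with t h1 h2 h3
    rw [e.right_inv h3] at h1
    have h4 : e' (T x) + (lam⁻¹ * t) • Complex.I = e' (T (e.symm (e x + t • Complex.I))) := by
      rw [sub_eq_iff_eq_add'.1 h1]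
      simp
    simp only [Function.comp, h4, e'.left_inv h2]
  unfold lineDeriv
  rw [key.deriv_eq]
  refine (deriv_comp_mul_left lam⁻¹
    (fun u : ℝ => (f ∘ e'.symm) (e' (T x) + u • Complex.I)) 0).trans ?_
  simp

theorem Lv_comp (hT : IsLinearPseudoAnosov S T lam) (f : S.smoothFun) :
    S.Lv (hT.comp f) = ((lam⁻¹ : ℝ) : ℂ) • hT.comp (S.Lv f) := by
  ext x
  exact hT.vertDeriv_comp f x

theorem Lv_pow_comp (hT : IsLinearPseudoAnosov S T lam) (j : ℕ) (f : S.smoothFun) :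
    (S.Lv ^ j) (hT.comp f) = (((lam⁻¹) ^ j : ℝ) : ℂ) • hT.comp ((S.Lv ^ j) f) := by
  induction j with
  | zero => simp
  | succ j ih =>
    rw [pow_succ', Module.End.mul_apply, ih, map_smul, hT.Lv_comp, smul_smul, pow_succ,
      Complex.ofReal_mul]
    rfl

theorem trans (hT : IsLinearPseudoAnosov S T lam) (hT' : IsLinearPseudoAnosov S T' lam') :
    IsLinearPseudoAnosov S (T.trans T') (lam * lam') := by
  refine ⟨one_lt_mul_of_lt_of_le hT.one_lt hT'.one_lt.le, ?_, fun e he e'' he'' x hx hx'' => ?_⟩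
  · change (T' ∘ T) '' S.sing = S.sing
    rw [image_comp, hT.image_sing, hT'.image_sing]
  · have hxs : T x ∉ S.sing := fun h => S.source_subset e he hx (hT.map_mem_sing.1 h)
    obtain ⟨e', he', hx'⟩ := S.cover _ hxs
    filter_upwards [hT.linear e he e' he' x hx hx', (T.continuous.tendsto x).eventually
      (hT'.linear e' he' e'' he'' (T x) hx' hx'')] with y h1 h2
    simp only [Homeomorph.trans_apply]
    rw [h2, h1]
    simp only [Complex.add_re, Complex.add_im, Complex.mul_re, Complex.mul_im, Complex.ofReal_re,
      Complex.ofReal_im, Complex.I_re, Complex.I_im, mul_zero, mul_one, sub_zero, add_zero,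
      zero_add]
    push_cast
    rw [mul_inv]
    ring

/-- Only positive powers occur: the expansion factor must exceed `1`, which excludes the factor
`λ^0`. -/
theorem exists_iterate (hT : IsLinearPseudoAnosov S T lam) (n : ℕ) :
    ∃ T' : M ≃ₜ M, ∃ hT' : IsLinearPseudoAnosov S T' (lam ^ (n + 1)),
      ∀ f, hT'.comp f = (hT.comp)^[n + 1] f := by
  induction n with
  | zero =>
    exact ⟨T, by simpa using hT, fun f => rfl⟩
  | succ n ih =>
    obtain ⟨T', hT', h⟩ := ih
    refine ⟨T.trans T', ?_, fun f => ?_⟩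
    · have := hT.trans hT'
      rwa [← pow_succ'] at this
    · rw [Function.iterate_succ_apply', ← h]
      rfl

/-- The exponent `j + 1` collects `j` vertical derivatives and one Jacobian. -/
theorem integral_comp (hT : IsLinearPseudoAnosov S T lam) (β : ℝ) (φ : ℝ → ℂ) (γ : ℝ → M) (j : ℕ)
    (f : S.smoothFun) :
    ∫ t in (0 : ℝ)..β, φ t * ((S.Lv ^ j) (hT.comp f) : M → ℂ) (γ t) =
      (((lam⁻¹) ^ (j + 1) : ℝ) : ℂ) * ∫ s in (0 : ℝ)..lam * β,
        φ (lam⁻¹ * s) * ((S.Lv ^ j) f : M → ℂ) (T (γ (lam⁻¹ * s))) := by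
  have hl := hT.pos.ne'
  have h := intervalIntegral.integral_comp_mul_left (a := 0) (b := β)
    (fun s => φ (lam⁻¹ * s) * ((S.Lv ^ j) f : M → ℂ) (T (γ (lam⁻¹ * s)))) hl
  simp only [inv_mul_cancel_left₀ hl, mul_zero] at h
  rw [pow_succ, Complex.ofReal_mul, mul_assoc, ← Complex.real_smul (x := lam⁻¹), ← h,
    ← intervalIntegral.integral_const_mul]
  congr 1
  funext t
  rw [hT.Lv_pow_comp]
  change φ t * ((((lam⁻¹) ^ j : ℝ) : ℂ) * ((S.Lv ^ j) f : M → ℂ) (T (γ t))) = _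
  ring

end IsLinearPseudoAnosov

theorem iteratedDeriv_comp_inv_mul {lam : ℝ} {φ : ℝ → ℂ} {k : ℕ} (h : ContDiff ℝ k φ) {i : ℕ}
    (hi : i ≤ k) (x : ℝ) : iteratedDeriv i (fun s => φ (lam⁻¹ * s)) x =
      (((lam⁻¹) ^ i : ℝ) : ℂ) * iteratedDeriv i φ (lam⁻¹ * x) := by
  rw [iteratedDeriv_comp_const_smul (h.of_le (by exact_mod_cast hi))]
  simp

/-- Dilation of a unit test. -/
theorem IsUnitTest.dilate {kh : ℝ≥0} {β lam : ℝ} {φ : ℝ → ℂ} (h : IsUnitTest kh β φ)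
    (hlam : 1 < lam) :
    ContDiff ℝ ⌊kh⌋₊ (fun s => φ (lam⁻¹ * s)) ∧
    tsupport (fun s => φ (lam⁻¹ * s)) ⊆ Ioo 0 (lam * β) ∧
    (∀ i ≤ ⌊kh⌋₊, ∀ x, ‖iteratedDeriv i (fun s => φ (lam⁻¹ * s)) x‖ ≤ 1) ∧
    ∀ x y, ‖iteratedDeriv ⌊kh⌋₊ (fun s => φ (lam⁻¹ * s)) x -
      iteratedDeriv ⌊kh⌋₊ (fun s => φ (lam⁻¹ * s)) y‖ ≤
        2 * lam ^ (-(kh : ℝ)) * |x - y| ^ ((kh : ℝ) - ⌊kh⌋₊) := by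
  have hl : 0 < lam := zero_lt_one.trans hlam
  have hl' : 0 ≤ lam⁻¹ := inv_nonneg.2 hl.le
  obtain ⟨h1, h2⟩ := h.ckBoundOn
  have hp : ∀ i : ℕ, ‖(((lam⁻¹) ^ i : ℝ) : ℂ)‖ = (lam⁻¹) ^ i := fun i => by
    rw [Complex.norm_real, Real.norm_of_nonneg (by positivity)]
  refine ⟨h.contDiff.comp (contDiff_const.mul contDiff_id), ?_, fun i hi x => ?_, fun x y => ?_⟩
  · intro s hs
    have h3 : lam⁻¹ * s ∈ tsupport φ :=
      tsupport_comp_subset_preimage φ (f := fun s => lam⁻¹ * s) (by fun_prop) hs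
    have h4 := h.tsupport_subset h3
    refine ⟨?_, ?_⟩
    · by_contra h5
      have := mul_nonpos_of_nonneg_of_nonpos hl' (not_lt.1 h5)
      linarith [h4.1]
    · have := h4.2
      rwa [inv_mul_lt_iff₀ hl] at this
  · rw [iteratedDeriv_comp_inv_mul h.contDiff hi, norm_mul, hp]
    exact mul_le_one₀ (pow_le_one₀ hl' (inv_le_one_of_one_le₀ hlam.le)) (norm_nonneg _) (h2 i hi _)
  · rw [iteratedDeriv_comp_inv_mul h.contDiff le_rfl, iteratedDeriv_comp_inv_mul h.contDiff le_rfl,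
      ← mul_sub, norm_mul, hp]
    refine (mul_le_mul_of_nonneg_left (h1.holder _ trivial _ trivial) (by positivity)).trans
      (le_of_eq ?_)
    rw [← mul_sub, abs_mul, abs_of_nonneg hl', Real.mul_rpow hl' (abs_nonneg _)]
    have : lam ^ (-(kh : ℝ)) = lam⁻¹ ^ ⌊kh⌋₊ * lam⁻¹ ^ ((kh : ℝ) - ⌊kh⌋₊) := by
      rw [← Real.rpow_natCast, ← Real.rpow_add (by positivity), Real.inv_rpow hl.le,
        Real.rpow_neg hl.le]
      congr 2
      ring
    rw [this]
    ring

/-! ### The Lasota–Yorke inequality -/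

namespace TranslationSurface

variable {M : Type*} [TopologicalSpace M] [CompactSpace M] {S : TranslationSurface M}

theorem norm_integral_le_anisoNorm {δ : ℝ} {kh : ℝ≥0} {kv j : ℕ} (hj : j ≤ kv) (f : S.smoothFun)
    {γ : ℝ → M} (hγ : S.IsHorizontalSegment δ γ) {φ : ℝ → ℂ} (hφ : IsUnitTest kh δ φ) :
    ‖∫ t in (0 : ℝ)..δ, φ t * ((S.Lv ^ j) f : M → ℂ) (γ t)‖ ≤ S.anisoNorm δ kh kv f :=
  le_csSup (bddAbove_testValues δ kh kv f) ⟨j, hj, γ, hγ, φ, hφ, rfl⟩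

theorem norm_integral_le_of_ckBoundOn {δ A : ℝ} {kh : ℝ≥0} {kv j : ℕ} (hj : j ≤ kv)
    (f : S.smoothFun) {γ : ℝ → M} (hγ : S.IsHorizontalSegment δ γ) {φ : ℝ → ℂ}
    (hφ : CkBoundOn ⌊kh⌋₊ (kh - ⌊kh⌋₊) univ A φ) (hs : tsupport φ ⊆ Ioo 0 δ) (hA : 0 ≤ A) :
    ‖∫ t in (0 : ℝ)..δ, φ t * ((S.Lv ^ j) f : M → ℂ) (γ t)‖ ≤ A * S.anisoNorm δ kh kv f :=
  hφ.norm_integral_le hs hA fun _ hφ' => norm_integral_le_anisoNorm hj f hγ hφ'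

/-- A smooth function supported inside `(0, δ)` is a multiple of a unit test. -/
theorem exists_ckBoundOn_of_smooth {ψ : ℝ → ℂ} {δ : ℝ} (hψ : ContDiff ℝ ∞ ψ)
    (hs : tsupport ψ ⊆ Ioo 0 δ) (kh : ℝ≥0) :
    ∃ A : ℝ, 0 ≤ A ∧ CkBoundOn ⌊kh⌋₊ (kh - ⌊kh⌋₊) univ A ψ := by
  have hc : HasCompactSupport ψ :=
    isCompact_Icc.of_isClosed_subset (isClosed_tsupport _) (hs.trans Ioo_subset_Icc_self)
  obtain ⟨A, hA, h⟩ := exists_bound_iteratedDeriv hψ hc (⌊kh⌋₊ + 1)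
  exact ⟨2 * A, by positivity, CkBoundOn.of_bound_succ (hψ.of_le (by exact_mod_cast le_top)) h
    (ckExponent_nonneg kh) (ckExponent_le_one kh)⟩

/-- The test functions that remain after subtracting Taylor polynomials. -/
def taylorWindow (δ : ℝ) (i : ℕ) (t : ℝ) : ℂ := window δ t * ((t ^ i / i.factorial : ℝ) : ℂ)

theorem contDiff_taylorWindow (δ : ℝ) (i : ℕ) : ContDiff ℝ ∞ (taylorWindow δ i) :=
  (contDiff_window δ).mul (by simpa using contDiff_taylorMonomial 0 i)

theorem tsupport_taylorWindow {δ : ℝ} (hδ : 0 < δ) (i : ℕ) :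
    tsupport (taylorWindow δ i) ⊆ Ioo 0 δ :=
  tsupport_mul_subset_left.trans (tsupport_window_subset_Ioo hδ)

/-- Lasota–Yorke inequality, uniform over all linear pseudo-Anosov maps. -/
theorem exists_lasotaYorke {δ β : ℝ} (hδ : 0 < δ) (hδβ : δ ≤ β) (kh : ℝ≥0) (kv : ℕ) :
    ∃ C : ℝ, 0 ≤ C ∧ ∀ (T : M ≃ₜ M) (lam : ℝ) (hT : IsLinearPseudoAnosov S T lam)
      (f : S.smoothFun) (B : ℝ), 0 ≤ B →
      (∀ j < kv, ∀ γ, S.IsHorizontalSegment δ γ → ∀ i ≤ ⌊kh⌋₊,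
        ‖∫ t in (0 : ℝ)..δ, taylorWindow δ i t * ((S.Lv ^ j) f : M → ℂ) (γ t)‖ ≤ B) →
      S.anisoNorm β kh kv (hT.comp f) ≤
        C * (lam ^ (-(min (kh : ℝ) (kv : ℝ))) * S.anisoNorm δ kh kv f + B) := by
  have hψ := fun i => exists_ckBoundOn_of_smooth (contDiff_taylorWindow δ i)
    (tsupport_taylorWindow hδ i) kh
  choose A hA hAψ using hψ
  obtain ⟨Mw, hMw0, hMw⟩ := exists_bound_iteratedDeriv (contDiff_window δ)
    (hasCompactSupport_window hδ) (⌊kh⌋₊ + 1)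
  set D := max 1 δ
  have hD : 1 ≤ D := le_max_left _ _
  have hβ : 0 < β := hδ.trans_le hδβ
  set k := ⌊kh⌋₊
  set A' := ∑ i ∈ Finset.range (k + 1), A i with hA'
  have hA'0 : 0 ≤ A' := Finset.sum_nonneg fun i _ => hA i
  set P := 2 ^ (k + 1) * Mw * D * (2 * D ^ (k + 1)) with hP
  have hP0 : 0 ≤ P := by positivity
  -- The three summands absorb the Taylor remainders, the Taylor polynomials for `j = kv`, and those
  -- for `j < kv`.
  set C := 4 * β / δ * (P + (k + 1) * A' + (k + 1)) with hC
  refine ⟨C, by positivity, fun T lam hT f B hB0 hB => ?_⟩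
  have hl := hT.pos
  set N := S.anisoNorm δ kh kv f with hN
  have hN0 : 0 ≤ N := anisoNorm_nonneg _ _ _ _
  set r := lam ^ (-(min (kh : ℝ) (kv : ℝ))) with hr
  have hr0 : 0 < r := by positivity
  have hr1 : lam ^ (-(kh : ℝ)) ≤ r :=
    Real.rpow_le_rpow_of_exponent_le hT.one_lt.le (neg_le_neg (min_le_left _ _))
  have hr2 : lam⁻¹ ^ kv ≤ r := by
    rw [← Real.rpow_natCast, Real.inv_rpow hl.le, ← Real.rpow_neg hl.le]
    exact Real.rpow_le_rpow_of_exponent_le hT.one_lt.le (neg_le_neg (min_le_right _ _))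
  refine Real.sSup_le ?_ (by positivity)
  rintro _ ⟨j, hj, γ, hγ, φ, hφ, rfl⟩
  obtain ⟨h1, h2, h3, h4⟩ := hφ.dilate hT.one_lt
  -- The factor `lam` in the number of windows cancels the Jacobian, leaving `lam⁻¹ ^ j` and a
  -- constant independent of the map.
  have hsplit : ∀ B', (∀ γ', S.IsHorizontalSegment δ γ' → ∀ i ≤ k,
      ‖∫ t in (0 : ℝ)..δ, taylorWindow δ i t * ((S.Lv ^ j) f : M → ℂ) (γ' t)‖ ≤ B') →
      ‖∫ t in (0 : ℝ)..β, φ t * ((S.Lv ^ j) (hT.comp f) : M → ℂ) (γ t)‖ ≤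
        lam⁻¹ ^ j * (4 * β / δ * (P * lam ^ (-(kh : ℝ)) * N + (k + 1) * B')) := by
    intro B' hB'
    have h5 := norm_integral_le_of_split hδ (hδβ.trans
      (le_mul_of_one_le_left hβ.le hT.one_lt.le)) (hT.isHorizontalSegment_image hγ)
      (A := 2 * lam ^ (-(kh : ℝ))) (by positivity) hD (le_max_right 1 δ) hMw0 hMw h1 h2 h3 h4
      (continuous_of_mem ((S.Lv ^ j) f).2)
      (fun γ' hγ' φ' hφ' => norm_integral_le_anisoNorm hj f hγ' hφ') hB'
    rw [hT.integral_comp, norm_mul, Complex.norm_real, Real.norm_of_nonneg (by positivity)]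
    refine (mul_le_mul_of_nonneg_left h5 (by positivity)).trans (le_of_eq ?_)
    rw [pow_succ, hP, ← hN]
    change lam⁻¹ ^ j * lam⁻¹ * (4 * (lam * β) / δ * (2 ^ (k + 1) * Mw * D *
      (2 * lam ^ (-(kh : ℝ)) * D ^ (k + 1)) * N + (k + 1) * B')) = _
    field_simp
  have hlj : lam⁻¹ ^ j ≤ 1 := pow_le_one₀ (by positivity) (inv_le_one_of_one_le₀ hT.one_lt.le)
  -- Below top order the polynomials are estimated by the weak bound `B`. At top order the trivial
  -- bound by the norm is enough, since the factor `lam⁻¹ ^ kv` is available.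
  rcases hj.lt_or_eq with hj' | rfl
  · refine (hsplit B fun γ' hγ' i hi => hB j hj' γ' hγ' i hi).trans ?_
    calc lam⁻¹ ^ j * (4 * β / δ * (P * lam ^ (-(kh : ℝ)) * N + (k + 1) * B))
        ≤ 1 * (4 * β / δ * (P * r * N + (k + 1) * B)) := by gcongr
      _ ≤ C * (r * N + B) := by
        rw [hC, one_mul, mul_assoc (4 * β / δ)]
        refine mul_le_mul_of_nonneg_left ?_ (show 0 ≤ 4 * β / δ by positivity)
        have e1 : 0 ≤ (k + 1) * A' * (r * N) := by positivity
        have e2 : 0 ≤ (k + 1) * (r * N) := by positivity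
        have e3 : 0 ≤ P * B := by positivity
        have e4 : 0 ≤ (k + 1) * A' * B := by positivity
        nlinarith
  · have hB' : ∀ γ', S.IsHorizontalSegment δ γ' → ∀ i ≤ k,
        ‖∫ t in (0 : ℝ)..δ, taylorWindow δ i t * ((S.Lv ^ j) f : M → ℂ) (γ' t)‖ ≤ A' * N := by
      intro γ' hγ' i hi
      refine (norm_integral_le_of_ckBoundOn hj f hγ' (hAψ i) (tsupport_taylorWindow hδ i)
        (hA i)).trans (mul_le_mul_of_nonneg_right ?_ hN0)
      exact Finset.single_le_sum (fun i _ => hA i) (Finset.mem_range.2 (Nat.lt_succ_of_le hi))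
    refine (hsplit _ hB').trans ?_
    have hlk : lam ^ (-(kh : ℝ)) ≤ 1 :=
      Real.rpow_le_one_of_one_le_of_nonpos hT.one_lt.le (neg_nonpos.2 kh.2)
    have e0 : lam⁻¹ ^ j * lam ^ (-(kh : ℝ)) ≤ r :=
      (mul_le_of_le_one_left (by positivity) hlj).trans hr1
    calc lam⁻¹ ^ j * (4 * β / δ * (P * lam ^ (-(kh : ℝ)) * N + (k + 1) * (A' * N)))
        = 4 * β / δ * (P * N * (lam⁻¹ ^ j * lam ^ (-(kh : ℝ))) +
            (k + 1) * (A' * N) * lam⁻¹ ^ j) := by ring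
      _ ≤ 4 * β / δ * (P * N * r + (k + 1) * (A' * N) * r) := by gcongr
      _ ≤ C * (r * N + B) := by
        rw [hC, mul_assoc (4 * β / δ)]
        refine mul_le_mul_of_nonneg_left ?_ (show 0 ≤ 4 * β / δ by positivity)
        have e2 : 0 ≤ (k + 1) * (r * N) := by positivity
        have e3 : 0 ≤ (P + (k + 1) * A' + (k + 1)) * B := by positivity
        nlinarith

/-- Composition with linear pseudo-Anosov maps is uniformly bounded. -/
theorem exists_anisoNorm_comp_le {δ β : ℝ} (hδ : 0 < δ) (hδβ : δ ≤ β) (kh : ℝ≥0) (kv : ℕ) :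
    ∃ C : ℝ, 0 ≤ C ∧ ∀ (T : M ≃ₜ M) (lam : ℝ) (hT : IsLinearPseudoAnosov S T lam)
      (f : S.smoothFun), S.anisoNorm β kh kv (hT.comp f) ≤ C * S.anisoNorm δ kh kv f := by
  obtain ⟨C, hC, h⟩ := exists_lasotaYorke (S := S) hδ hδβ kh kv
  have hψ := fun i => exists_ckBoundOn_of_smooth (contDiff_taylorWindow δ i)
    (tsupport_taylorWindow hδ i) kh
  choose A hA hAψ using hψ
  set A' := ∑ i ∈ Finset.range (⌊kh⌋₊ + 1), A i with hA'
  have hA'0 : 0 ≤ A' := Finset.sum_nonneg fun i _ => hA i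
  refine ⟨C * (1 + A'), by positivity, fun T lam hT f => ?_⟩
  have hN0 : 0 ≤ S.anisoNorm δ kh kv f := anisoNorm_nonneg _ _ _ _
  refine (h T lam hT f (A' * S.anisoNorm δ kh kv f) (by positivity)
    fun j hj γ hγ i hi => ?_).trans ?_
  · refine (norm_integral_le_of_ckBoundOn hj.le f hγ (hAψ i) (tsupport_taylorWindow hδ i)
      (hA i)).trans (mul_le_mul_of_nonneg_right ?_ hN0)
    exact Finset.single_le_sum (fun i _ => hA i) (Finset.mem_range.2 (Nat.lt_succ_of_le hi))
  · have hr : lam ^ (-(min (kh : ℝ) (kv : ℝ))) ≤ 1 :=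
      Real.rpow_le_one_of_one_le_of_nonpos hT.one_lt.le
        (neg_nonpos.2 (le_min kh.2 (Nat.cast_nonneg _)))
    rw [mul_assoc, add_mul]
    gcongr

/-- The image of a segment of length `δ` has length exactly `β`, so nothing is cut; the dilated test
is twice a unit test at most, and the prefactor `lam^(-(j+1))` is at most `1`. -/
theorem anisoNorm_comp_le_two_mul {δ β : ℝ} (kh : ℝ≥0) (kv : ℕ) {T : M ≃ₜ M} {lam : ℝ}
    (hT : IsLinearPseudoAnosov S T lam) (hlam : lam * δ = β) (f : S.smoothFun) :
    S.anisoNorm δ kh kv (hT.comp f) ≤ 2 * S.anisoNorm β kh kv f := by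
  have hN0 : 0 ≤ S.anisoNorm β kh kv f := anisoNorm_nonneg _ _ _ _
  have hl := hT.pos
  refine Real.sSup_le ?_ (by positivity)
  rintro _ ⟨j, hj, γ, hγ, φ, hφ, rfl⟩
  obtain ⟨h1, h2, h3, h4⟩ := hφ.dilate hT.one_lt
  have hγ' := hT.isHorizontalSegment_image hγ
  rw [hT.integral_comp, norm_mul, Complex.norm_real, Real.norm_of_nonneg (by positivity)]
  rw [hlam] at h2 hγ' ⊢
  have hlk : lam ^ (-(kh : ℝ)) ≤ 1 :=
    Real.rpow_le_one_of_one_le_of_nonpos hT.one_lt.le (neg_nonpos.2 kh.2)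
  have h5 := norm_integral_le_of_ckBoundOn hj f hγ' (A := 2) ⟨h1, fun i hi x _ =>
    (h3 i hi x).trans one_le_two, fun x _ y _ => (h4 x y).trans (by
      refine mul_le_mul_of_nonneg_right ?_ (by positivity)
      linarith)⟩ h2 zero_le_two
  exact (mul_le_of_le_one_left (norm_nonneg _) (pow_le_one₀ (by positivity)
    (inv_le_one_of_one_le₀ hT.one_lt.le))).trans h5

end TranslationSurface

/-! ### Developed flat domains and vertical displacement of segments -/

namespace TranslationSurface

variable {M : Type*} [TopologicalSpace M] {S : TranslationSurface M}

variable (S) in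
/-- A local developing inverse: a map from an open subset of the plane to `M - Σ` which is a local
isomorphism of translation structures. -/
structure IsFlatOn (E : ℂ → M) (D : Set ℂ) : Prop where
  isOpen : IsOpen D
  continuousOn : ContinuousOn E D
  notMem_sing : ∀ w ∈ D, E w ∉ S.sing
  flat : ∀ w ∈ D, ∀ e ∈ S.atlas, E w ∈ e.source → ∀ᶠ w' in 𝓝 w, e (E w') - e (E w) = w' - w

namespace IsFlatOn

variable {E : ℂ → M} {D : Set ℂ}

theorem continuousAt (h : S.IsFlatOn E D) {w : ℂ} (hw : w ∈ D) : ContinuousAt E w :=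
  h.continuousOn.continuousAt (h.isOpen.mem_nhds hw)

theorem isHorizontalSegment (h : S.IsFlatOn E D) {w : ℂ} {δ : ℝ}
    (hw : ∀ t ∈ Icc (0 : ℝ) δ, w + t ∈ D) : S.IsHorizontalSegment δ fun t => E (w + t) := by
  have hc : Continuous fun t : ℝ => w + (t : ℂ) := by fun_prop
  refine ⟨h.continuousOn.comp hc.continuousOn hw, fun t ht => h.notMem_sing _ (hw t ht),
    fun t ht e he hte => ?_⟩
  filter_upwards [mem_nhdsWithin_of_mem_nhds ((hc.tendsto t).eventually
    (h.flat _ (hw t ht) e he hte))] with s hs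
  rw [hs]
  push_cast
  ring

/-- A horizontal segment is determined by its starting point, as long as it can be continued in
a flat domain. -/
theorem eq_of_isHorizontalSegment [T2Space M] (h : S.IsFlatOn E D) {w : ℂ} {δ : ℝ}
    (hw : ∀ t ∈ Icc (0 : ℝ) δ, w + t ∈ D) {γ : ℝ → M} (hγ : S.IsHorizontalSegment δ γ)
    (h0 : γ 0 = E w) : ∀ t ∈ Icc (0 : ℝ) δ, γ t = E (w + t) := by
  have hE := h.isHorizontalSegment hw
  -- Continuation: the coincidence set is closed as `M` is Hausdorff, and it extends to the right
  -- because both curves have the same coordinates in a chart.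
  have hclosed : IsClosed ({t | γ t = E (w + t)} ∩ Icc (0 : ℝ) δ) := by
    have := (hγ.continuousOn.prodMk hE.continuousOn).preimage_isClosed_of_isClosed isClosed_Icc
      (isClosed_diagonal (X := M))
    rw [inter_comm]
    exact this
  refine hclosed.Icc_subset_of_forall_mem_nhdsWithin (by simpa using h0) ?_
  rintro t ⟨ht, ht1⟩
  have htI : t ∈ Icc (0 : ℝ) δ := Ico_subset_Icc_self ht1
  obtain ⟨e, he, hte⟩ := S.cover _ (hγ.notMem_sing t htI)
  have hte' : E (w + t) ∈ e.source := by rw [← show γ t = E (w + t) from ht]; exact hte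
  have hle : 𝓝[>] t ≤ 𝓝[Icc 0 δ] t := by
    rw [nhdsWithin_le_iff]
    filter_upwards [Ioo_mem_nhdsGT ht1.2] with s hs
    exact ⟨ht1.1.trans hs.1.le, hs.2.le⟩
  have c1 := (hγ.continuousOn t htI).mono_left hle
  have c2 := (hE.continuousOn t htI).mono_left hle
  filter_upwards [hle (hγ.horizontal t htI e he hte), hle (hE.horizontal t htI e he hte'),
    c1.eventually (e.open_source.mem_nhds hte), c2.eventually (e.open_source.mem_nhds hte')]
    with s h1 h2 h3 h4
  refine e.injOn h3 h4 ?_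
  have h5 : e (γ t) = e (E (w + t)) := congrArg e ht
  rw [← h2, h5] at h1
  simpa using h1

theorem hasDerivAt_vert (h : S.IsFlatOn E D) (f : S.smoothFun) {p : ℂ} {u : ℝ}
    (hu : p + u * Complex.I ∈ D) :
    HasDerivAt (fun u : ℝ => (f : M → ℂ) (E (p + u * Complex.I)))
      ((S.Lv f : M → ℂ) (E (p + u * Complex.I))) u := by
  set w := p + u * Complex.I with hw
  obtain ⟨e, he, hwe⟩ := S.cover _ (h.notMem_sing w hu)
  have hd := differentiableAt_of_mem f.2 he (e.map_source hwe)
  change HasDerivAt _ (S.vertDeriv f (E w)) u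
  rw [vertDeriv_eq _ he hwe]
  have h1 : HasDerivAt (fun t : ℝ => ((f : M → ℂ) ∘ e.symm) (e (E w) + t • Complex.I))
      (lineDeriv ℝ ((f : M → ℂ) ∘ e.symm) (e (E w)) Complex.I) (u - u) := by
    rw [sub_self]
    exact hd.lineDifferentiableAt.hasLineDerivAt
  have h2 := h1.comp_sub_const u u
  refine h2.congr_of_eventuallyEq ?_
  have hc : Tendsto (fun v : ℝ => p + v * Complex.I) (𝓝 u) (𝓝 w) := by
    have : Continuous fun v : ℝ => p + v * Complex.I := by fun_prop
    exact this.tendsto u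
  filter_upwards [hc.eventually (h.flat w hu e he hwe),
    hc.eventually ((h.continuousAt hu).eventually (e.open_source.mem_nhds hwe))] with v h3 h4
  have h5 : e (E w) + (v - u) • Complex.I = e (E (p + v * Complex.I)) := by
    rw [sub_eq_iff_eq_add'.1 h3, hw]
    simp only [Complex.real_smul]
    push_cast
    ring
  simp only [Function.comp, h5, e.left_inv h4]

/-- Moving a horizontal segment vertically. -/
theorem norm_integral_sub_le_vert (h : S.IsFlatOn E D) (f : S.smoothFun) {p : ℂ} {δ y₁ y₂ K : ℝ}
    (hδ : 0 ≤ δ)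
    (hD : ∀ t ∈ Icc (0 : ℝ) δ, ∀ y ∈ uIcc y₁ y₂, p + t + y * Complex.I ∈ D) {ψ : ℝ → ℂ}
    (hψ : Continuous ψ) (hK : ∀ y ∈ uIcc y₁ y₂,
      ‖∫ t in (0 : ℝ)..δ, ψ t * (S.Lv f : M → ℂ) (E (p + y * Complex.I + t))‖ ≤ K) :
    ‖(∫ t in (0 : ℝ)..δ, ψ t * (f : M → ℂ) (E (p + y₂ * Complex.I + t))) -
      ∫ t in (0 : ℝ)..δ, ψ t * (f : M → ℂ) (E (p + y₁ * Complex.I + t))‖ ≤ K * |y₂ - y₁| := by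
  have hsw : ∀ (y t : ℝ), p + y * Complex.I + t = p + t + y * Complex.I := fun y t => by ring
  simp only [hsw] at hK ⊢
  have hLc : Continuous (S.Lv f : M → ℂ) := continuous_of_mem (S.Lv f).2
  have hfc : Continuous (f : M → ℂ) := continuous_of_mem f.2
  have hc2 : ContinuousOn (fun q : ℝ × ℝ => ψ q.1 * (S.Lv f : M → ℂ) (E (p + q.1 + q.2 * Complex.I)))
      (Icc 0 δ ×ˢ uIcc y₁ y₂) := by
    refine (hψ.comp continuous_fst).continuousOn.mul (hLc.comp_continuousOn ?_)
    refine h.continuousOn.comp (Continuous.continuousOn (by fun_prop)) ?_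
    rintro ⟨t, y⟩ ⟨ht, hy⟩
    exact hD t ht y hy
  have hi : ∀ y ∈ uIcc y₁ y₂, IntervalIntegrable
      (fun t : ℝ => ψ t * (f : M → ℂ) (E (p + t + y * Complex.I))) MeasureTheory.volume 0 δ := by
    intro y hy
    apply ContinuousOn.intervalIntegrable
    rw [uIcc_of_le hδ]
    refine hψ.continuousOn.mul (hfc.comp_continuousOn ?_)
    exact h.continuousOn.comp (Continuous.continuousOn (by fun_prop)) fun t ht => hD t ht y hy
  rw [← intervalIntegral.integral_sub (hi _ right_mem_uIcc) (hi _ left_mem_uIcc)]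
  -- The fundamental theorem of calculus vertically, then Fubini, so that `hK` applies on each
  -- horizontal line.
  have hftc : ∀ t ∈ uIcc 0 δ, ψ t * (f : M → ℂ) (E (p + t + y₂ * Complex.I)) -
      ψ t * (f : M → ℂ) (E (p + t + y₁ * Complex.I)) =
      ∫ y in y₁..y₂, ψ t * (S.Lv f : M → ℂ) (E (p + t + y * Complex.I)) := by
    intro t ht
    rw [uIcc_of_le hδ] at ht
    rw [intervalIntegral.integral_const_mul, ← mul_sub]
    congr 1
    symm
    refine intervalIntegral.integral_eq_sub_of_hasDerivAt
      (fun y hy => h.hasDerivAt_vert f (hD t ht y hy)) ?_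
    apply ContinuousOn.intervalIntegrable
    exact hLc.comp_continuousOn (h.continuousOn.comp (Continuous.continuousOn (by fun_prop))
      fun y hy => hD t ht y hy)
  rw [intervalIntegral.integral_congr hftc, MeasureTheory.intervalIntegral_intervalIntegral_swap]
  · exact intervalIntegral.norm_integral_le_of_norm_le_const fun y hy =>
      hK y (uIoc_subset_uIcc hy)
  · rw [← uIcc_of_le hδ] at hc2
    exact (hc2.integrableOn_compact (isCompact_uIcc.prod isCompact_uIcc)).mono_set
      (prod_mono uIoc_subset_uIcc uIoc_subset_uIcc)

end IsFlatOn

/-- Differences of translates of a fixed smooth test function are small. -/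
theorem exists_ckBoundOn_sub_translate {ψ : ℝ → ℂ} (hψ : ContDiff ℝ ∞ ψ)
    (hs : HasCompactSupport ψ) (kh : ℝ≥0) :
    ∃ C : ℝ, 0 ≤ C ∧ ∀ a : ℝ,
      CkBoundOn ⌊kh⌋₊ (kh - ⌊kh⌋₊) univ (C * |a|) fun t => ψ t - ψ (t - a) := by
  obtain ⟨A, hA, h⟩ := exists_bound_iteratedDeriv hψ hs (⌊kh⌋₊ + 2)
  refine ⟨2 * A, by positivity, fun a => ?_⟩
  have hψa : ContDiff ℝ ∞ fun t => ψ (t - a) := hψ.comp (contDiff_id.sub contDiff_const)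
  rw [mul_assoc]
  refine CkBoundOn.of_bound_succ ((hψ.sub hψa).of_le (by exact_mod_cast le_top)) (fun i hi x => ?_)
    (ckExponent_nonneg kh) (ckExponent_le_one kh)
  have h1 : iteratedDeriv i (fun t => ψ t - ψ (t - a)) x =
      iteratedDeriv i ψ x - iteratedDeriv i ψ (x - a) := by
    have h2 : iteratedDeriv i (fun t => ψ (t - a)) x = iteratedDeriv i ψ (x - a) := by
      rw [iteratedDeriv_comp_sub_const]
    rw [← h2]
    exact iteratedDeriv_sub (hψ.contDiffAt.of_le (by exact_mod_cast le_top))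
      (hψa.contDiffAt.of_le (by exact_mod_cast le_top))
  rw [h1]
  have h3 := norm_iteratedDeriv_sub_le (n := i + 1) (i := i) (hψ.of_le (by exact_mod_cast le_top))
    (Nat.lt_succ_self i) convex_univ (fun x _ => h (i + 1) (by omega) x) (mem_univ x)
    (mem_univ (x - a))
  simpa using h3

/-- Shifting the integration domain of a compactly supported function. -/
theorem integral_translate {ψ G : ℝ → ℂ} {δ a : ℝ} (h0 : tsupport ψ ⊆ Ioo 0 δ)
    (h1 : tsupport (fun t => ψ (t - a)) ⊆ Ioo 0 δ) :
    ∫ t in (0 : ℝ)..δ, ψ t * G (a + t) = ∫ t in (0 : ℝ)..δ, ψ (t - a) * G t := by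
  rw [intervalIntegral.integral_eq_integral_of_support_subset,
    intervalIntegral.integral_eq_integral_of_support_subset]
  · rw [← MeasureTheory.integral_add_right_eq_self (fun t => ψ (t - a) * G t) a]
    simp [add_comm a]
  · exact (Function.support_mul_subset_left _ _).trans ((subset_tsupport _).trans
      (h1.trans Ioo_subset_Ioc_self))
  · exact (Function.support_mul_subset_left _ _).trans ((subset_tsupport _).trans
      (h0.trans Ioo_subset_Ioc_self))

theorem exists_margin {ψ : ℝ → ℂ} {δ : ℝ} (hs : tsupport ψ ⊆ Ioo 0 δ) :
    ∃ ρ > 0, ∀ a : ℝ, |a| < ρ → tsupport (fun t => ψ (t - a)) ⊆ Ioo 0 δ := by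
  have hc : IsCompact (tsupport ψ) :=
    isCompact_Icc.of_isClosed_subset (isClosed_tsupport _) (hs.trans Ioo_subset_Icc_self)
  obtain ⟨ρ, hρ, h⟩ := hc.exists_thickening_subset_open isOpen_Ioo hs
  refine ⟨ρ, hρ, fun a ha t ht => h ?_⟩
  have h1 : t - a ∈ tsupport ψ :=
    tsupport_comp_subset_preimage ψ (f := fun t => t - a) (by fun_prop) ht
  rw [Metric.mem_thickening_iff]
  exact ⟨t - a, h1, by simpa [Real.dist_eq] using ha⟩

end TranslationSurface

/-! ### Finite nets of functionals -/

namespace TranslationSurface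

variable {M : Type*} [TopologicalSpace M] {S : TranslationSurface M}

variable (S) in
/-- The functionals `f ↦ ∫ ψ L_v^j f` (with `j < k_v`) along the curves in `𝒞` can be approximated,
in the dual of the anisotropic space, by finitely many of them. -/
def HasFiniteNet (δ : ℝ) (𝒞 : Set (ℝ → M)) : Prop :=
  ∀ ψ : ℝ → ℂ, ContDiff ℝ ∞ ψ → tsupport ψ ⊆ Ioo 0 δ → ∀ (kh : ℝ≥0) (kv : ℕ), ∀ ε > 0,
    ∃ Γ : Set (ℝ → M), Γ.Finite ∧ (∀ γ ∈ Γ, S.IsHorizontalSegment δ γ) ∧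
      ∀ γ ∈ 𝒞, ∃ γ₀ ∈ Γ, ∀ j < kv, ∀ f : S.smoothFun,
        ‖(∫ t in (0 : ℝ)..δ, ψ t * ((S.Lv ^ j) f : M → ℂ) (γ t)) -
          ∫ t in (0 : ℝ)..δ, ψ t * ((S.Lv ^ j) f : M → ℂ) (γ₀ t)‖ ≤ ε * S.anisoNorm δ kh kv f

theorem HasFiniteNet.mono {δ : ℝ} {𝒞 𝒞' : Set (ℝ → M)} (h : S.HasFiniteNet δ 𝒞')
    (hs : 𝒞 ⊆ 𝒞') : S.HasFiniteNet δ 𝒞 := fun ψ h1 h2 kh kv ε hε => by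
  obtain ⟨Γ, hf, hΓ, hn⟩ := h ψ h1 h2 kh kv ε hε
  exact ⟨Γ, hf, hΓ, fun γ hγ => hn γ (hs hγ)⟩

theorem HasFiniteNet.empty (δ : ℝ) : S.HasFiniteNet δ ∅ := fun _ _ _ _ _ _ _ =>
  ⟨∅, finite_empty, fun _ h => h.elim, fun _ h => h.elim⟩

theorem HasFiniteNet.union {δ : ℝ} {𝒞 𝒞' : Set (ℝ → M)} (h : S.HasFiniteNet δ 𝒞)
    (h' : S.HasFiniteNet δ 𝒞') : S.HasFiniteNet δ (𝒞 ∪ 𝒞') := fun ψ h1 h2 kh kv ε hε => by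
  obtain ⟨Γ, hf, hΓ, hn⟩ := h ψ h1 h2 kh kv ε hε
  obtain ⟨Γ', hf', hΓ', hn'⟩ := h' ψ h1 h2 kh kv ε hε
  refine ⟨Γ ∪ Γ', hf.union hf', fun γ hγ => hγ.elim (hΓ γ) (hΓ' γ), fun γ hγ => ?_⟩
  rcases hγ with hγ | hγ
  · obtain ⟨γ₀, h3, h4⟩ := hn γ hγ
    exact ⟨γ₀, Or.inl h3, h4⟩
  · obtain ⟨γ₀, h3, h4⟩ := hn' γ hγ
    exact ⟨γ₀, Or.inr h3, h4⟩

theorem HasFiniteNet.biUnion {ι : Type*} {s : Set ι} (hs : s.Finite) {δ : ℝ}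
    {𝒞 : ι → Set (ℝ → M)} (h : ∀ i ∈ s, S.HasFiniteNet δ (𝒞 i)) :
    S.HasFiniteNet δ (⋃ i ∈ s, 𝒞 i) := by
  induction s, hs using Set.Finite.induction_on with
  | empty => simpa using HasFiniteNet.empty δ
  | insert _ _ ih =>
    rw [biUnion_insert]
    exact (h _ (mem_insert _ _)).union (ih fun i hi => h i (mem_insert_of_mem _ hi))

/-- The starting points of the horizontal segments of length `δ` staying in the domain `D` of a flat
chart, in the closed half plane determined by a sign. -/
def startPoints (D : Set ℂ) (s R δ : ℝ) : Set ℂ :=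
  {w | ‖w‖ ≤ R / 4 ∧ 0 ≤ s * w.im ∧ ∀ t ∈ Icc (0 : ℝ) δ, w + t ∈ D}

namespace IsFlatOn

variable [CompactSpace M] {E : ℂ → M} {D : Set ℂ}

/-- The two segments are joined by a path going into the half plane, across, and back. Each vertical
leg has length at most `2η` and costs `A` per unit through `L_v^(j+1)`, admissible as `j < kv`; the
horizontal leg is a translation of `ψ` and costs at most `C η`. -/
theorem norm_integral_sub_le (h : S.IsFlatOn E D) {s R δ : ℝ} (hs : s = 1 ∨ s = -1) (hδ : 0 < δ)
    (hδR : δ ≤ R / 4) (hD : ∀ w : ℂ, ‖w‖ < R → 0 < s * w.im → w ∈ D) {ψ : ℝ → ℂ}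
    (hψ : ContDiff ℝ ∞ ψ) {kh : ℝ≥0} {kv : ℕ} {A C ρ η : ℝ} (hA0 : 0 ≤ A) (hC0 : 0 ≤ C)
    (hA : CkBoundOn ⌊kh⌋₊ (kh - ⌊kh⌋₊) univ A ψ)
    (hC : ∀ a : ℝ, CkBoundOn ⌊kh⌋₊ (kh - ⌊kh⌋₊) univ (C * |a|) fun t => ψ t - ψ (t - a))
    (hρ : ∀ a : ℝ, |a| < ρ → tsupport (fun t => ψ (t - a)) ⊆ Ioo 0 δ)
    (hη : 0 < η) (hηρ : η ≤ ρ) (hηR : η ≤ R / 8) {w₁ w₂ : ℂ} (hw₁ : w₁ ∈ startPoints D s R δ)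
    (hw₂ : w₂ ∈ startPoints D s R δ) (hw : ‖w₁ - w₂‖ < η) {j : ℕ} (hj : j < kv)
    (f : S.smoothFun) :
    ‖(∫ t in (0 : ℝ)..δ, ψ t * ((S.Lv ^ j) f : M → ℂ) (E (w₁ + t))) -
      ∫ t in (0 : ℝ)..δ, ψ t * ((S.Lv ^ j) f : M → ℂ) (E (w₂ + t))‖ ≤
        (4 * A + C) * η * S.anisoNorm δ kh kv f := by
  set N := S.anisoNorm δ kh kv f
  have hN0 : 0 ≤ N := anisoNorm_nonneg _ _ _ _
  have hψs : tsupport ψ ⊆ Ioo 0 δ := by simpa using hρ 0 (by simpa using hη.trans_le hηρ)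
  have hss : s * s = 1 := by rcases hs with rfl | rfl <;> norm_num
  have hsa : |s| = 1 := by rcases hs with rfl | rfl <;> norm_num
  have him : |w₁.im - w₂.im| < η := (Complex.abs_im_le_norm (w₁ - w₂)).trans_lt hw
  have hre : |w₂.re - w₁.re| < η := by
    rw [abs_sub_comm]; exact (Complex.abs_re_le_norm (w₁ - w₂)).trans_lt hw
  -- A level `η` beyond the farther segment: it lies strictly inside the half plane, and within `2η`
  -- of both starting heights.
  set m := max (s * w₁.im) (s * w₂.im) + η with hm
  set y := s * m with hy
  have hsy : s * y = m := by rw [hy, ← mul_assoc, hss, one_mul]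
  have hsim : |s * w₁.im - s * w₂.im| < η := by
    rw [← mul_sub, abs_mul, hsa, one_mul]; exact him
  rw [abs_lt] at hsim
  -- moving up
  have hup : ∀ w ∈ startPoints D s R δ, s * w.im ≤ m - η → m - 2 * η ≤ s * w.im →
      (∀ t ∈ Icc (0 : ℝ) δ, (w.re : ℂ) + y * Complex.I + t ∈ D) ∧
      ‖(∫ t in (0 : ℝ)..δ, ψ t * ((S.Lv ^ j) f : M → ℂ) (E (w.re + y * Complex.I + t))) -
        ∫ t in (0 : ℝ)..δ, ψ t * ((S.Lv ^ j) f : M → ℂ) (E (w + t))‖ ≤ A * N * (2 * η) := by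
    rintro w ⟨h1, h2, h3⟩ h4 h5
    have hwy : |y - w.im| ≤ 2 * η := by
      have : |s * (y - w.im)| ≤ 2 * η := by
        rw [mul_sub, hsy, abs_le]; constructor <;> linarith
      rwa [abs_mul, hsa, one_mul] at this
    have hrect : ∀ t ∈ Icc (0 : ℝ) δ, ∀ v ∈ uIcc w.im y, (w.re : ℂ) + t + v * Complex.I ∈ D := by
      intro t ht v hv
      have hvw : |v - w.im| ≤ |y - w.im| := abs_sub_left_of_mem_uIcc hv
      -- At its initial height the segment may lie on the boundary of the half plane, where
      -- membership in `startPoints` keeps it in `D`; every other height is strictly inside.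
      rcases eq_or_ne v w.im with rfl | hne
      · have := h3 t ht
        rwa [← Complex.re_add_im w, add_right_comm] at this
      · refine hD _ ?_ ?_
        · have e1 : (w.re : ℂ) + t + v * Complex.I =
              w + t + ((v - w.im : ℝ) : ℂ) * Complex.I := by
            apply Complex.ext <;> simp
          rw [e1]
          calc ‖w + t + ((v - w.im : ℝ) : ℂ) * Complex.I‖
              ≤ ‖w‖ + ‖(t : ℂ)‖ + ‖((v - w.im : ℝ) : ℂ) * Complex.I‖ := norm_add₃_le
            _ ≤ R / 4 + R / 4 + R / 4 := by
              have e2 : ‖(t : ℂ)‖ ≤ R / 4 := by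
                rw [Complex.norm_real, Real.norm_of_nonneg ht.1]; exact ht.2.trans hδR
              have e3 : ‖((v - w.im : ℝ) : ℂ) * Complex.I‖ ≤ R / 4 := by
                rw [norm_mul, Complex.norm_I, mul_one, Complex.norm_real, Real.norm_eq_abs]
                linarith
              gcongr
            _ < R := by linarith
        · have e1 : ((w.re : ℂ) + t + v * Complex.I).im = v := by simp
          rw [e1]
          have e2 : s * v ∈ uIcc (s * w.im) (s * y) := by
            rw [← image_const_mul_uIcc]; exact ⟨v, hv, rfl⟩
          rw [hsy, uIcc_of_le (by linarith)] at e2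
          refine lt_of_le_of_ne (h2.trans e2.1) fun e3 => hne ?_
          have e4 : s * v = s * w.im := le_antisymm (by linarith) e2.1
          exact mul_left_cancel₀ (left_ne_zero_of_mul_eq_one hss) e4
    have hrow : ∀ v ∈ uIcc w.im y, ∀ t ∈ Icc (0 : ℝ) δ, (w.re : ℂ) + v * Complex.I + t ∈ D :=
      fun v hv t ht => by rw [add_right_comm]; exact hrect t ht v hv
    refine ⟨hrow y right_mem_uIcc, ?_⟩
    have h6 := h.norm_integral_sub_le_vert ((S.Lv ^ j) f) (p := w.re) (y₁ := w.im) (y₂ := y)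
      (K := A * N) hδ.le hrect hψ.continuous fun v hv => by
        have := norm_integral_le_of_ckBoundOn (j := j + 1) hj f
          (h.isHorizontalSegment (hrow v hv)) hA hψs hA0
        rwa [pow_succ'] at this
    rw [Complex.re_add_im] at h6
    exact h6.trans (mul_le_mul_of_nonneg_left hwy (by positivity))
  have hm1 := le_max_left (s * w₁.im) (s * w₂.im)
  have hm2 := le_max_right (s * w₁.im) (s * w₂.im)
  have hm3 : max (s * w₁.im) (s * w₂.im) ≤ s * w₁.im + η := max_le (by linarith) (by linarith)
  have hm4 : max (s * w₁.im) (s * w₂.im) ≤ s * w₂.im + η := max_le (by linarith) (by linarith)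
  obtain ⟨hr1, hu1⟩ := hup w₁ hw₁ (by linarith) (by linarith)
  obtain ⟨hr2, hu2⟩ := hup w₂ hw₂ (by linarith) (by linarith)
  -- moving horizontally
  set a := w₂.re - w₁.re with ha
  have hG : (∫ t in (0 : ℝ)..δ, ψ t * ((S.Lv ^ j) f : M → ℂ) (E (w₂.re + y * Complex.I + t))) =
      ∫ t in (0 : ℝ)..δ, ψ (t - a) * ((S.Lv ^ j) f : M → ℂ) (E (w₁.re + y * Complex.I + t)) := by
    rw [← integral_translate hψs (hρ a (hre.trans_le hηρ))]
    congr 1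
    funext t
    have e1 : (w₂.re : ℂ) + y * Complex.I + t = w₁.re + y * Complex.I + ((a + t : ℝ) : ℂ) := by
      rw [ha]; push_cast; ring
    rw [e1]
  have hseg := h.isHorizontalSegment hr1
  have hint : ∀ g : ℝ → ℂ, Continuous g → IntervalIntegrable (fun t : ℝ => g t *
      ((S.Lv ^ j) f : M → ℂ) (E (w₁.re + y * Complex.I + t))) MeasureTheory.volume 0 δ := by
    intro g hg
    apply ContinuousOn.intervalIntegrable
    rw [uIcc_of_le hδ.le]
    exact hg.continuousOn.mul
      ((continuous_of_mem ((S.Lv ^ j) f).2).comp_continuousOn hseg.continuousOn)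
  have hh : ‖(∫ t in (0 : ℝ)..δ, ψ t * ((S.Lv ^ j) f : M → ℂ) (E (w₁.re + y * Complex.I + t))) -
      ∫ t in (0 : ℝ)..δ, ψ t * ((S.Lv ^ j) f : M → ℂ) (E (w₂.re + y * Complex.I + t))‖ ≤
      C * η * N := by
    rw [hG, ← intervalIntegral.integral_sub (hint _ hψ.continuous)
      (hint (fun t => ψ (t - a)) (hψ.continuous.comp (by fun_prop)))]
    have h7 := norm_integral_le_of_ckBoundOn hj.le f hseg (hC a)
      ((tsupport_sub _ _).trans (union_subset hψs (hρ a (hre.trans_le hηρ)))) (by positivity)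
    simp only [sub_mul] at h7
    refine h7.trans ?_
    gcongr
  set I₁ := ∫ t in (0 : ℝ)..δ, ψ t * ((S.Lv ^ j) f : M → ℂ) (E (w₁ + t))
  set I₂ := ∫ t in (0 : ℝ)..δ, ψ t * ((S.Lv ^ j) f : M → ℂ) (E (w₂ + t))
  set J₁ := ∫ t in (0 : ℝ)..δ, ψ t * ((S.Lv ^ j) f : M → ℂ) (E (w₁.re + y * Complex.I + t))
  set J₂ := ∫ t in (0 : ℝ)..δ, ψ t * ((S.Lv ^ j) f : M → ℂ) (E (w₂.re + y * Complex.I + t))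
  calc ‖I₁ - I₂‖ = ‖-(J₁ - I₁) + (J₁ - J₂) + (J₂ - I₂)‖ := by congr 1; ring
    _ ≤ ‖-(J₁ - I₁)‖ + ‖J₁ - J₂‖ + ‖J₂ - I₂‖ := norm_add₃_le
    _ ≤ A * N * (2 * η) + C * η * N + A * N * (2 * η) := by
      rw [norm_neg]
      gcongr
    _ = (4 * A + C) * η * N := by ring

/-- Total boundedness of the set of horizontal segments in a flat half disk. -/
theorem hasFiniteNet (h : S.IsFlatOn E D) {s R δ : ℝ} (hs : s = 1 ∨ s = -1) (hδ : 0 < δ)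
    (hδR : δ ≤ R / 4) (hD : ∀ w : ℂ, ‖w‖ < R → 0 < s * w.im → w ∈ D) :
    S.HasFiniteNet δ {γ | ∃ w ∈ startPoints D s R δ, ∀ t ∈ Icc (0 : ℝ) δ, γ t = E (w + t)} := by
  intro ψ hψ hψs kh kv ε hε
  have hcomp : HasCompactSupport ψ :=
    isCompact_Icc.of_isClosed_subset (isClosed_tsupport _) (hψs.trans Ioo_subset_Icc_self)
  obtain ⟨A, hA0, hA⟩ := exists_ckBoundOn_of_smooth hψ hψs kh
  obtain ⟨C, hC0, hC⟩ := exists_ckBoundOn_sub_translate hψ hcomp kh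
  obtain ⟨ρ, hρ0, hρ⟩ := exists_margin hψs
  -- Small enough for the translated `ψ` to stay supported in `(0, δ)`, for the detour to stay in
  -- the disk, and for the total cost `(4A + C) η` to be at most `ε`.
  set η := min (min ρ (R / 8)) (ε / (4 * A + C + 1)) with hη
  have hη0 : 0 < η := lt_min (lt_min hρ0 (by linarith)) (by positivity)
  have htb : TotallyBounded (startPoints D s R δ) := by
    refine (isCompact_closedBall (0 : ℂ) (R / 4)).totallyBounded.subset fun w hw => ?_
    simpa using hw.1
  obtain ⟨W, hWs, hWf, hW⟩ := Metric.finite_approx_of_totallyBounded htb η hη0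
  refine ⟨(fun w (t : ℝ) => E (w + t)) '' W, hWf.image _, ?_, ?_⟩
  · rintro _ ⟨w, hw, rfl⟩
    exact h.isHorizontalSegment (hWs hw).2.2
  · rintro γ ⟨w, hw, hγ⟩
    obtain ⟨w', hw', hww'⟩ := mem_iUnion₂.1 (hW hw)
    refine ⟨_, ⟨w', hw', rfl⟩, fun j hj f => ?_⟩
    have h1 : (∫ t in (0 : ℝ)..δ, ψ t * ((S.Lv ^ j) f : M → ℂ) (γ t)) =
        ∫ t in (0 : ℝ)..δ, ψ t * ((S.Lv ^ j) f : M → ℂ) (E (w + t)) := by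
      refine intervalIntegral.integral_congr fun t ht => ?_
      rw [uIcc_of_le hδ.le] at ht
      simp only [hγ t ht]
    rw [h1]
    refine (h.norm_integral_sub_le hs hδ hδR hD hψ hA0 hC0 hA hC hρ hη0
      ((min_le_left _ _).trans (min_le_left _ _)) ((min_le_left _ _).trans (min_le_right _ _))
      hw (hWs hw') (by simpa [dist_eq_norm] using hww') hj f).trans
      (mul_le_mul_of_nonneg_right ?_ (anisoNorm_nonneg _ _ _ _))
    have h2 : η * (4 * A + C + 1) ≤ ε := by
      rw [← le_div_iff₀ (by positivity)]; exact min_le_right _ _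
    linarith

end IsFlatOn

end TranslationSurface

/-! ### Flat coordinates near regular points and singularities -/

/-- A branch of the `d`-th root, defined outside of the half line `-τ ℝ₊`, where `τ = ζ ^ d`. -/
def rootBranch (d : ℕ) (ζ τ w : ℂ) : ℂ := ζ * (w / τ) ^ ((d : ℂ)⁻¹)

theorem rootBranch_pow {d : ℕ} (hd : 0 < d) {ζ τ : ℂ} (hτ : τ ≠ 0) (hζ : ζ ^ d = τ) (w : ℂ) :
    rootBranch d ζ τ w ^ d = w := by
  rw [rootBranch, mul_pow, Complex.cpow_nat_inv_pow _ hd.ne', hζ, mul_div_cancel₀ _ hτ]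

theorem norm_rootBranch_lt {d : ℕ} (hd : 0 < d) {ζ τ : ℂ} (hτ : τ ≠ 0) (hζ : ζ ^ d = τ) {w : ℂ}
    {r : ℝ} (hr : 0 ≤ r) (hw : ‖w‖ < r ^ d) : ‖rootBranch d ζ τ w‖ < r := by
  refine lt_of_pow_lt_pow_left₀ d hr ?_
  rwa [← norm_pow, rootBranch_pow hd hτ hζ]

theorem tendsto_rootBranch_zero {d : ℕ} (hd : 0 < d) {ζ τ : ℂ} (hτ : τ ≠ 0) (hζ : ζ ^ d = τ) :
    Tendsto (rootBranch d ζ τ) (𝓝 0) (𝓝 0) := by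
  rw [Metric.tendsto_nhds]
  intro ε hε
  filter_upwards [Metric.ball_mem_nhds (0 : ℂ) (pow_pos hε d)] with w hw
  rw [dist_zero_right]
  exact norm_rootBranch_lt hd hτ hζ hε.le (by simpa using hw)

theorem rootBranch_ne_zero {d : ℕ} (hd : 0 < d) {ζ τ : ℂ} (hτ : τ ≠ 0) (hζ : ζ ^ d = τ) {w : ℂ}
    (hw : w ≠ 0) : rootBranch d ζ τ w ≠ 0 := fun h => hw <| by
  rw [← rootBranch_pow hd hτ hζ w, h, zero_pow hd.ne']

theorem continuousAt_rootBranch (d : ℕ) (ζ τ : ℂ) {w : ℂ} (hw : w / τ ∈ Complex.slitPlane) :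
    ContinuousAt (rootBranch d ζ τ) w :=
  continuousAt_const.mul ((continuousAt_id.div_const τ).cpow continuousAt_const hw)

/-- With `τ = s i` the excluded half line is vertical and opposite to the half plane `s · im > 0`.
-/
theorem div_mul_I_mem_slitPlane {s : ℝ} (hs : s = 1 ∨ s = -1) (w : ℂ) :
    w / (s * Complex.I) ∈ Complex.slitPlane ↔ 0 < s * w.im ∨ w.re ≠ 0 := by
  rw [Complex.mem_slitPlane_iff]
  rcases hs with rfl | rfl <;> simp [div_neg]

namespace TranslationSurface

variable {M : Type*} [TopologicalSpace M] {S : TranslationSurface M}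

theorem isFlatOn_chart {e : OpenPartialHomeomorph M ℂ} (he : e ∈ S.atlas) {c : ℂ} {R : ℝ}
    (hR : Metric.ball c R ⊆ e.target) :
    S.IsFlatOn (fun w => e.symm (c + w)) (Metric.ball 0 R) := by
  have hmem : ∀ w ∈ Metric.ball (0 : ℂ) R, c + w ∈ e.target := fun w hw =>
    hR (by simpa [dist_eq_norm] using hw)
  have hc : ContinuousOn (fun w => e.symm (c + w)) (Metric.ball 0 R) :=
    e.continuousOn_symm.comp (Continuous.continuousOn (by fun_prop)) hmem
  refine ⟨Metric.isOpen_ball, hc, fun w hw => S.source_subset e he (e.map_target (hmem w hw)),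
    fun w hw e' he' hwe' => ?_⟩
  filter_upwards [(hc.continuousAt (Metric.isOpen_ball.mem_nhds hw)).eventually
    (S.translation e he e' he' _ (e.map_target (hmem w hw)) hwe'),
    Metric.isOpen_ball.mem_nhds hw] with w' h1 h2
  rw [h1, e.right_inv (hmem w hw), e.right_inv (hmem w' h2)]
  ring

/-- Up to translations the flat coordinate near a singularity is `h ^ d`, so a branch of the root
followed by `h.symm` inverts it locally. -/
theorem isFlatOn_rootBranch {σ : M} {d : ℕ} (hd : 0 < d) {h : OpenPartialHomeomorph M ℂ}
    (hσ : h σ = 0) {R : ℝ} (hR : 0 ≤ R) (hsub : Metric.ball 0 R ⊆ h.target)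
    (hns : ∀ z ∈ Metric.ball (0 : ℂ) R, z ≠ 0 → h.symm z ∉ S.sing)
    (hflat : ∀ x ∈ h.source, x ≠ σ → ∀ e ∈ S.atlas, x ∈ e.source →
      ∀ᶠ y in 𝓝 x, e y - e x = h y ^ d - h x ^ d) {ζ τ : ℂ} (hτ : τ ≠ 0) (hζ : ζ ^ d = τ) :
    S.IsFlatOn (fun w => h.symm (rootBranch d ζ τ w))
      {w | w / τ ∈ Complex.slitPlane ∧ ‖w‖ < R ^ d} := by
  set D := {w : ℂ | w / τ ∈ Complex.slitPlane ∧ ‖w‖ < R ^ d}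
  have hopen : IsOpen D := (Complex.isOpen_slitPlane.preimage (continuous_id.div_const τ)).inter
    (isOpen_lt continuous_norm continuous_const)
  have hball : ∀ w ∈ D, rootBranch d ζ τ w ∈ Metric.ball (0 : ℂ) R := fun w hw => by
    simpa using norm_rootBranch_lt hd hτ hζ hR hw.2
  have hne : ∀ w ∈ D, rootBranch d ζ τ w ≠ 0 := fun w hw => by
    refine rootBranch_ne_zero hd hτ hζ ?_
    rintro rfl
    simpa using Complex.slitPlane_ne_zero hw.1
  have hc : ∀ w ∈ D, ContinuousAt (fun w => h.symm (rootBranch d ζ τ w)) w := fun w hw =>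
    (h.continuousAt_symm (hsub (hball w hw))).comp (continuousAt_rootBranch d ζ τ hw.1)
  refine ⟨hopen, fun w hw => (hc w hw).continuousWithinAt, fun w hw => hns _ (hball w hw) (hne w hw),
    fun w hw e he hwe => ?_⟩
  have hxσ : h.symm (rootBranch d ζ τ w) ≠ σ := fun h0 => hne w hw <| by
    rw [← h.right_inv (hsub (hball w hw)), h0, hσ]
  filter_upwards [(hc w hw).eventually (hflat _ (h.map_target (hsub (hball w hw))) hxσ e he hwe),
    hopen.mem_nhds hw] with w' h1 h2
  rw [h1, h.right_inv (hsub (hball w hw)), h.right_inv (hsub (hball w' h2)),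
    rootBranch_pow hd hτ hζ, rootBranch_pow hd hτ hζ]

/-! ### Total boundedness of short horizontal segments -/

variable [CompactSpace M] [T2Space M]

theorem exists_hasFiniteNet_of_notMem_sing {x : M} (hx : x ∉ S.sing) :
    ∃ U ∈ 𝓝 x, ∃ δ₀ > 0, ∀ δ, 0 < δ → δ ≤ δ₀ →
      S.HasFiniteNet δ {γ | S.IsHorizontalSegment δ γ ∧ γ 0 ∈ U} := by
  obtain ⟨e, he, hxe⟩ := S.cover x hx
  obtain ⟨R, hR0, hR⟩ := Metric.isOpen_iff.1 e.open_target _ (e.map_source hxe)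
  have hF := isFlatOn_chart he hR
  refine ⟨{y | y ∈ e.source ∧ ‖e y - e x‖ < R / 4}, ?_, R / 4, by positivity, fun δ hδ hδR => ?_⟩
  · refine inter_mem (e.open_source.mem_nhds hxe) ?_
    have := (e.continuousAt hxe).eventually (Metric.ball_mem_nhds (e x) (show 0 < R / 4 by positivity))
    filter_upwards [this] with y hy
    change ‖e y - e x‖ < R / 4
    rwa [← dist_eq_norm]
  · have hD : ∀ s : ℝ, ∀ w : ℂ, ‖w‖ < R → 0 < s * w.im → w ∈ Metric.ball (0 : ℂ) R :=
      fun s w hw _ => by simpa using hw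
    refine ((hF.hasFiniteNet (Or.inl rfl) hδ hδR (hD 1)).union
      (hF.hasFiniteNet (Or.inr rfl) hδ hδR (hD (-1)))).mono ?_
    rintro γ ⟨hγ, h0, h1⟩
    have hw : ∀ t ∈ Icc (0 : ℝ) δ, e (γ 0) - e x + t ∈ Metric.ball (0 : ℂ) R := by
      intro t ht
      rw [mem_ball_zero_iff]
      calc ‖e (γ 0) - e x + t‖ ≤ ‖e (γ 0) - e x‖ + ‖(t : ℂ)‖ := norm_add_le _ _
        _ < R / 4 + R / 4 := by
          refine add_lt_add_of_lt_of_le h1 ?_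
          rw [Complex.norm_real, Real.norm_of_nonneg ht.1]
          exact ht.2.trans hδR
        _ ≤ R := by linarith
    have heq := hF.eq_of_isHorizontalSegment hw hγ
      (by rw [add_sub_cancel, e.left_inv h0])
    rcases le_total 0 (e (γ 0) - e x).im with h2 | h2
    · exact Or.inl ⟨_, ⟨h1.le, by linarith, hw⟩, heq⟩
    · exact Or.inr ⟨_, ⟨h1.le, by linarith, hw⟩, heq⟩

/-- In the coordinate `h ^ d`, a segment starts in the closed upper or lower half plane and moves to
the right, inside the plane slit on the other side. Each half plane needs one family per `d`-th root
of `±i`, hence finitely many families in all. -/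
theorem exists_hasFiniteNet_of_mem_sing {σ : M} (hσ : σ ∈ S.sing) :
    ∃ U ∈ 𝓝 σ, ∃ δ₀ > 0, ∀ δ, 0 < δ → δ ≤ δ₀ →
      S.HasFiniteNet δ {γ | S.IsHorizontalSegment δ γ ∧ γ 0 ∈ U} := by
  obtain ⟨d, hd, h, hσh, hσ0, hflat⟩ := S.ramified σ hσ
  obtain ⟨R₀, hR₀, hsub, hns⟩ : ∃ R₀ > 0, Metric.ball 0 R₀ ⊆ h.target ∧
      ∀ z ∈ Metric.ball (0 : ℂ) R₀, z ≠ 0 → h.symm z ∉ S.sing := by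
    have h0 : (0 : ℂ) ∈ h.target := hσ0 ▸ h.map_source hσh
    have hc : Tendsto h.symm (𝓝 0) (𝓝 σ) := by
      have := (h.continuousAt_symm h0).tendsto
      rwa [show h.symm 0 = σ by rw [← hσ0, h.left_inv hσh]] at this
    have h1 : (S.sing \ {σ})ᶜ ∈ 𝓝 σ :=
      (S.finite_sing.subset sdiff_subset).isClosed.isOpen_compl.mem_nhds (by simp)
    obtain ⟨R₀, hR₀, h2⟩ := Metric.mem_nhds_iff.1
      (inter_mem (h.open_target.mem_nhds h0) (hc h1))
    refine ⟨R₀, hR₀, fun z hz => (h2 hz).1, fun z hz hz0 hzs => (h2 hz).2 ⟨hzs, fun h3 => hz0 ?_⟩⟩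
    rw [← h.right_inv (h2 hz).1, mem_singleton_iff.1 h3, hσ0]
  set R := R₀ ^ d with hRdef
  have hR : 0 < R := pow_pos hR₀ d
  have hτ : ∀ s : ℝ, s = 1 ∨ s = -1 → (s : ℂ) * Complex.I ≠ 0 := by
    rintro s (rfl | rfl) <;> simp
  have hF := fun (s : ℝ) (hs : s = 1 ∨ s = -1) (ζ : ℂ) (hζ : ζ ^ d = s * Complex.I) =>
    isFlatOn_rootBranch hd hσ0 hR₀.le hsub hns hflat (hτ s hs) hζ
  set D : ℝ → Set ℂ := fun s => {w | w / (s * Complex.I) ∈ Complex.slitPlane ∧ ‖w‖ < R} with hDdef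
  have hDm : ∀ s : ℝ, s = 1 ∨ s = -1 → ∀ w : ℂ, w ∈ D s ↔ (0 < s * w.im ∨ w.re ≠ 0) ∧ ‖w‖ < R :=
    fun s hs w => and_congr_left' (div_mul_I_mem_slitPlane hs w)
  refine ⟨{y | y ∈ h.source ∧ ‖h y ^ d‖ < R / 4}, ?_, R / 4, by positivity, fun δ hδ hδR => ?_⟩
  · refine inter_mem (h.open_source.mem_nhds hσh) ?_
    have h1 : ContinuousAt (fun y => ‖h y ^ d‖) σ := ((h.continuousAt hσh).pow d).norm
    exact h1.eventually_lt continuousAt_const (by simpa [hσ0, hd.ne'] using hR)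
  have hD : ∀ s : ℝ, s = 1 ∨ s = -1 → ∀ w : ℂ, ‖w‖ < R → 0 < s * w.im → w ∈ D s :=
    fun s hs w h1 h2 => (hDm s hs w).2 ⟨Or.inl h2, h1⟩
  have hfin : ∀ a : ℂ, {ζ : ℂ | ζ ^ d = a}.Finite := fun a =>
    (Polynomial.nthRoots d a).toFinset.finite_toSet.subset fun ζ hζ => by
      simpa [Polynomial.mem_nthRoots hd] using hζ
  have hnet := fun (s : ℝ) (hs : s = 1 ∨ s = -1) => HasFiniteNet.biUnion
    (hfin (s * Complex.I)) fun ζ hζ => (hF s hs ζ hζ).hasFiniteNet hs hδ hδR (hD s hs)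
  refine ((hnet 1 (Or.inl rfl)).union (hnet (-1) (Or.inr rfl))).mono ?_
  rintro γ ⟨hγ, h0, h1⟩
  set w := h (γ 0) ^ d with hw
  have hγσ : γ 0 ≠ σ := fun h2 => hγ.notMem_sing 0 ⟨le_rfl, hδ.le⟩ (h2 ▸ hσ)
  have hw0 : w ≠ 0 := pow_ne_zero _ fun h2 => hγσ <| by
    rw [← h.left_inv h0, h2, ← hσ0, h.left_inv hσh]
  have key : ∀ s : ℝ, s = 1 ∨ s = -1 → 0 ≤ s * w.im →
      γ ∈ ⋃ ζ ∈ {ζ : ℂ | ζ ^ d = s * Complex.I}, {γ | ∃ w ∈ startPoints (D s) s R δ,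
        ∀ t ∈ Icc (0 : ℝ) δ, γ t = h.symm (rootBranch d ζ (s * Complex.I) (w + t))} := by
    intro s hs hsw
    have hroot : (w / (s * Complex.I)) ^ ((d : ℂ)⁻¹) ≠ 0 := fun h2 => by
      have h3 := Complex.cpow_nat_inv_pow (w / (s * Complex.I)) hd.ne'
      rw [h2, zero_pow hd.ne'] at h3
      exact div_ne_zero hw0 (hτ s hs) h3.symm
    -- Selects the branch whose value at `w` is `h (γ 0)`, so that the developed segment starts at
    -- the right point.
    set ζ := h (γ 0) / (w / (s * Complex.I)) ^ ((d : ℂ)⁻¹) with hζdef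
    have hζ : ζ ^ d = s * Complex.I := by
      rw [hζdef, div_pow, Complex.cpow_nat_inv_pow _ hd.ne', ← hw, div_div_cancel₀ hw0]
    have hstart : γ 0 = h.symm (rootBranch d ζ (s * Complex.I) w) := by
      rw [rootBranch, hζdef, div_mul_cancel₀ _ hroot, h.left_inv h0]
    have hnorm : ∀ t ∈ Icc (0 : ℝ) δ, ‖w + t‖ < R := by
      intro t ht
      calc ‖w + t‖ ≤ ‖w‖ + ‖(t : ℂ)‖ := norm_add_le _ _
        _ < R / 4 + R / 4 := by
          refine add_lt_add_of_lt_of_le h1 ?_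
          rw [Complex.norm_real, Real.norm_of_nonneg ht.1]
          exact ht.2.trans hδR
        _ ≤ R := by linarith
    -- The horizontal line can leave `D s` only by reaching `0`, at time `t₀ = -w`. Before `t₀` the
    -- curve follows the root branch, so by continuity `γ t₀` would be the singularity `σ`, which is
    -- excluded.
    have hmemD : ∀ t ∈ Icc (0 : ℝ) δ, w + t ∈ D s := by
      intro t₀ ht₀
      refine (hDm s hs _).2 ⟨?_, hnorm t₀ ht₀⟩
      by_contra hcon
      push Not at hcon
      have him : w.im = 0 := by
        have h2 : s * w.im = 0 := le_antisymm (by simpa using hcon.1) hsw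
        rcases mul_eq_zero.1 h2 with h3 | h3
        · rcases hs with rfl | rfl <;> norm_num at h3
        · exact h3
      have hre : w.re = -t₀ := by
        have := hcon.2
        simp at this
        linarith
      have ht₀pos : 0 < t₀ := by
        refine lt_of_le_of_ne ht₀.1 fun h2 => hw0 ?_
        apply Complex.ext
        · rw [hre, ← h2]; simp
        · exact him
      have hwt : w = ((-t₀ : ℝ) : ℂ) := by
        apply Complex.ext
        · simpa using hre
        · simpa using him
      have heq : ∀ t ∈ Ico 0 t₀, γ t = h.symm (rootBranch d ζ (s * Complex.I) (w + t)) := by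
        intro t ht
        have hγt : S.IsHorizontalSegment t γ := by
          simpa using hγ.shift (δ := t) (a := 0) le_rfl (by linarith [ht.2, ht₀.2])
        refine (hF s hs ζ hζ).eq_of_isHorizontalSegment (fun u hu => ?_) hγt hstart t ⟨ht.1, le_rfl⟩
        refine (hDm s hs _).2 ⟨Or.inr ?_, hnorm u ⟨hu.1, by linarith [hu.2, ht.2, ht₀.2]⟩⟩
        simp only [Complex.add_re, hre, Complex.ofReal_re]
        linarith [hu.2, ht.2]
      have hlim1 : Tendsto γ (𝓝[Ico 0 t₀] t₀) (𝓝 (γ t₀)) :=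
        (hγ.continuousOn t₀ ht₀).mono_left (nhdsWithin_mono _ fun u hu =>
          ⟨hu.1, hu.2.le.trans ht₀.2⟩)
      have hlim2 : Tendsto γ (𝓝[Ico 0 t₀] t₀) (𝓝 σ) := by
        have c1 : Tendsto (fun t : ℝ => w + t) (𝓝 t₀) (𝓝 0) := by
          have : Continuous fun t : ℝ => w + (t : ℂ) := by fun_prop
          simpa [hwt] using this.tendsto t₀
        have c2 : Tendsto h.symm (𝓝 0) (𝓝 σ) := by
          have := (h.continuousAt_symm (hsub (Metric.mem_ball_self hR₀))).tendsto
          rwa [show h.symm 0 = σ by rw [← hσ0, h.left_inv hσh]] at this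
        have c3 := (c2.comp ((tendsto_rootBranch_zero hd (hτ s hs) hζ).comp c1)).mono_left
          (nhdsWithin_le_nhds (s := Ico 0 t₀))
        refine c3.congr' ?_
        filter_upwards [self_mem_nhdsWithin] with t ht
        exact (heq t ht).symm
      have : (𝓝[Ico 0 t₀] t₀).NeBot := by
        rw [← mem_closure_iff_nhdsWithin_neBot, closure_Ico ht₀pos.ne]
        exact ⟨ht₀pos.le, le_rfl⟩
      exact hγ.notMem_sing t₀ ht₀ (tendsto_nhds_unique hlim1 hlim2 ▸ hσ)
    refine mem_iUnion₂.2 ⟨ζ, hζ, w, ⟨h1.le, hsw, hmemD⟩, ?_⟩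
    exact (hF s hs ζ hζ).eq_of_isHorizontalSegment hmemD hγ hstart
  rcases le_total 0 w.im with h2 | h2
  · exact Or.inl (key 1 (Or.inl rfl) (by linarith))
  · exact Or.inr (key (-1) (Or.inr rfl) (by linarith))

/-- Total boundedness of the set of all short horizontal segments. -/
theorem exists_hasFiniteNet (S : TranslationSurface M) :
    ∃ δ₀ > 0, ∀ δ, 0 < δ → δ ≤ δ₀ → S.HasFiniteNet δ {γ | S.IsHorizontalSegment δ γ} := by
  have key : ∃ δ₀ > 0, ∀ δ, 0 < δ → δ ≤ δ₀ →
      S.HasFiniteNet δ {γ | S.IsHorizontalSegment δ γ ∧ γ 0 ∈ (univ : Set M)} := by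
    refine isCompact_univ.induction_on (p := fun U : Set M => ∃ δ₀ > 0, ∀ δ, 0 < δ → δ ≤ δ₀ →
      S.HasFiniteNet δ {γ | S.IsHorizontalSegment δ γ ∧ γ 0 ∈ U}) ?_ ?_ ?_ ?_
    · exact ⟨1, one_pos, fun δ _ _ => by simpa using HasFiniteNet.empty δ⟩
    · rintro U U' hU ⟨δ₀, hδ₀, h⟩
      exact ⟨δ₀, hδ₀, fun δ h1 h2 => (h δ h1 h2).mono fun γ hγ => ⟨hγ.1, hU hγ.2⟩⟩
    · rintro U U' ⟨δ₀, hδ₀, h⟩ ⟨δ₁, hδ₁, h'⟩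
      refine ⟨min δ₀ δ₁, lt_min hδ₀ hδ₁, fun δ h1 h2 => ((h δ h1 (h2.trans (min_le_left _ _))).union
        (h' δ h1 (h2.trans (min_le_right _ _)))).mono ?_⟩
      rintro γ ⟨h3, h4 | h4⟩
      · exact Or.inl ⟨h3, h4⟩
      · exact Or.inr ⟨h3, h4⟩
    · intro x _
      by_cases hx : x ∈ S.sing
      · obtain ⟨U, hU, h⟩ := exists_hasFiniteNet_of_mem_sing hx
        exact ⟨U, mem_nhdsWithin_of_mem_nhds hU, h⟩
      · obtain ⟨U, hU, h⟩ := exists_hasFiniteNet_of_notMem_sing hx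
        exact ⟨U, mem_nhdsWithin_of_mem_nhds hU, h⟩
  simpa using key

end TranslationSurface

/-! ### The operator on the completion -/

theorem spectralRadius_le_one_of_bounded_pow {X : Type*} [NormedAddCommGroup X] [NormedSpace ℂ X]
    [CompleteSpace X] {A : X →L[ℂ] X} {C : ℝ} (h : ∀ n : ℕ, ‖A ^ (n + 1)‖ ≤ C) :
    spectralRadius ℂ A ≤ 1 := by
  refine iSup₂_le fun z hz => ?_
  rw [← enorm_eq_nnnorm, ← ofReal_norm, ENNReal.ofReal_le_one]
  by_contra! hlt
  -- Spectral mapping puts `z^(n+1)` in the spectrum of `A^(n+1)`, which bounds its modulus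
  -- uniformly in `n`; this is impossible for `|z| > 1`.
  obtain ⟨n, hn⟩ := pow_unbounded_of_one_lt (C * ‖(1 : X →L[ℂ] X)‖) hlt
  have h1 := spectrum.norm_le_norm_mul_of_mem (spectrum.pow_mem_pow A (n + 1) hz)
  have h2 : ‖z‖ ^ n ≤ ‖z‖ ^ (n + 1) := pow_le_pow_right₀ hlt.le (Nat.le_succ n)
  rw [norm_pow] at h1
  have h3 := mul_le_mul_of_nonneg_right (h n) (norm_nonneg (1 : X →L[ℂ] X))
  linarith

namespace TranslationSurface

variable {M : Type*} [TopologicalSpace M] [CompactSpace M] {S : TranslationSurface M}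

variable {β : ℝ} {kh : ℝ≥0} {kv : ℕ}

theorem norm_toAnisotropic (f : S.smoothFun) :
    ‖S.toAnisotropic β kh kv f‖ = S.anisoNorm β kh kv f :=
  UniformSpace.Completion.norm_coe (E := S.NormedSmoothFun β kh kv) f

theorem denseRange_toAnisotropic : DenseRange (S.toAnisotropic β kh kv) :=
  UniformSpace.Completion.denseRange_coe (α := S.NormedSmoothFun β kh kv)

theorem toAnisotropic_add (f g : S.smoothFun) : S.toAnisotropic β kh kv (f + g) =
    S.toAnisotropic β kh kv f + S.toAnisotropic β kh kv g :=
  UniformSpace.Completion.coe_add (α := S.NormedSmoothFun β kh kv) f g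

theorem toAnisotropic_smul (c : ℂ) (f : S.smoothFun) : S.toAnisotropic β kh kv (c • f) =
    c • S.toAnisotropic β kh kv f :=
  UniformSpace.Completion.coe_smul (X := S.NormedSmoothFun β kh kv) c f

/-- Extension by density of linear maps which are bounded for the anisotropic norm. -/
theorem exists_extension {F : Type*} [NormedAddCommGroup F] [NormedSpace ℂ F] [CompleteSpace F]
    (ℓ : S.smoothFun →ₗ[ℂ] F) {C : ℝ} (hC : ∀ f, ‖ℓ f‖ ≤ C * S.anisoNorm β kh kv f) :
    ∃ L : S.AnisotropicSpace β kh kv →L[ℂ] F, ∀ f, L (S.toAnisotropic β kh kv f) = ℓ f := by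
  let ℓ' : S.NormedSmoothFun β kh kv →ₗ[ℂ] F := ℓ
  let ℓc : S.NormedSmoothFun β kh kv →L[ℂ] F := ℓ'.mkContinuous C hC
  refine ⟨ℓc.extend UniformSpace.Completion.toComplL, fun f => ?_⟩
  exact ContinuousLinearMap.extend_eq (e := UniformSpace.Completion.toComplL) ℓc
    UniformSpace.Completion.denseRange_coe (UniformSpace.Completion.isUniformInducing_coe _) f

/-- The functional `f ↦ ∫ φ L_v^j f` along a curve, composed with a pseudo-Anosov map. -/
theorem exists_integral_functional {δ : ℝ} {γ : ℝ → M} (hγ : S.IsHorizontalSegment δ γ)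
    {ψ : ℝ → ℂ} (hψ : ContDiff ℝ ∞ ψ) (hψs : tsupport ψ ⊆ Ioo 0 δ) {j : ℕ} (hj : j ≤ kv)
    {T : M ≃ₜ M} {lam : ℝ} (hT : IsLinearPseudoAnosov S T lam) (hδ : 0 ≤ δ) (hlam : lam * δ = β) :
    ∃ L : S.AnisotropicSpace β kh kv →L[ℂ] ℂ, ∀ f, L (S.toAnisotropic β kh kv f) =
      ∫ t in (0 : ℝ)..δ, ψ t * ((S.Lv ^ j) (hT.comp f) : M → ℂ) (γ t) := by
  obtain ⟨A, hA0, hA⟩ := exists_ckBoundOn_of_smooth hψ hψs kh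
  have hint : ∀ g : S.smoothFun, IntervalIntegrable (fun t => ψ t * (g : M → ℂ) (γ t))
      MeasureTheory.volume 0 δ := fun g => by
    apply ContinuousOn.intervalIntegrable
    rw [uIcc_of_le hδ]
    exact hψ.continuous.continuousOn.mul ((continuous_of_mem g.2).comp_continuousOn hγ.continuousOn)
  let ℓ : S.smoothFun →ₗ[ℂ] ℂ :=
    { toFun := fun f => ∫ t in (0 : ℝ)..δ, ψ t * ((S.Lv ^ j) (hT.comp f) : M → ℂ) (γ t)
      map_add' := fun f g => by
        rw [← intervalIntegral.integral_add (hint _) (hint _)]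
        congr 1
        funext t
        rw [show hT.comp (f + g) = hT.comp f + hT.comp g from rfl, map_add, ← mul_add]
        rfl
      map_smul' := fun c f => by
        rw [RingHom.id_apply, smul_eq_mul, ← intervalIntegral.integral_const_mul]
        congr 1
        funext t
        rw [show hT.comp (c • f) = c • hT.comp f from rfl, map_smul]
        change ψ t * (c * _) = _
        ring }
  refine exists_extension ℓ (C := A * 2) fun f => ?_
  refine (norm_integral_le_of_ckBoundOn hj _ hγ hA hψs hA0).trans ?_
  rw [mul_assoc]
  exact mul_le_mul_of_nonneg_left (anisoNorm_comp_le_two_mul kh kv hT hlam f) hA0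

theorem iterate_apply_toAnisotropic {T : M ≃ₜ M} {lam : ℝ} (hT : IsLinearPseudoAnosov S T lam)
    {A : S.AnisotropicSpace β kh kv →L[ℂ] S.AnisotropicSpace β kh kv}
    (hA : ∀ f, A (S.toAnisotropic β kh kv f) = S.toAnisotropic β kh kv (hT.comp f)) (n : ℕ)
    (f : S.smoothFun) :
    (A ^ n) (S.toAnisotropic β kh kv f) = S.toAnisotropic β kh kv ((hT.comp)^[n] f) := by
  induction n generalizing f with
  | zero => rfl
  | succ n ih =>
    rw [pow_succ, mul_apply_eq_comp, hA, ih, Function.iterate_succ_apply]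

/-- Each positive power is composition with another linear pseudo-Anosov map, and the constant in
`hC` serves for all of them. -/
theorem norm_pow_le {T : M ≃ₜ M} {lam : ℝ} (hT : IsLinearPseudoAnosov S T lam) {C : ℝ}
    (hC0 : 0 ≤ C)
    (hC : ∀ (T : M ≃ₜ M) (lam : ℝ) (hT : IsLinearPseudoAnosov S T lam) (f : S.smoothFun),
      S.anisoNorm β kh kv (hT.comp f) ≤ C * S.anisoNorm β kh kv f)
    {A : S.AnisotropicSpace β kh kv →L[ℂ] S.AnisotropicSpace β kh kv}
    (hA : ∀ f, A (S.toAnisotropic β kh kv f) = S.toAnisotropic β kh kv (hT.comp f)) (n : ℕ) :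
    ‖A ^ (n + 1)‖ ≤ C := by
  refine ContinuousLinearMap.opNorm_le_bound _ hC0 fun v => ?_
  refine denseRange_toAnisotropic.induction_on (p := fun v => ‖(A ^ (n + 1)) v‖ ≤ C * ‖v‖) v
    (isClosed_le (by fun_prop) (by fun_prop)) fun f => ?_
  obtain ⟨T', hT', h⟩ := hT.exists_iterate n
  rw [iterate_apply_toAnisotropic hT hA, ← h, norm_toAnisotropic, norm_toAnisotropic]
  exact hC T' _ hT' f

variable [T2Space M]

/-- Lasota–Yorke inequality on a subspace of finite codimension. -/
theorem exists_finiteCodim_norm_le {T : M ≃ₜ M} {lam : ℝ} (hT : IsLinearPseudoAnosov S T lam)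
    (hβ : 0 < β) {A : S.AnisotropicSpace β kh kv →L[ℂ] S.AnisotropicSpace β kh kv}
    (hA : ∀ f, A (S.toAnisotropic β kh kv f) = S.toAnisotropic β kh kv (hT.comp f)) :
    ∃ (m : ℕ) (C : ℝ), ∀ n : ℕ, ∃ V : Submodule ℂ (S.AnisotropicSpace β kh kv),
      IsClosed (V : Set (S.AnisotropicSpace β kh kv)) ∧
      FiniteDimensional ℂ (S.AnisotropicSpace β kh kv ⧸ V) ∧
      ∀ v ∈ V, ‖(A ^ (n + m)) v‖ ≤ C * (lam ^ (-(min (kh : ℝ) (kv : ℝ)))) ^ n * ‖v‖ := by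
  have hl := hT.pos
  obtain ⟨δ₀, hδ₀, hnet⟩ := exists_hasFiniteNet S
  obtain ⟨m, hm⟩ := pow_unbounded_of_one_lt (β / δ₀) hT.one_lt
  set δ := β / lam ^ (m + 1) with hδdef
  have hδ : 0 < δ := by positivity
  have hlδ : lam ^ (m + 1) * δ = β := mul_div_cancel₀ _ (by positivity)
  have hδβ : δ ≤ β := div_le_self hβ.le (one_le_pow₀ hT.one_lt.le)
  have hδδ₀ : δ ≤ δ₀ := by
    rw [hδdef, div_le_iff₀ (by positivity), ← div_le_iff₀' hδ₀]
    exact hm.le.trans (pow_le_pow_right₀ hT.one_lt.le (Nat.le_succ m))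
  have hnet := hnet δ hδ hδδ₀
  obtain ⟨C, hC0, hLY⟩ := exists_lasotaYorke (S := S) hδ hδβ kh kv
  obtain ⟨T', hT', hT'c⟩ := hT.exists_iterate m
  set r := lam ^ (-(min (kh : ℝ) (kv : ℝ))) with hr
  have hr0 : 0 < r := by positivity
  have hr1 : r ≤ 1 := Real.rpow_le_one_of_one_le_of_nonpos hT.one_lt.le
    (neg_nonpos.2 (le_min kh.2 (Nat.cast_nonneg _)))
  -- `n + (m + 2) = (n + 1) + (m + 1)`: the first applied `m + 1` iterates pass from `β` to `δ`, the
  -- other `n + 1` contract. The `4` comes from two error terms (remainders and net), each with the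
  -- factor `2` of `anisoNorm_comp_le_two_mul`.
  refine ⟨m + 2, 4 * C, fun n => ?_⟩
  have hrn : 0 < r ^ (n + 1) := by positivity
  -- The precision of the nets is `r ^ (n + 1)`, so the approximation error in the weak term is no
  -- larger than the strong term.
  have hnets := fun i => hnet (taylorWindow δ i) (contDiff_taylorWindow δ i)
    (tsupport_taylorWindow hδ i) kh kv (r ^ (n + 1)) hrn
  choose Γ hΓf hΓs hΓ using hnets
  have hL := fun (q : ℕ × ℕ × (ℝ → M)) (hq : q.2.1 < kv ∧ q.2.2 ∈ Γ q.1) =>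
    exists_integral_functional (kh := kh) (hΓs q.1 q.2.2 hq.2) (contDiff_taylorWindow δ q.1)
      (tsupport_taylorWindow hδ q.1) hq.1.le hT' hδ.le hlδ
  choose! L hL using hL
  -- One functional for each Taylor degree, order of vertical derivative and net curve; their common
  -- kernel is the subspace of finite codimension.
  set 𝒬 : Set (ℕ × ℕ × (ℝ → M)) := ⋃ i ∈ Iio (⌊kh⌋₊ + 1), {i} ×ˢ (Iio kv ×ˢ Γ i) with h𝒬
  have h𝒬f : 𝒬.Finite := (finite_Iio _).biUnion fun i _ =>
    (finite_singleton i).prod ((finite_Iio kv).prod (hΓf i))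
  have : Fintype 𝒬 := h𝒬f.fintype
  let Φ : S.AnisotropicSpace β kh kv →L[ℂ] (𝒬 → ℂ) := ContinuousLinearMap.pi fun q => L q.1
  have hmain : ∀ v, ‖(A ^ (n + (m + 2))) v‖ ≤
      C * (r ^ (n + 1) * (2 * ‖v‖) + (r ^ (n + 1) * (2 * ‖v‖) + ‖Φ v‖)) := by
    intro v
    refine denseRange_toAnisotropic.induction_on (p := fun v => ‖(A ^ (n + (m + 2))) v‖ ≤
      C * (r ^ (n + 1) * (2 * ‖v‖) + (r ^ (n + 1) * (2 * ‖v‖) + ‖Φ v‖))) v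
      (isClosed_le (by fun_prop) (by fun_prop)) fun f => ?_
    obtain ⟨T'', hT'', hT''c⟩ := hT.exists_iterate n
    have h2 := anisoNorm_comp_le_two_mul kh kv hT' hlδ f
    have e : hT''.comp (hT'.comp f) = (hT.comp)^[n + (m + 2)] f := by
      rw [hT''c, hT'c, ← Function.iterate_add_apply]
      congr 1
      omega
    rw [iterate_apply_toAnisotropic hT hA, ← e, norm_toAnisotropic, norm_toAnisotropic]
    have hrr : (lam ^ (n + 1)) ^ (-(min (kh : ℝ) (kv : ℝ))) = r ^ (n + 1) := by
      rw [hr, ← Real.rpow_natCast, ← Real.rpow_natCast, ← Real.rpow_mul hl.le,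
        ← Real.rpow_mul hl.le, mul_comm]
    have h3 := hLY T'' _ hT'' (hT'.comp f) (r ^ (n + 1) * S.anisoNorm δ kh kv (hT'.comp f) +
      ‖Φ (S.toAnisotropic β kh kv f)‖)
      (add_nonneg (mul_nonneg hrn.le (anisoNorm_nonneg _ _ _ _)) (norm_nonneg _)) ?_
    · rw [hrr] at h3
      refine h3.trans ?_
      gcongr
    · intro j hj γ hγ i hi
      obtain ⟨γ₀, hγ₀, h4⟩ := hΓ i γ hγ
      have h5 := h4 j hj (hT'.comp f)
      have hq : (i, j, γ₀) ∈ 𝒬 := mem_iUnion₂.2 ⟨i, Nat.lt_succ_of_le hi, rfl, hj, hγ₀⟩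
      have h6 := norm_le_pi_norm (Φ (S.toAnisotropic β kh kv f)) ⟨(i, j, γ₀), hq⟩
      have h7 : Φ (S.toAnisotropic β kh kv f) ⟨(i, j, γ₀), hq⟩ = _ :=
        hL (i, j, γ₀) ⟨hj, hγ₀⟩ f
      rw [h7] at h6
      have h8 := norm_add_le_of_le h5 h6
      rwa [sub_add_cancel] at h8
  refine ⟨LinearMap.ker (Φ : S.AnisotropicSpace β kh kv →ₗ[ℂ] (𝒬 → ℂ)), Φ.isClosed_ker,
    Module.Finite.equiv (LinearMap.quotKerEquivRange
      (Φ : S.AnisotropicSpace β kh kv →ₗ[ℂ] (𝒬 → ℂ))).symm, fun v hv => ?_⟩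
  have h1 := hmain v
  have h0 : Φ v = 0 := hv
  rw [h0, norm_zero, add_zero] at h1
  refine h1.trans ?_
  have h2 : r ^ (n + 1) ≤ r ^ n := pow_le_pow_of_le_one hr0.le hr1 (Nat.le_succ n)
  calc C * (r ^ (n + 1) * (2 * ‖v‖) + r ^ (n + 1) * (2 * ‖v‖))
      = 4 * C * r ^ (n + 1) * ‖v‖ := by ring
    _ ≤ 4 * C * r ^ n * ‖v‖ := by gcongr

end TranslationSurface

end

/-! ### Conclusion -/

theorem theorem3p1 {M : Type*} [TopologicalSpace M] [T2Space M] [CompactSpace M]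
    [ConnectedSpace M] (S : TranslationSurface M) (T : M ≃ₜ M) (lam : ℝ)
    (hT : IsLinearPseudoAnosov S T lam) (β : ℝ) (hβ : 0 < β) (kh : ℝ≥0) (kv : ℕ) :
    ∃ 𝒯 : S.AnisotropicSpace β kh kv →L[ℂ] S.AnisotropicSpace β kh kv,
      (∀ f : S.smoothFun,
        𝒯 (S.toAnisotropic β kh kv f) = S.toAnisotropic β kh kv (hT.comp f)) ∧
      spectralRadius ℂ 𝒯 ≤ 1 ∧
      essSpectralRadius 𝒯 ≤ ENNReal.ofReal (lam ^ (-(min (kh : ℝ) (kv : ℝ)))) := by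
  -- With `δ = β` the same norm stands on both sides, and one constant both extends the operator and
  -- bounds its positive powers.
  obtain ⟨C, hC0, hC⟩ := TranslationSurface.exists_anisoNorm_comp_le (S := S) hβ le_rfl kh kv
  let ℓ : S.smoothFun →ₗ[ℂ] S.AnisotropicSpace β kh kv :=
    { toFun := fun f => S.toAnisotropic β kh kv (hT.comp f)
      map_add' := fun f g => TranslationSurface.toAnisotropic_add (hT.comp f) (hT.comp g)
      map_smul' := fun c f => TranslationSurface.toAnisotropic_smul c (hT.comp f) }
  obtain ⟨A, hA⟩ := TranslationSurface.exists_extension ℓ (C := C) fun f =>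
    (TranslationSurface.norm_toAnisotropic (hT.comp f)).trans_le (hC T lam hT f)
  obtain ⟨m, C', hV⟩ := TranslationSurface.exists_finiteCodim_norm_le hT hβ hA
  exact ⟨A, hA,
    spectralRadius_le_one_of_bounded_pow (TranslationSurface.norm_pow_le hT hC0 hC hA),
    essSpectralRadius_le_of_finiteCodim A (Real.rpow_nonneg hT.pos.le _) m hV⟩
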